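/- **Conventions.** Let $k$ be a field of characteristic $0$, let $\mathfrak g$ be a left Leibniz algebra over $k$, i.e. $[[x,y],z]=[x,[y,z]]-[y,[x,z]]$, let $\mathfrak g^{\mathrm{ann}}$ be the span of all $[x,x]$, let $\mathfrak g_{\mathrm{Lie}}=\mathfrak g/\mathfrak g^{\mathrm{ann}}$ with quotient map $d:\mathfrak g\to\mathfrak g_{\mathrm{Lie}}$; $\mathfrak g_{\mathrm{Lie}}$ acts on $\mathfrak g$ by $dx\cdot y=[x,y]$. $\mathfrak g^{\mathrm{opp}}$ is the right Leibniz algebra with $[x,y]_{\mathrm{opp}}=[y,x]$. $\mathcal E(\mathfrak g)$ is the DG Lie algebra (with $|d|=-1$) generated by the complex $d:\mathfrak g\to\mathfrak g_{\mathrm{Lie}}$, with $\mathfrak g$ in degree $1$ and $\mathfrak g_{\mathrm{Lie}}$ in degree $0$, subject to $\llbracket a,b\rrbracket=[a,b]_{\mathfrak g_{\mathrm{Lie}}}$ and $\llbracket a,x\rrbracket=a\cdot x$ for $a,b\in\mathfrak g_{\mathrm{Lie}}$, $x\in\mathfrak g$. $U(\mathcal E(\mathfrak g))$ is its (DG) universal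 enveloping algebra and $T(\mathfrak g)$ is the tensor algebra, with $\mathfrak g$ in degree $1$. A representation of $\mathfrak g$ is a vector space $\mathfrak m$ with bilinear $[x,m],[m,x]\in\mathfrak m$ such that the left Leibniz identity holds whenever two of the arguments are in $\mathfrak g$ and one is in $\mathfrak m$. Let $\mathfrak m^{\mathrm{anti}}$ be the span of all $[x,m]+[m,x]$ and let $d:\mathfrak m\to\mathfrak m_{\mathrm{symm}}=\mathfrak m/\mathfrak m^{\mathrm{anti}}$ be the quotient map. $\mathcal E(\mathfrak m)$ is the DG $\mathcal E(\mathfrak g)$-module generated by the complex $\mathfrak m\to\mathfrak m_{\mathrm{symm}}$ (degrees $0$ and $-1$) subject to $\llbracket dx,m\rrbracket=[x,m]$ and $\llbracket x,dm\rrbracket=-[m,x]$, together with the consequence $\llbracket dx,dm\rrbracket=d[x,m]$ of the first relation. $\mathcal M(\mathfrak m)$ is the DG $\mathcal E(\mathfrak g)$-module $\mathfrak m^{\mathrm{anti}}\hookrightarrow\mathfrak m\to\mathfrak m_{\mathrm{symm}}$ in degrees $1,0,-1$, on which $\mathfrak g_{\mathrm{Lie}}$ acts through the left bracket, and $\llbracket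 x,m\rrbracket=[x,m]+[m,x]\in\mathfrak m^{\mathrm{anti}}$, $\llbracket x,dm\rrbracket=-[m,x]$ for $x\in\mathfrak g$, $m\in\mathfrak m$. A left DG module is also a right one by $\llbracket e,x\rrbracket=(-1)^{|x||e|+1}\llbracket x,e\rrbracket$. $\overline N$ denotes the graded module obtained from $N$ by replacing $N_i$, $i<0$, by $0$. For a right Leibniz algebra $\mathfrak h$, *Loday's standard complexes* are the following. For a representation $\mathfrak m$ of $\mathfrak h$ (the right Leibniz identity holds when two arguments are in $\mathfrak h$ and one in $\mathfrak m$), $C^n=\mathrm{Hom}_k(\mathfrak h^{\otimes n},\mathfrak m)$ with $$(\delta f)(x_1,\dots,x_{n+1})=[x_1,f(x_2,\dots,x_{n+1})]+\sum_{i=2}^{n+1}(-1)^i[f(\dots,\widehat{x_i},\dots),x_i]+\sum_{1\le i<j\le n+1}(-1)^{j+1}f(\dots,[x_i,x_j],\dots,\widehat{x_j},\dots).$$ For a co-representation $\mathfrak m$ of $\mathfrak h$ (brackets with $[[x,y],m]=[x,[y,m]]-[y,[x,m]]$, $[y,[m,x]]=[[y,m],x]-[m,[x,y]]$, $[[m,x],y]=[m,[x,y]]-[[y,m],x]$),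 $C_n=\mathfrak m\otimes\mathfrak h^{\otimes n}$ with $$\partial(m\otimes x_1\cdots x_n)=[m,x_1]\otimes x_2\cdots x_n+\sum_{i=2}^{n}(-1)^i[x_i,m]\otimes x_1\cdots\widehat{x_i}\cdots x_n+\sum_{1\le i<j\le n}(-1)^{j+1}m\otimes x_1\cdots[x_i,x_j]\cdots\widehat{x_j}\cdots x_n.$$ **Statement.** 1. The map $a\otimes t\mapsto at$ is an isomorphism $U(\mathfrak g_{\mathrm{Lie}})\otimes_k T(\mathfrak g)\cong U(\mathcal E(\mathfrak g))$ of graded left $U(\mathfrak g_{\mathrm{Lie}})$-modules ($U(\mathfrak g_{\mathrm{Lie}})$ in degree $0$). 2. Let $\mathfrak m$ be a $\mathfrak g_{\mathrm{Lie}}$-module, also regarded as a right module by $ma=-a\cdot m$. Then - $\mathfrak m\otimes_{\mathfrak g_{\mathrm{Lie}}}U(\mathcal E(\mathfrak g))$, with $d(m\otimes u)=m\otimes du$, is a chain complex, and the maps $m\otimes x_1\cdots x_n\mapsto m\otimes x_1\otimes\dots\otimes x_n$ are isomorphisms $(\mathfrak m\otimes_{\mathfrak g_{\mathrm{Lie}}}U(\mathcal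 E(\mathfrak g)))_n\cong\mathfrak m\otimes\mathfrak g^{\otimes n}$, $n\ge0$, which take $d$ to $-\partial$, where $\partial$ is Loday's boundary for $\mathfrak g^{\mathrm{opp}}$ and the co-representation $[m,x]=dx\cdot m=-[x,m]$; - $\mathrm{Hom}_{\mathfrak g_{\mathrm{Lie}}}(U(\mathcal E(\mathfrak g)),\mathfrak m)$, with $df=f\circ d$, is a cochain complex, and $f\mapsto\bigl((x_1,\dots,x_n)\mapsto f(x_1\cdots x_n)\bigr)$ are isomorphisms of its degree $n$ part with $\mathrm{Hom}_k(\mathfrak g^{\otimes n},\mathfrak m)$, $n\ge0$, which take $d$ to $-\delta$, where $\delta$ is Loday's coboundary for $\mathfrak g^{\mathrm{opp}}$ and the representation opposite to $[x,m]=dx\cdot m=-[m,x]$. 3. Let $\mathfrak m$ be a representation of $\mathfrak g$. Then - in degrees $n\ge0$ the map $\overline{\mathcal E(\mathfrak m)}\otimes_{\mathcal E(\mathfrak g)}U(\mathcal E(\mathfrak g))\to\mathcal E(\mathfrak m)\otimes_{\mathcal E(\mathfrak g)}U(\mathcal E(\mathfrak g))$ is bijective. With the differential $d(e\otimes u)=de\otimes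 u+(-1)^{|e|}e\otimes du$ of the latter this is a chain complex, and the maps $m\otimes x_1\cdots x_n\mapsto m\otimes x_1\otimes\dots\otimes x_n$ (for $m\in\mathfrak m=\mathcal E_0(\mathfrak m)$) give isomorphisms of its degree $n$ part with $\mathfrak m\otimes\mathfrak g^{\otimes n}$, $n\ge0$, which take $d$ to $-\partial$, where $\partial$ is Loday's boundary for $\mathfrak g^{\mathrm{opp}}$ and the co-representation $[x,m]_c=-[x,m]$, $[m,x]_c=[m,x]+[x,m]$ that corresponds to $\mathfrak m$ (this correspondence is a bijection between representations of $\mathfrak g$ and co-representations of $\mathfrak g^{\mathrm{opp}}$ on the space $\mathfrak m$); - for $n\ge0$ let $\mathrm{Hom}^n$ be the space of degree $-n$ morphisms $f$ from $U(\mathcal E(\mathfrak g))$ to $\overline{\mathcal M(\mathfrak m)}$, that is, of the linear maps $f$ of degree $-n$ with $f(xu)=(-1)^{n|x|}xf(u)$ for homogeneous $x\in\mathcal E(\mathfrak g)$ and $u\in U(\mathcal E(\mathfrak g))$, $|u|\ge n$. With $df=f\circ d-(-1)^{\deg f}d\circ f$ these spaces form a cochain complex, and $f\mapsto\bigl((x_1,\dots,x_n)\mapsto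 f(x_1\cdots x_n)\in\overline{\mathcal M(\mathfrak m)}_0=\mathfrak m\bigr)$ are isomorphisms $\mathrm{Hom}^n\cong\mathrm{Hom}_k(\mathfrak g^{\otimes n},\mathfrak m)$, $n\ge0$, which take $d$ to $-\delta$, where $\delta$ is Loday's coboundary for $\mathfrak g^{\mathrm{opp}}$ with coefficients in $\mathfrak m^{\mathrm{opp}}$ (the brackets of $\mathfrak m$ with the arguments exchanged). -/

import Mathlib

open scoped TensorProduct DirectSum

namespace Leib

universe u v w

section Leibniz

variable {k : Type u} [Field k] {g : Type v} [AddCommGroup g] [Module k g]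

/-- A left Leibniz algebra structure on the vector space `g`. -/
structure LeftLeibniz (k : Type u) [Field k] (g : Type v) [AddCommGroup g] [Module k g] where
  /-- the bracket `[x, y]` -/
  br : g →ₗ[k] g →ₗ[k] g
  leibniz : ∀ x y z, br (br x y) z = br x (br y z) - br y (br x z)

/-- A right Leibniz algebra structure on the vector space `g`. -/
structure RightLeibniz (k : Type u) [Field k] (g : Type v) [AddCommGroup g] [Module k g] where
  /-- the bracket `[x, y]` -/
  br : g →ₗ[k] g →ₗ[k] g
  leibniz : ∀ x y z, br x (br y z) = br (br x y) z - br (br x z) y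

/-- The opposite right Leibniz algebra: `[x, y]_opp = [y, x]`. -/
def LeftLeibniz.opp (G : LeftLeibniz k g) : RightLeibniz k g where
  br := G.br.flip
  leibniz x y z := by simp [G.leibniz]

namespace LeftLeibniz

variable (G : LeftLeibniz k g)

/-- The kernel `g^ann`: the span of the squares `[x, x]`. -/
def ann : Submodule k g := Submodule.span k (Set.range fun x => G.br x x)

lemma symm_mem_ann (x y : g) : G.br x y + G.br y x ∈ G.ann := by
  have h (z : g) : G.br z z ∈ G.ann := Submodule.subset_span ⟨z, rfl⟩
  have h1 := G.ann.sub_mem (G.ann.sub_mem (h (x + y)) (h x)) (h y)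
  convert h1 using 1
  simp only [map_add, LinearMap.add_apply]
  abel

lemma br_ann_left {x : g} (hx : x ∈ G.ann) (y : g) : G.br x y = 0 := by
  induction hx using Submodule.span_induction with
  | mem x h => obtain ⟨z, rfl⟩ := h; simp [G.leibniz]
  | zero => simp
  | add a b _ _ ha hb => simp [ha, hb]
  | smul c a _ ha => simp [ha]

lemma br_ann_right (y : g) {x : g} (hx : x ∈ G.ann) : G.br y x ∈ G.ann := by
  have := G.symm_mem_ann y x
  rwa [G.br_ann_left hx, add_zero] at this

/-- The maximal Lie quotient `g_Lie = g / g^ann`. -/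
def LieQuot : Type v := g ⧸ G.ann

instance : AddCommGroup G.LieQuot := inferInstanceAs (AddCommGroup (g ⧸ G.ann))
instance : Module k G.LieQuot := inferInstanceAs (Module k (g ⧸ G.ann))

/-- The quotient map `d : g → g_Lie`. -/
def toLie : g →ₗ[k] G.LieQuot := G.ann.mkQ

lemma toLie_surjective : Function.Surjective G.toLie := G.ann.mkQ_surjective

lemma toLie_eq_zero_iff {x : g} : G.toLie x = 0 ↔ x ∈ G.ann :=
  Submodule.Quotient.mk_eq_zero _

/-- The left action of `g_Lie` on `g`: `dx · y = [x, y]`. -/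
def lieAct : G.LieQuot →ₗ[k] g →ₗ[k] g :=
  G.ann.liftQ G.br fun x hx => by
    ext y
    exact G.br_ann_left hx y

@[simp] lemma lieAct_toLie (x y : g) : G.lieAct (G.toLie x) y = G.br x y := rfl

/-- The bracket of `g_Lie`, induced by that of `g`. -/
def lieBr : G.LieQuot →ₗ[k] G.LieQuot →ₗ[k] G.LieQuot :=
  G.ann.liftQ
    (LinearMap.mk₂ k (fun x (b : G.LieQuot) =>
        (G.ann.liftQ (G.toLie ∘ₗ G.br x) fun y hy =>
          G.toLie_eq_zero_iff.2 (G.br_ann_right x hy) : G.LieQuot →ₗ[k] G.LieQuot) b)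
      (fun x x' b => by
        obtain ⟨b, rfl⟩ := G.toLie_surjective b
        change G.toLie (G.br (x + x') b) = G.toLie (G.br x b) + G.toLie (G.br x' b)
        simp)
      (fun c x b => by
        obtain ⟨b, rfl⟩ := G.toLie_surjective b
        change G.toLie (G.br (c • x) b) = c • G.toLie (G.br x b)
        simp)
      (fun x b b' => map_add _ b b')
      (fun c x b => map_smul _ c b))
    fun x hx => by
      ext b
      obtain ⟨b, rfl⟩ := G.toLie_surjective b
      change G.toLie (G.br x b) = 0
      rw [G.br_ann_left hx, map_zero]

@[simp] lemma lieBr_toLie (x y : g) :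
    G.lieBr (G.toLie x) (G.toLie y) = G.toLie (G.br x y) := rfl

instance : LieRing G.LieQuot where
  bracket a b := G.lieBr a b
  add_lie a b c := by change G.lieBr _ _ = G.lieBr _ _ + G.lieBr _ _; simp
  lie_add a b c := by change G.lieBr _ _ = G.lieBr _ _ + G.lieBr _ _; simp
  lie_self a := by
    obtain ⟨a, rfl⟩ := G.toLie_surjective a
    change G.lieBr _ _ = 0
    rw [lieBr_toLie, toLie_eq_zero_iff]
    exact Submodule.subset_span ⟨a, rfl⟩
  leibniz_lie a b c := by
    obtain ⟨a, rfl⟩ := G.toLie_surjective a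
    obtain ⟨b, rfl⟩ := G.toLie_surjective b
    obtain ⟨c, rfl⟩ := G.toLie_surjective c
    change G.lieBr _ (G.lieBr _ _) = G.lieBr (G.lieBr _ _) _ + G.lieBr _ (G.lieBr _ _)
    simp [G.leibniz]

instance : LieAlgebra k G.LieQuot where
  lie_smul c a b := by change G.lieBr _ _ = c • G.lieBr _ _; simp

lemma toLie_lie (x y : g) : ⁅G.toLie x, G.toLie y⁆ = G.toLie (G.br x y) := rfl

lemma toLie_lieAct (a : G.LieQuot) (y : g) : G.toLie (G.lieAct a y) = ⁅a, G.toLie y⁆ := by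
  obtain ⟨a, rfl⟩ := G.toLie_surjective a
  rfl

end LeftLeibniz

/-- A representation of a left Leibniz algebra: `l x m = [x, m]`, `r m x = [m, x]`. -/
structure LeftLeibniz.Rep (G : LeftLeibniz k g) (m : Type w) [AddCommGroup m] [Module k m] where
  l : g →ₗ[k] m →ₗ[k] m
  r : m →ₗ[k] g →ₗ[k] m
  mll : ∀ a x y, r (r a x) y = r a (G.br x y) - l x (r a y)
  lml : ∀ x a y, r (l x a) y = l x (r a y) - r a (G.br x y)
  llm : ∀ x y a, l (G.br x y) a = l x (l y a) - l y (l x a)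

/-- A representation of a right Leibniz algebra: `l x m = [x, m]`, `r m x = [m, x]`. -/
structure RightLeibniz.Rep (H : RightLeibniz k g) (m : Type w) [AddCommGroup m] [Module k m] where
  l : g →ₗ[k] m →ₗ[k] m
  r : m →ₗ[k] g →ₗ[k] m
  mll : ∀ a x y, r a (H.br x y) = r (r a x) y - r (r a y) x
  lml : ∀ x a y, l x (r a y) = r (l x a) y - l (H.br x y) a
  llm : ∀ x y a, l x (l y a) = l (H.br x y) a - r (l x a) y

/-- A co-representation (in the sense of Loday and Pirashvili) of a right Leibniz algebra:
`l x m = [x, m]`, `r m x = [m, x]`. -/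
structure RightLeibniz.Corep (H : RightLeibniz k g) (m : Type w)
    [AddCommGroup m] [Module k m] where
  l : g →ₗ[k] m →ₗ[k] m
  r : m →ₗ[k] g →ₗ[k] m
  mll : ∀ x y a, l (H.br x y) a = l x (l y a) - l y (l x a)
  lml : ∀ x y a, l y (r a x) = r (l y a) x - r a (H.br x y)
  llm : ∀ x y a, r (r a x) y = r a (H.br x y) - r (l y a) x

section Coefficients

variable {G : LeftLeibniz k g} {m : Type w} [AddCommGroup m] [Module k m]

/-- The opposite representation `m^opp` of `g^opp`: `[x, m]_opp = [m, x]`, `[m, x]_opp = [x, m]`. -/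
def LeftLeibniz.Rep.opp (V : G.Rep m) : G.opp.Rep m where
  l := V.r.flip
  r := V.l.flip
  mll a x y := by simp [LeftLeibniz.opp, V.llm]
  lml x a y := by simp [LeftLeibniz.opp, V.lml]
  llm x y a := by simp [LeftLeibniz.opp, V.mll]

/-- The translation between representations of a left Leibniz algebra `g` and co-representations
of the right Leibniz algebra `g^opp`: the representation with brackets `[x, a]`, `[a, x]`
corresponds to the co-representation with brackets `-[x, a]` and `[a, x] + [x, a]`. -/
def LeftLeibniz.repEquivCorep : G.Rep m ≃ G.opp.Corep m where
  toFun V :=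
    { l := -V.l
      r := V.r + V.l.flip
      mll := fun x y a => by
        simp [LeftLeibniz.opp, V.llm]
      lml := fun x y a => by
        simp [LeftLeibniz.opp, V.llm, V.lml]
        abel
      llm := fun x y a => by
        simp [LeftLeibniz.opp, V.llm, V.lml, V.mll]
        abel }
  invFun A :=
    { l := -A.l
      r := A.r + A.l.flip
      mll := fun a x y => by
        have h1 := A.mll y x a
        have h2 := A.lml y x a
        have h3 := A.llm x y a
        have h4 := A.llm y x a
        have h5 := A.lml x y a
        simp only [LeftLeibniz.opp, LinearMap.flip_apply, LinearMap.add_apply,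
          LinearMap.neg_apply, map_add] at *
        rw [h1, h3, h2, h5]
        abel
      lml := fun x a y => by
        have h1 := A.mll y x a
        have h2 := A.lml y x a
        simp only [LeftLeibniz.opp, LinearMap.flip_apply, LinearMap.add_apply,
          LinearMap.neg_apply, map_add, map_neg] at *
        rw [h1, h2]
        abel
      llm := fun x y a => by
        have h1 := A.mll y x a
        simp only [LeftLeibniz.opp, LinearMap.flip_apply, LinearMap.neg_apply, map_neg] at *
        rw [h1]
        abel }
  left_inv V := by
    cases V
    simp only [LeftLeibniz.Rep.mk.injEq, neg_neg, true_and]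
    ext a x
    simp
  right_inv A := by
    cases A
    simp only [RightLeibniz.Corep.mk.injEq, neg_neg, true_and]
    ext a x
    simp

variable (G m) [LieRingModule G.LieQuot m] [LieModule k G.LieQuot m]

/-- The operator `x ↦ (a ↦ dx · a)` on a `g_Lie`-module. -/
def LeftLeibniz.lieOp : g →ₗ[k] m →ₗ[k] m :=
  (LieModule.toEnd k G.LieQuot m : G.LieQuot →ₗ[k] Module.End k m) ∘ₗ G.toLie

@[simp] lemma LeftLeibniz.lieOp_apply (x : g) (a : m) : G.lieOp m x a = ⁅G.toLie x, a⁆ := rfl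

/-- A `g_Lie`-module as a (symmetric) representation of `g`: `[x, a] = dx · a = -[a, x]`. -/
def LeftLeibniz.lieRep : G.Rep m where
  l := G.lieOp m
  r := -(G.lieOp m).flip
  mll a x y := by simp [← G.toLie_lie]
  lml x a y := by
    simp [← G.toLie_lie]
    abel
  llm x y a := by simp [← G.toLie_lie]

/-- A `g_Lie`-module as a (symmetric) co-representation of the right Leibniz algebra `g^opp`:
`[a, x] = dx · a = -[x, a]`. -/
def LeftLeibniz.lieCorep : G.opp.Corep m where
  l := -G.lieOp m
  r := (G.lieOp m).flip
  mll x y a := by simp [LeftLeibniz.opp, ← G.toLie_lie]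
  lml x y a := by
    simp [LeftLeibniz.opp, ← G.toLie_lie]
    abel
  llm x y a := by simp [LeftLeibniz.opp, ← G.toLie_lie]

end Coefficients

section LodayComplexes

variable {H : RightLeibniz k g} {m : Type w} [AddCommGroup m] [Module k m] {n : ℕ}

/-- For an `n`-linear `f`, the map `y ↦ (z ↦ f (z_0, ..., [z_i, y], ..., z_{n-1}))`. -/
def RightLeibniz.insertBr {W : Type*} [AddCommGroup W] [Module k W] (H : RightLeibniz k g)
    (f : MultilinearMap k (fun _ : Fin n => g) W) (i : Fin n) :
    g →ₗ[k] MultilinearMap k (fun _ : Fin n => g) W where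
  toFun y := MultilinearMap.mk' (fun z => f (Function.update z i (H.br (z i) y)))
    (fun z j a b => by
      by_cases h : j = i
      · subst h; simp
      · rw [Function.update_of_ne (Ne.symm h), Function.update_of_ne (Ne.symm h),
          Function.update_of_ne (Ne.symm h), Function.update_comm h, Function.update_comm h,
          Function.update_comm h, f.map_update_add])
    (fun z j c a => by
      by_cases h : j = i
      · subst h; simp
      · rw [Function.update_of_ne (Ne.symm h), Function.update_of_ne (Ne.symm h),
          Function.update_comm h, Function.update_comm h, f.map_update_smul])
  map_add' a b := by ext z; simp
  map_smul' c a := by ext z; simp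

/-- For bilinear `P` and an `n`-linear `f`, the map `y ↦ (z ↦ P y (f z))`. -/
def opTerm {W Z : Type*} [AddCommGroup W] [Module k W] [AddCommGroup Z] [Module k Z]
    (P : g →ₗ[k] W →ₗ[k] Z) (f : MultilinearMap k (fun _ : Fin n => g) W) :
    g →ₗ[k] MultilinearMap k (fun _ : Fin n => g) Z where
  toFun y := (P y).compMultilinearMap f
  map_add' a b := by ext z; simp
  map_smul' c a := by ext z; simp

/-- The value of the Loday coboundary operator on an `n`-linear map; see `cohomFun_apply`. -/
def RightLeibniz.Rep.cohomFun (V : H.Rep m) (f : MultilinearMap k (fun _ : Fin n => g) m) :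
    MultilinearMap k (fun _ : Fin (n + 1) => g) m :=
  LinearMap.uncurryMid (M := fun _ => g) 0 (opTerm V.l f)
    + ∑ i : Fin n, (-1 : k) ^ (i : ℕ) •
        LinearMap.uncurryMid (M := fun _ => g) i.succ (opTerm V.r.flip f)
    + ∑ j : Fin (n + 1), ∑ i : Fin n with i.castSucc < j,
        (-1 : k) ^ (j : ℕ) • LinearMap.uncurryMid (M := fun _ => g) j (H.insertBr f i)

/-- The Loday coboundary (indices start from `0`):
`(df)(x_0, ..., x_n) = [x_0, f(x_1, ..., x_n)] + ∑_{1 ≤ i ≤ n} (-1)^{i-1} [f(..., x̂_i, ...), x_i]`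
`+ ∑_{i < j} (-1)^j f(x_0, ..., [x_i, x_j], ..., x̂_j, ..., x_n)`. -/
lemma RightLeibniz.Rep.cohomFun_apply (V : H.Rep m)
    (f : MultilinearMap k (fun _ : Fin n => g) m) (x : Fin (n + 1) → g) :
    V.cohomFun f x =
      V.l (x 0) (f fun l => x l.succ)
      + ∑ i : Fin n, (-1 : k) ^ (i : ℕ) • V.r (f fun l => x (i.succ.succAbove l)) (x i.succ)
      + ∑ j : Fin (n + 1), ∑ i : Fin n with i.castSucc < j, (-1 : k) ^ (j : ℕ) •
          f (Function.update (fun l => x (j.succAbove l)) i (H.br (x i.castSucc) (x j))) := by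
  simp only [RightLeibniz.Rep.cohomFun, add_apply, sum_apply, smul_apply,
    LinearMap.uncurryMid_apply, opTerm, RightLeibniz.insertBr, LinearMap.coe_mk, AddHom.coe_mk,
    LinearMap.compMultilinearMap_apply, MultilinearMap.mk'_apply, LinearMap.flip_apply]
  congr 1
  refine Finset.sum_congr rfl fun j _ => Finset.sum_congr rfl fun i hi => ?_
  have hi' : i.castSucc < j := by simpa using hi
  simp only [Fin.removeNth_apply, Fin.succAbove_of_castSucc_lt _ _ hi']
  rfl

/-- The differential of the standard complex `Hom(h^{⊗ *}, m)` for the cohomology of a right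
Leibniz algebra `h` with coefficients in a representation `m`; see `cohomFun_apply`. -/
def RightLeibniz.Rep.cohomD (V : H.Rep m) (n : ℕ) :
    MultilinearMap k (fun _ : Fin n => g) m →ₗ[k]
      MultilinearMap k (fun _ : Fin (n + 1) => g) m where
  toFun := V.cohomFun
  map_add' f f' := by
    ext x
    simp only [RightLeibniz.Rep.cohomFun_apply, add_apply, map_add, LinearMap.add_apply, smul_add,
      Finset.sum_add_distrib]
    abel
  map_smul' c f := by
    ext x
    simp only [RightLeibniz.Rep.cohomFun_apply, smul_apply, map_smul, LinearMap.smul_apply,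
      smul_comm _ c, Finset.smul_sum, smul_add, RingHom.id_apply]

/-- The multilinear map `(x_1, ..., x_n) ↦ (a ↦ a ⊗ x_1 ⊗ ... ⊗ x_n)`. -/
def tensorPure (k : Type u) [Field k] (g : Type v) [AddCommGroup g] [Module k g]
    (m : Type w) [AddCommGroup m] [Module k m] (n : ℕ) :
    MultilinearMap k (fun _ : Fin n => g) (m →ₗ[k] m ⊗[k] (⨂[k] (_ : Fin n), g)) :=
  (TensorProduct.mk k m (⨂[k] (_ : Fin n), g)).flip.compMultilinearMap (PiTensorProduct.tprod k)

@[simp] lemma tensorPure_apply (x : Fin n → g) (a : m) :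
    tensorPure k g m n x a = a ⊗ₜ PiTensorProduct.tprod k x := rfl

/-- Precomposition of the operators of a bilinear map `g × m → m`, as a bilinear map. -/
def precomp {W : Type*} [AddCommGroup W] [Module k W] (P : g →ₗ[k] m →ₗ[k] m) :
    g →ₗ[k] (m →ₗ[k] W) →ₗ[k] (m →ₗ[k] W) :=
  LinearMap.mk₂ k (fun y φ => φ ∘ₗ P y)
    (by intros; ext; simp) (by intros; ext; simp) (by intros; ext; simp) (by intros; ext; simp)

/-- The Loday boundary operator as a multilinear map; see `homD_tmul`. -/
def RightLeibniz.Corep.homFun (A : H.Corep m) (n : ℕ) :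
    MultilinearMap k (fun _ : Fin (n + 1) => g) (m →ₗ[k] m ⊗[k] (⨂[k] (_ : Fin n), g)) :=
  LinearMap.uncurryMid (M := fun _ => g) 0 (opTerm (precomp A.r.flip) (tensorPure k g m n))
    + ∑ i : Fin n, (-1 : k) ^ (i : ℕ) • LinearMap.uncurryMid (M := fun _ => g) i.succ
        (opTerm (precomp A.l) (tensorPure k g m n))
    + ∑ j : Fin (n + 1), ∑ i : Fin n with i.castSucc < j, (-1 : k) ^ (j : ℕ) •
        LinearMap.uncurryMid (M := fun _ => g) j (H.insertBr (tensorPure k g m n) i)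

/-- The differential of the standard complex `m ⊗ h^{⊗ *}` for the homology of a right
Leibniz algebra `h` with coefficients in a co-representation `m`; see `homD_tmul`. -/
def RightLeibniz.Corep.homD (A : H.Corep m) (n : ℕ) :
    m ⊗[k] (⨂[k] (_ : Fin (n + 1)), g) →ₗ[k] m ⊗[k] (⨂[k] (_ : Fin n), g) :=
  TensorProduct.lift (PiTensorProduct.lift (A.homFun n)).flip

/-- The Loday boundary (indices start from `0`):
`d(a ⊗ x_0 ⋯ x_n) = [a, x_0] ⊗ x_1 ⋯ x_n + ∑_{1 ≤ i ≤ n} (-1)^{i-1} [x_i, a] ⊗ x_0 ⋯ x̂_i ⋯ x_n`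
`+ ∑_{i < j} (-1)^j a ⊗ x_0 ⋯ [x_i, x_j] ⋯ x̂_j ⋯ x_n`. -/
lemma RightLeibniz.Corep.homD_tmul (A : H.Corep m) (a : m) (x : Fin (n + 1) → g) :
    A.homD n (a ⊗ₜ PiTensorProduct.tprod k x) =
      A.r a (x 0) ⊗ₜ PiTensorProduct.tprod k (fun l => x l.succ)
      + ∑ i : Fin n, (-1 : k) ^ (i : ℕ) •
          A.l (x i.succ) a ⊗ₜ PiTensorProduct.tprod k (fun l => x (i.succ.succAbove l))
      + ∑ j : Fin (n + 1), ∑ i : Fin n with i.castSucc < j, (-1 : k) ^ (j : ℕ) •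
          a ⊗ₜ PiTensorProduct.tprod k
            (Function.update (fun l => x (j.succAbove l)) i (H.br (x i.castSucc) (x j))) := by
  simp only [RightLeibniz.Corep.homD, TensorProduct.lift.tmul, LinearMap.flip_apply,
    PiTensorProduct.lift.tprod, RightLeibniz.Corep.homFun, add_apply, sum_apply, smul_apply,
    LinearMap.uncurryMid_apply, opTerm, RightLeibniz.insertBr, LinearMap.coe_mk, AddHom.coe_mk,
    LinearMap.compMultilinearMap_apply, MultilinearMap.mk'_apply, LinearMap.add_apply,
    LinearMap.sum_apply, LinearMap.smul_apply, precomp, LinearMap.mk₂_apply, LinearMap.comp_apply,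
    tensorPure_apply]
  congr 1
  refine Finset.sum_congr rfl fun j _ => Finset.sum_congr rfl fun i hi => ?_
  have hi' : i.castSucc < j := by simpa using hi
  simp only [Fin.removeNth_apply, Fin.succAbove_of_castSucc_lt _ _ hi']
  rfl

end LodayComplexes

end Leibniz

section DG

/-- The sign `(-1)^n` in `k`. -/
def sgn (k : Type u) [Field k] (n : ℤ) : k := ((n.negOnePow : ℤ) : k)

lemma sgn_eq_ite (k : Type u) [Field k] (n : ℤ) : sgn k n = if Even n then 1 else -1 := by
  unfold sgn
  split_ifs with h
  · simp [Int.negOnePow_even n h]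
  · simp [Int.negOnePow_odd n (Int.not_even_iff_odd.1 h)]

/-- A differential graded Lie algebra `L = ⨁ L_i` over `k`, with differential of degree `-1`. The
bracket `L_i × L_j → L_n` is indexed by proofs of `i + j = n`, the differential `L_i → L_j` by
proofs of `j + 1 = i`. -/
structure DGLie (k : Type u) [Field k] where
  X : ℤ → Type v
  [addCommGroup : ∀ i, AddCommGroup (X i)]
  [module : ∀ i, Module k (X i)]
  br : ∀ {i j n : ℤ}, i + j = n → X i →ₗ[k] X j →ₗ[k] X n
  d : ∀ {i j : ℤ}, j + 1 = i → X i →ₗ[k] X j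
  br_symm : ∀ {i j n : ℤ} (h : i + j = n) (h' : j + i = n) (x : X i) (y : X j),
    br h x y = sgn k (i * j + 1) • br h' y x
  jacobi : ∀ {i j l ij jl li n : ℤ} (h₁ : j + l = jl) (h₂ : i + jl = n) (h₃ : l + i = li)
    (h₄ : j + li = n) (h₅ : i + j = ij) (h₆ : l + ij = n) (x : X i) (y : X j) (z : X l),
    sgn k (i * l) • br h₂ x (br h₁ y z) + sgn k (j * i) • br h₄ y (br h₃ z x)
      + sgn k (l * j) • br h₆ z (br h₅ x y) = 0
  d_d : ∀ {i j l : ℤ} (h : j + 1 = i) (h' : l + 1 = j) (x : X i), d h' (d h x) = 0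
  d_br : ∀ {i j n i' j' n' : ℤ} (h : i + j = n) (hn : n' + 1 = n) (hi : i' + 1 = i)
    (hj : j' + 1 = j) (h₁ : i' + j = n') (h₂ : i + j' = n') (x : X i) (y : X j),
    d hn (br h x y) = br h₁ (d hi x) y + sgn k i • br h₂ x (d hj y)

attribute [instance] DGLie.addCommGroup DGLie.module

/-- A graded (left) module over the graded Lie algebra underlying `L`. -/
structure GrModule {k : Type u} [Field k] (L : DGLie.{u, v} k) where
  X : ℤ → Type w
  [addCommGroup : ∀ i, AddCommGroup (X i)]
  [module : ∀ i, Module k (X i)]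
  act : ∀ {i p q : ℤ}, i + p = q → L.X i →ₗ[k] X p →ₗ[k] X q
  act_br : ∀ {i j n p r s q : ℤ} (h : i + j = n) (h₀ : n + p = q) (h₁ : j + p = r)
    (h₂ : i + r = q) (h₃ : i + p = s) (h₄ : j + s = q) (x : L.X i) (y : L.X j) (e : X p),
    act h₀ (L.br h x y) e = act h₂ x (act h₁ y e) - sgn k (j * i) • act h₄ y (act h₃ x e)

attribute [instance] GrModule.addCommGroup GrModule.module

/-- A differential graded (left) module over `L`. -/
structure DGModule {k : Type u} [Field k] (L : DGLie.{u, v} k) extends GrModule.{u, v, w} L where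
  d : ∀ {p q : ℤ}, q + 1 = p → X p →ₗ[k] X q
  d_d : ∀ {p q r : ℤ} (h : q + 1 = p) (h' : r + 1 = q) (e : X p), d h' (d h e) = 0
  d_act : ∀ {i p n i' p' n' : ℤ} (h : i + p = n) (hn : n' + 1 = n) (hi : i' + 1 = i)
    (hp : p' + 1 = p) (h₁ : i' + p = n') (h₂ : i + p' = n') (x : L.X i) (e : X p),
    d hn (act h x e) = act h₁ (L.d hi x) e + sgn k i • act h₂ x (d hp e)

namespace DGLie

variable {k : Type u} [Field k] (L : DGLie.{u, v} k)

/-- The total space `⨁ L_i`. -/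
abbrev Tot : Type v := ⨁ i, L.X i

/-- The inclusion of `L_i` into the total space. -/
abbrev of (i : ℤ) : L.X i →ₗ[k] L.Tot := DirectSum.lof k ℤ L.X i

/-- The defining relations `x y - (-1)^{|x||y|} y x = ⟦x, y⟧` of the universal enveloping algebra. -/
inductive URel : TensorAlgebra k L.Tot → TensorAlgebra k L.Tot → Prop
  | br {i j n : ℤ} (h : i + j = n) (x : L.X i) (y : L.X j) :
    URel
      (TensorAlgebra.ι k (L.of i x) * TensorAlgebra.ι k (L.of j y)
        - sgn k (i * j) • (TensorAlgebra.ι k (L.of j y) * TensorAlgebra.ι k (L.of i x)))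
      (TensorAlgebra.ι k (L.of n (L.br h x y)))

/-- The universal enveloping algebra `U(L)`. -/
def U : Type (max u v) := RingQuot L.URel

instance : Ring L.U := inferInstanceAs (Ring (RingQuot L.URel))
instance : Algebra k L.U := inferInstanceAs (Algebra k (RingQuot L.URel))

/-- The quotient map from the tensor algebra. -/
def mkU : TensorAlgebra k L.Tot →ₐ[k] L.U := RingQuot.mkAlgHom k L.URel

/-- The canonical map `⨁ L_i → U(L)`. -/
def totι : L.Tot →ₗ[k] L.U := L.mkU.toLinearMap ∘ₗ TensorAlgebra.ι k

/-- The canonical map `L_i → U(L)`. -/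
def ι (i : ℤ) : L.X i →ₗ[k] L.U := L.totι ∘ₗ L.of i

lemma totι_of (i : ℤ) (x : L.X i) : L.totι (L.of i x) = L.ι i x := rfl

lemma ι_br {i j n : ℤ} (h : i + j = n) (x : L.X i) (y : L.X j) :
    L.ι i x * L.ι j y - sgn k (i * j) • (L.ι j y * L.ι i x) = L.ι n (L.br h x y) := by
  have : L.mkU _ = L.mkU _ := RingQuot.mkAlgHom_rel k (URel.br h x y)
  rwa [map_sub, map_smul, map_mul, map_mul] at this

/-- The universal property of `U(L)`. -/
def Ulift {A : Type*} [Ring A] [Algebra k A] (f : L.Tot →ₗ[k] A)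
    (hf : ∀ {i j n : ℤ} (h : i + j = n) (x : L.X i) (y : L.X j),
      f (L.of i x) * f (L.of j y) - sgn k (i * j) • (f (L.of j y) * f (L.of i x))
        = f (L.of n (L.br h x y))) : L.U →ₐ[k] A :=
  RingQuot.liftAlgHom k ⟨TensorAlgebra.lift k f, fun a b r => by
    cases r with
    | br h x y => simpa using hf h x y⟩

lemma Ulift_totι {A : Type*} [Ring A] [Algebra k A] (f : L.Tot →ₗ[k] A) (hf) (z : L.Tot) :
    L.Ulift f hf (L.totι z) = f z := by
  have h : L.Ulift f hf (L.totι z) = TensorAlgebra.lift k f (TensorAlgebra.ι k z) :=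
    RingQuot.liftAlgHom_mkAlgHom_apply k _ _ _
  rw [h, TensorAlgebra.lift_ι_apply]

lemma U_induction {P : L.U → Prop} (algebraMap : ∀ c : k, P (algebraMap k L.U c))
    (gen : ∀ z : L.Tot, P (L.totι z)) (mul : ∀ u v, P u → P v → P (u * v))
    (add : ∀ u v, P u → P v → P (u + v)) (u : L.U) : P u := by
  obtain ⟨t, rfl⟩ : ∃ t, L.mkU t = u := RingQuot.mkAlgHom_surjective k _ u
  induction t using TensorAlgebra.induction with
  | algebraMap c => simpa using algebraMap c
  | ι z => exact gen z
  | mul a b ha hb => simpa using mul _ _ ha hb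
  | add a b ha hb => simpa using add _ _ ha hb

/-- The grading involution `x ↦ (-1)^{|x|} x` of the total space. -/
def totσ : L.Tot →ₗ[k] L.Tot := DirectSum.toModule k ℤ _ fun i => sgn k i • L.of i

/-- The differential of the total space. -/
def totD : L.Tot →ₗ[k] L.Tot :=
  DirectSum.toModule k ℤ _ fun i => L.of (i - 1) ∘ₗ L.d (sub_add_cancel i 1)

lemma totσ_of (i : ℤ) (x : L.X i) : L.totσ (L.of i x) = sgn k i • L.of i x := by
  simp [totσ]

lemma totD_of {i j : ℤ} (h : j + 1 = i) (x : L.X i) : L.totD (L.of i x) = L.of j (L.d h x) := by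
  obtain rfl : j = i - 1 := by omega
  simp [totD]

/-- The homomorphism `U(L) → M_2(U(L))` with `x ↦ ((-1)^{|x|} x, dx; 0, x)`; its upper right
entry is the differential of `U(L)`. -/
def Umat : L.U →ₐ[k] Matrix (Fin 2) (Fin 2) L.U :=
  L.Ulift
    { toFun := fun z => !![L.totι (L.totσ z), L.totι (L.totD z); 0, L.totι z]
      map_add' := fun a b => by ext i j; fin_cases i <;> fin_cases j <;> simp
      map_smul' := fun c a => by ext i j; fin_cases i <;> fin_cases j <;> simp }
    (fun {i j n} h x y => by
      have hi := sub_add_cancel i 1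
      have hj := sub_add_cancel j 1
      have hn := sub_add_cancel n 1
      have h1 : (i - 1) + j = n - 1 := by omega
      have h2 : i + (j - 1) = n - 1 := by omega
      have e0 := L.ι_br h x y
      have e1 := L.ι_br h1 (L.d hi x) y
      have e2 := L.ι_br h2 x (L.d hj y)
      have e3 := L.d_br h hn hi hj h1 h2 x y
      simp only [LinearMap.coe_mk, AddHom.coe_mk, totσ_of, L.totD_of hi, L.totD_of hj,
        L.totD_of hn, totι_of, map_smul, e3, map_add, ← e0, ← e1, ← e2]
      subst h
      ext a b
      fin_cases a <;> fin_cases b <;> simp [Matrix.mul_apply, Fin.sum_univ_two] <;>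
      by_cases pi : Even i <;> by_cases pj : Even j <;>
        simp [sgn_eq_ite, Int.even_add, Int.even_mul, pi, pj,
          ← Int.not_even_iff_odd] <;> abel)

lemma Umat_totι (z : L.Tot) :
    L.Umat (L.totι z) = !![L.totι (L.totσ z), L.totι (L.totD z); 0, L.totι z] :=
  L.Ulift_totι _ _ z

lemma Umat_lower (u : L.U) : L.Umat u 1 0 = 0 ∧ L.Umat u 1 1 = u := by
  induction u using L.U_induction with
  | algebraMap c => simp [Algebra.algebraMap_eq_smul_one]
  | gen z => simp [Umat_totι]
  | mul u v hu hv => simp [Matrix.mul_apply, hu, hv]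
  | add u v hu hv => simp [hu, hv]

/-- The differential of `U(L)`: the derivation that extends the differential of `L`; see `dU_one`,
`dU_ι`, `dU_ι_mul`. -/
def dU : L.U →ₗ[k] L.U where
  toFun u := L.Umat u 0 1
  map_add' := by simp
  map_smul' := by simp

lemma dU_one : L.dU 1 = 0 := by simp [dU]

lemma dU_ι {i j : ℤ} (h : j + 1 = i) (x : L.X i) : L.dU (L.ι i x) = L.ι j (L.d h x) := by
  rw [← totι_of, ← totι_of, ← totD_of]
  simp [dU, Umat_totι]

lemma dU_ι_mul {i j : ℤ} (h : j + 1 = i) (x : L.X i) (u : L.U) :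
    L.dU (L.ι i x * u) = L.ι j (L.d h x) * u + sgn k i • (L.ι i x * L.dU u) := by
  have h1 := (L.Umat_lower u).2
  rw [← totι_of, ← totι_of, ← totD_of]
  simp only [dU, LinearMap.coe_mk, AddHom.coe_mk, map_mul, Umat_totι, Matrix.mul_apply,
    Fin.sum_univ_two, h1, totσ_of]
  simp [add_comm]

/-- The degree `n` part of `U(L)`: the span of the products `x_1 ⋯ x_r` of homogeneous elements
of `L` with `|x_1| + ⋯ + |x_r| = n`. -/
def Udeg (n : ℤ) : Submodule k L.U :=
  Submodule.span k {u | ∃ l : List (Σ i, L.X i),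
    (l.map Sigma.fst).sum = n ∧ (l.map fun x => L.ι x.1 x.2).prod = u}

lemma one_mem_Udeg : (1 : L.U) ∈ L.Udeg 0 := Submodule.subset_span ⟨[], by simp⟩

lemma ι_mul_mem {i q r : ℤ} (h : i + q = r) (x : L.X i) {u : L.U} (hu : u ∈ L.Udeg q) :
    L.ι i x * u ∈ L.Udeg r := by
  subst h
  induction hu using Submodule.span_induction with
  | mem u h =>
    obtain ⟨l, rfl, rfl⟩ := h
    exact Submodule.subset_span ⟨⟨i, x⟩ :: l, by simp⟩
  | zero => simp
  | add u v _ _ hu hv => rw [mul_add]; exact add_mem hu hv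
  | smul c u _ hu => rw [mul_smul_comm]; exact Submodule.smul_mem _ _ hu

lemma dU_mem {q r : ℤ} (h : r + 1 = q) {u : L.U} (hu : u ∈ L.Udeg q) : L.dU u ∈ L.Udeg r := by
  obtain rfl : r = q - 1 := by omega
  induction hu using Submodule.span_induction with
  | mem u h =>
    obtain ⟨l, rfl, rfl⟩ := h
    clear h
    induction l with
    | nil => simp [dU_one]
    | cons x l ih =>
      simp only [List.map_cons, List.prod_cons, List.sum_cons]
      rw [L.dU_ι_mul (sub_add_cancel x.1 1)]
      refine add_mem (L.ι_mul_mem (by omega) _ (Submodule.subset_span ⟨l, rfl, rfl⟩))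
        (Submodule.smul_mem _ _ (L.ι_mul_mem (by omega) _ ih))
  | zero => simp
  | add u v _ _ hu hv => rw [map_add]; exact add_mem hu hv
  | smul c u _ hu => rw [map_smul]; exact Submodule.smul_mem _ _ hu

/-- The differential `U(L)_q → U(L)_r`, `r + 1 = q`. -/
def dUdeg {q r : ℤ} (h : r + 1 = q) : L.Udeg q →ₗ[k] L.Udeg r :=
  L.dU.restrict fun _ hu => L.dU_mem h hu

/-- Left multiplication `L_i × U(L)_q → U(L)_r`, `i + q = r`. -/
def mulUdeg {i q r : ℤ} (h : i + q = r) : L.X i →ₗ[k] L.Udeg q →ₗ[k] L.Udeg r :=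
  LinearMap.mk₂ k (fun x u => ⟨L.ι i x * u, L.ι_mul_mem h x u.2⟩)
    (fun x y u => by ext; simp [add_mul]) (fun c x u => by ext; simp)
    (fun x u v => by ext; simp [mul_add]) (fun c x u => by ext; simp)

lemma dUdeg_mulUdeg {i q r i' q' r' : ℤ} (h : i + q = r) (hi : i' + 1 = i) (hq : q' + 1 = q)
    (hr : r' + 1 = r) (h₁ : i' + q = r') (h₂ : i + q' = r') (x : L.X i) (u : L.Udeg q) :
    L.dUdeg hr (L.mulUdeg h x u) =
      L.mulUdeg h₁ (L.d hi x) u + sgn k i • L.mulUdeg h₂ x (L.dUdeg hq u) := by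
  ext
  exact L.dU_ι_mul hi x u

end DGLie

namespace GrModule

variable {k : Type u} [Field k] {L : DGLie.{u, v} k} (N : GrModule.{u, v, w} L)

/-- The total space `⨁ N_p`. -/
abbrev Tot : Type w := ⨁ p, N.X p

/-- The inclusion of `N_p` into the total space. -/
abbrev of (p : ℤ) : N.X p →ₗ[k] N.Tot := DirectSum.lof k ℤ N.X p

/-- The right action `⟦e, x⟧ = (-1)^{|x||e| + 1} ⟦x, e⟧`. -/
def ract {i p q : ℤ} (h : i + p = q) (e : N.X p) (x : L.X i) : N.X q :=
  sgn k (i * p + 1) • N.act h x e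

/-- The relations `e x ⊗ u = e ⊗ x u` of the tensor product over `L`. -/
def tensRel : Submodule k (N.Tot ⊗[k] L.U) :=
  Submodule.span k {t | ∃ (i p q : ℤ) (h : i + p = q) (e : N.X p) (x : L.X i) (u : L.U),
    t = N.of q (N.ract h e x) ⊗ₜ u - N.of p e ⊗ₜ (L.ι i x * u)}

/-- The tensor product `N ⊗_L U(L)` of graded `L`-modules. -/
abbrev Tens : Type (max u v w) := (N.Tot ⊗[k] L.U) ⧸ N.tensRel

/-- The class of `e ⊗ u`. -/
def tmk {p : ℤ} (e : N.X p) (u : L.U) : N.Tens := N.tensRel.mkQ (N.of p e ⊗ₜ u)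

/-- The degree `n` part of `N ⊗_L U(L)`. -/
def tensDeg (n : ℤ) : Submodule k N.Tens :=
  Submodule.span k {t | ∃ (p q : ℤ) (_ : p + q = n) (e : N.X p) (u : L.U),
    u ∈ L.Udeg q ∧ t = N.tmk e u}

lemma tmk_mem {p q n : ℤ} (h : p + q = n) (e : N.X p) {u : L.U} (hu : u ∈ L.Udeg q) :
    N.tmk e u ∈ N.tensDeg n := Submodule.subset_span ⟨p, q, h, e, u, hu, rfl⟩

/-- The truncation `N̄`: the graded module obtained from `N` by replacing each `N_p` with `p < 0`
by zero, for non-negatively graded `L`. -/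
def trunc (hL : ∀ i < 0, ∀ x : L.X i, x = 0) : GrModule.{u, v, w} L where
  X p := ({ carrier := {e | p < 0 → e = 0}
            add_mem' := fun ha hb hp => by rw [ha hp, hb hp, add_zero]
            zero_mem' := fun _ => rfl
            smul_mem' := fun c a ha hp => by rw [ha hp, smul_zero] } : Submodule k (N.X p))
  act {i p q} h := LinearMap.mk₂ k
    (fun x e => ⟨N.act h x e.1, fun hq => by
      by_cases hi : i < 0
      · simp [hL i hi x]
      · simp [e.2 (by omega)]⟩)
    (fun x y u => by ext; simp) (fun c x u => by ext; simp)
    (fun x u v => by ext; simp) (fun c x u => by ext; simp)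
  act_br h h₀ h₁ h₂ h₃ h₄ x y e := by
    ext
    simpa using N.act_br h h₀ h₁ h₂ h₃ h₄ x y e.1

/-- The inclusion `N̄_p → N_p`. -/
def truncIncl (hL : ∀ i < 0, ∀ x : L.X i, x = 0) (p : ℤ) : (N.trunc hL).X p →ₗ[k] N.X p :=
  Submodule.subtype _

end GrModule


namespace DGModule

variable {k : Type u} [Field k] {L : DGLie.{u, v} k} (M : DGModule.{u, v, w} L)

/-- The grading involution `e ↦ (-1)^{|e|} e` of the total space. -/
def totσ : M.Tot →ₗ[k] M.Tot := DirectSum.toModule k ℤ _ fun i => sgn k i • M.of i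

/-- The differential of the total space. -/
def totD : M.Tot →ₗ[k] M.Tot :=
  DirectSum.toModule k ℤ _ fun i => M.of (i - 1) ∘ₗ M.d (sub_add_cancel i 1)

lemma totσ_of (i : ℤ) (x : M.X i) : M.totσ (M.of i x) = sgn k i • M.of i x := by
  simp [totσ]

lemma totD_of {i j : ℤ} (h : j + 1 = i) (x : M.X i) : M.totD (M.of i x) = M.of j (M.d h x) := by
  obtain rfl : j = i - 1 := by omega
  simp [totD]

/-- The map `e ⊗ u ↦ de ⊗ u + (-1)^{|e|} e ⊗ du`. -/
def preTensD : M.Tot ⊗[k] L.U →ₗ[k] M.Tot ⊗[k] L.U :=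
  TensorProduct.map M.totD LinearMap.id + TensorProduct.map M.totσ L.dU

lemma preTensD_mem {t : M.Tot ⊗[k] L.U} (ht : t ∈ M.tensRel) : M.preTensD t ∈ M.tensRel := by
  induction ht using Submodule.span_induction with
  | mem t ht =>
    obtain ⟨i, p, q, h, e, x, u, rfl⟩ := ht
    have hi := sub_add_cancel i 1
    have hp := sub_add_cancel p 1
    have hq := sub_add_cancel q 1
    have h1 : (i - 1) + p = q - 1 := by omega
    have h2 : i + (p - 1) = q - 1 := by omega
    have a1 : M.of (q - 1) (M.ract h1 e (L.d hi x)) ⊗ₜ u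
        - M.of p e ⊗ₜ (L.ι (i - 1) (L.d hi x) * u) ∈ M.tensRel :=
      Submodule.subset_span ⟨_, _, _, h1, e, L.d hi x, u, rfl⟩
    have a2 : M.of (q - 1) (M.ract h2 (M.d hp e) x) ⊗ₜ u
        - M.of (p - 1) (M.d hp e) ⊗ₜ (L.ι i x * u) ∈ M.tensRel :=
      Submodule.subset_span ⟨_, _, _, h2, M.d hp e, x, u, rfl⟩
    have a3 : M.of q (M.ract h e x) ⊗ₜ L.dU u - M.of p e ⊗ₜ (L.ι i x * L.dU u) ∈ M.tensRel :=
      Submodule.subset_span ⟨_, _, _, h, e, x, L.dU u, rfl⟩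
    convert add_mem (add_mem (M.tensRel.smul_mem (sgn k p) a1) a2)
      (M.tensRel.smul_mem (sgn k q) a3) using 1
    simp only [preTensD, map_sub, LinearMap.add_apply, TensorProduct.map_tmul, LinearMap.id_apply,
      totσ_of, M.totD_of hq, M.totD_of hp, L.dU_ι_mul hi, GrModule.ract, map_smul,
      M.d_act h hq hi hp h1 h2, map_add, TensorProduct.add_tmul, TensorProduct.tmul_add,
      TensorProduct.smul_tmul', TensorProduct.tmul_smul, smul_add, smul_sub]
    subst h
    by_cases pi : Even i <;> by_cases pp : Even p <;>
        simp [sgn_eq_ite, Int.even_add, pi, pp, ← Int.not_even_iff_odd] <;> abel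
  | zero => simp
  | add u v _ _ hu hv => rw [map_add]; exact add_mem hu hv
  | smul c u _ hu => rw [map_smul]; exact Submodule.smul_mem _ _ hu

/-- The differential of `M ⊗_L U(L)`: `d(e ⊗ u) = de ⊗ u + (-1)^{|e|} e ⊗ du`. -/
def tensD : M.Tens →ₗ[k] M.Tens := M.tensRel.mapQ M.tensRel M.preTensD fun _ h => M.preTensD_mem h

lemma tensD_tmk {p q : ℤ} (h : q + 1 = p) (e : M.X p) (u : L.U) :
    M.tensD (M.tmk e u) = M.tmk (M.d h e) u + sgn k p • M.tmk e (L.dU u) := by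
  simp only [tensD, GrModule.tmk, Submodule.mkQ_apply, Submodule.mapQ_apply, preTensD,
    LinearMap.add_apply, TensorProduct.map_tmul, M.totD_of h, totσ_of, LinearMap.id_apply]
  rfl

lemma tensD_mem {n n' : ℤ} (h : n' + 1 = n) {t : M.Tens} (ht : t ∈ M.tensDeg n) :
    M.tensD t ∈ M.tensDeg n' := by
  induction ht using Submodule.span_induction with
  | mem t ht =>
    obtain ⟨p, q, hpq, e, u, hu, rfl⟩ := ht
    rw [M.tensD_tmk (sub_add_cancel p 1)]
    exact add_mem (M.tmk_mem (by omega) _ hu) (Submodule.smul_mem _ _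
      (M.tmk_mem (by omega) _ (L.dU_mem (sub_add_cancel q 1) hu)))
  | zero => simp
  | add u v _ _ hu hv => rw [map_add]; exact add_mem hu hv
  | smul c u _ hu => rw [map_smul]; exact Submodule.smul_mem _ _ hu

/-- The differential `(M ⊗_L U(L))_n → (M ⊗_L U(L))_{n'}`, `n' + 1 = n`. -/
def tensDdeg {n n' : ℤ} (h : n' + 1 = n) : M.tensDeg n →ₗ[k] M.tensDeg n' :=
  M.tensD.restrict fun _ ht => M.tensD_mem h ht

end DGModule

namespace GrModule

variable {k : Type u} [Field k] {L : DGLie.{u, v} k} (N : GrModule.{u, v, w} L)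
  (hL : ∀ i < 0, ∀ x : L.X i, x = 0)

/-- The inclusion of total spaces `⨁ N̄_p → ⨁ N_p`. -/
def truncTot : (N.trunc hL).Tot →ₗ[k] N.Tot :=
  DirectSum.toModule k ℤ _ fun p => N.of p ∘ₗ N.truncIncl hL p

lemma truncTot_of (p : ℤ) (e : (N.trunc hL).X p) :
    N.truncTot hL ((N.trunc hL).of p e) = N.of p (N.truncIncl hL p e) := by
  simp [truncTot]

/-- The map `N̄ ⊗_L U(L) → N ⊗_L U(L)` induced by the inclusion `N̄ → N`. -/
def truncTens : (N.trunc hL).Tens →ₗ[k] N.Tens :=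
  (N.trunc hL).tensRel.mapQ N.tensRel (TensorProduct.map (N.truncTot hL) LinearMap.id) <| by
    rw [tensRel, Submodule.span_le]
    rintro _ ⟨i, p, q, h, e, x, u, rfl⟩
    refine Submodule.subset_span ⟨i, p, q, h, N.truncIncl hL p e, x, u, ?_⟩
    simp only [map_sub, TensorProduct.map_tmul, truncTot_of, LinearMap.id_apply]
    rfl

lemma truncTens_tmk {p : ℤ} (e : (N.trunc hL).X p) (u : L.U) :
    N.truncTens hL ((N.trunc hL).tmk e u) = N.tmk (N.truncIncl hL p e) u := by
  simp [truncTens, tmk, truncTot_of]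

lemma truncTens_mem {n : ℤ} {t : (N.trunc hL).Tens} (ht : t ∈ (N.trunc hL).tensDeg n) :
    N.truncTens hL t ∈ N.tensDeg n := by
  induction ht using Submodule.span_induction with
  | mem t ht =>
    obtain ⟨p, q, hpq, e, u, hu, rfl⟩ := ht
    rw [truncTens_tmk]
    exact N.tmk_mem hpq _ hu
  | zero => simp
  | add u v _ _ hu hv => rw [map_add]; exact add_mem hu hv
  | smul c u _ hu => rw [map_smul]; exact Submodule.smul_mem _ _ hu

/-- The map `(N̄ ⊗_L U(L))_n → (N ⊗_L U(L))_n` induced by the inclusion `N̄ → N`. -/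
def truncTensDeg (n : ℤ) : (N.trunc hL).tensDeg n →ₗ[k] N.tensDeg n :=
  (N.truncTens hL).restrict fun _ ht => N.truncTens_mem hL ht

/-- The space `Hom(U(L), N)^n` of maps of degree `-n`, for `N` concentrated in non-negative degrees:
families of linear maps `f : U(L)_q → N_{q - n}` with `f(x u) = (-1)^{n |x|} x f(u)` for `x` in `L`
and `u` of degree `q ≥ n`. For `q < n` the maps vanish, as `N_{q - n} = 0`; so these are the degree
`-n` morphisms to `N` from the graded `L`-module of all elements of `U(L)` of degree `≥ n`. -/
def homDeg (n : ℤ) : Submodule k 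
    (∀ z : {z : ℤ × ℤ // z.1 + n = z.2}, L.Udeg z.1.2 →ₗ[k] N.X z.1.1) where
  carrier := {f | ∀ (i p q s r : ℤ) (hr : i + q = r) (hs : i + p = s) (hpq : p + n = q)
    (hsr : s + n = r), n ≤ q → ∀ (x : L.X i) (u : L.Udeg q),
      f ⟨(s, r), hsr⟩ (L.mulUdeg hr x u) = sgn k (n * i) • N.act hs x (f ⟨(p, q), hpq⟩ u)}
  add_mem' hf hf' i p q s r hr hs hpq hsr hn x u := by
    simp [hf i p q s r hr hs hpq hsr hn x u, hf' i p q s r hr hs hpq hsr hn x u]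
  zero_mem' i p q s r hr hs hpq hsr hn x u := by simp
  smul_mem' c f hf i p q s r hr hs hpq hsr hn x u := by
    simp [hf i p q s r hr hs hpq hsr hn x u, smul_comm c]

end GrModule

namespace DGModule

variable {k : Type u} [Field k] {L : DGLie.{u, v} k} (M : DGModule.{u, v, w} L)
  (hL : ∀ i < 0, ∀ x : L.X i, x = 0)

/-- The differential of the truncated chain complex `M̄`; it is zero on `M̄_0`. -/
def truncD {p q : ℤ} (h : q + 1 = p) : (M.trunc hL).X p →ₗ[k] (M.trunc hL).X q :=
  LinearMap.codRestrict _ (if 0 ≤ q then M.d h ∘ₗ M.truncIncl hL p else 0) fun e hq => by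
    rw [if_neg (by omega), LinearMap.zero_apply]

lemma truncD_coe {p q : ℤ} (h : q + 1 = p) (hq : 0 ≤ q) (e : (M.trunc hL).X p) :
    M.truncIncl hL q (M.truncD hL h e) = M.d h (M.truncIncl hL p e) := by
  change (if 0 ≤ q then M.d h ∘ₗ M.truncIncl hL p else 0) e = _
  rw [if_pos hq, LinearMap.comp_apply]

/-- The family `f ∘ d - (-1)^{deg f} d ∘ f`, where `deg f = -n`. -/
def homDfun {n n' : ℤ} (hn' : n + 1 = n')
    (f : ∀ z : {z : ℤ × ℤ // z.1 + n = z.2}, L.Udeg z.1.2 →ₗ[k] (M.trunc hL).X z.1.1)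
    (z : {z : ℤ × ℤ // z.1 + n' = z.2}) : L.Udeg z.1.2 →ₗ[k] (M.trunc hL).X z.1.1 :=
  f ⟨(z.1.1, z.1.2 - 1), by have := z.2; dsimp only; omega⟩ ∘ₗ L.dUdeg (sub_add_cancel z.1.2 1)
    - sgn k n • (M.truncD hL rfl ∘ₗ f ⟨(z.1.1 + 1, z.1.2), by have := z.2; dsimp only; omega⟩)

lemma homDfun_mem {n n' : ℤ} (hn' : n + 1 = n') {f} (hf : f ∈ (M.trunc hL).homDeg n) :
    M.homDfun hL hn' f ∈ (M.trunc hL).homDeg n' := by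
  subst hn'
  intro i p q s r hr hs hpq hsr hn x u
  by_cases hi0 : i < 0
  · simp [hL i hi0 x]
  have hi := sub_add_cancel i 1
  have hq := sub_add_cancel q 1
  have hr1 := sub_add_cancel r 1
  have h1 : (i - 1) + q = r - 1 := by omega
  have h2 : i + (q - 1) = r - 1 := by omega
  have f1 := hf (i - 1) (p + 1) q s (r - 1) h1 (by omega) (by omega) (by omega) (by omega)
    (L.d hi x) u
  have f2 := hf i p (q - 1) s (r - 1) h2 hs (by omega) (by omega) (by omega) x
    (L.dUdeg hq u)
  have f3 := hf i (p + 1) q (s + 1) r hr (by omega) (by omega) (by omega) (by omega) x u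
  apply Subtype.ext
  have key : ∀ e : (M.trunc hL).X (p + 1),
      M.truncD hL (rfl : s + 1 = s + 1) ((M.trunc hL).act (by omega : i + (p + 1) = s + 1) x e)
      = (M.trunc hL).act (by omega : (i - 1) + (p + 1) = s) (L.d hi x) e
        + sgn k i • (M.trunc hL).act hs x (M.truncD hL rfl e) := by
    intro e
    apply Subtype.ext
    have a1 := M.truncD_coe hL (rfl : s + 1 = s + 1) (by omega)
      ((M.trunc hL).act (by omega : i + (p + 1) = s + 1) x e)
    have a2 := M.truncD_coe hL (rfl : p + 1 = p + 1) (by omega) e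
    have a3 := M.d_act (by omega : i + (p + 1) = s + 1) rfl hi rfl (by omega) hs x e.1
    refine a1.trans (a3.trans ?_)
    change _ = M.act _ _ e.1 + sgn k i • M.act hs x (M.truncIncl hL p (M.truncD hL rfl e))
    rw [a2]
    rfl
  congr 1
  simp only [homDfun, LinearMap.sub_apply, LinearMap.comp_apply, LinearMap.smul_apply,
    L.dUdeg_mulUdeg hr hi hq hr1 h1 h2, map_add, map_smul, f1, f2, f3, key, map_sub, smul_sub,
    smul_add, smul_smul]
  by_cases pi : Even i <;> by_cases pn : Even n <;>
    simp [sgn_eq_ite, Int.even_mul, pi, pn, ← Int.not_even_iff_odd] <;> abel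

/-- The differential `df = f ∘ d - (-1)^{deg f} d ∘ f` of the cochain complex `Hom(U(L), M̄)`. -/
def homD {n n' : ℤ} (h : n + 1 = n') :
    (M.trunc hL).homDeg n →ₗ[k] (M.trunc hL).homDeg n' where
  toFun f := ⟨M.homDfun hL h f.1, M.homDfun_mem hL h f.2⟩
  map_add' f f' := by
    ext z u : 4
    simp [homDfun]
    abel
  map_smul' c f := by
    ext z u : 4
    simp [homDfun, smul_sub, smul_comm c]

end DGModule

section Universal

variable {k : Type u} [Field k] {g : Type v} [AddCommGroup g] [Module k g]

/-- Formal homogeneous expressions in the generators of the universal enveloping DG Lie algebra: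
`g_Lie` in degree `0` and `g` in degree `1`. -/
inductive EPre (G : LeftLeibniz k g) : ℤ → Type (max u v)
  | zero (n : ℤ) : EPre G n
  | add {n : ℤ} : EPre G n → EPre G n → EPre G n
  | smul {n : ℤ} : k → EPre G n → EPre G n
  | lie {n : ℤ} : n = 0 → G.LieQuot → EPre G n
  | gen {n : ℤ} : n = 1 → g → EPre G n
  | br {i j n : ℤ} : i + j = n → EPre G i → EPre G j → EPre G n

/-- The relations of `E(g)`: the axioms of a graded Lie algebra, linearity of the generators, and
`⟦x, y⟧ = [x, y]` for `x`, `y` in `g_Lie`, `⟦x, y⟧ = x · y` for `x` in `g_Lie` and `y` in `g`. -/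
inductive ERel (G : LeftLeibniz k g) : ∀ {n : ℤ}, EPre G n → EPre G n → Prop
  | refl {n : ℤ} (a : EPre G n) : ERel G a a
  | symm {n : ℤ} {a b : EPre G n} : ERel G a b → ERel G b a
  | trans {n : ℤ} {a b c : EPre G n} : ERel G a b → ERel G b c → ERel G a c
  | add_congr {n : ℤ} {a a' b b' : EPre G n} :
      ERel G a a' → ERel G b b' → ERel G (a.add b) (a'.add b')
  | smul_congr {n : ℤ} (c : k) {a a' : EPre G n} : ERel G a a' → ERel G (a.smul c) (a'.smul c)
  | br_congr {i j n : ℤ} (h : i + j = n) {a a' : EPre G i} {b b' : EPre G j} :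
      ERel G a a' → ERel G b b' → ERel G (EPre.br h a b) (EPre.br h a' b')
  | add_assoc {n : ℤ} (a b c : EPre G n) : ERel G ((a.add b).add c) (a.add (b.add c))
  | add_comm {n : ℤ} (a b : EPre G n) : ERel G (a.add b) (b.add a)
  | zero_add {n : ℤ} (a : EPre G n) : ERel G ((EPre.zero n).add a) a
  | zero_smul {n : ℤ} (a : EPre G n) : ERel G (a.smul 0) (EPre.zero n)
  | one_smul {n : ℤ} (a : EPre G n) : ERel G (a.smul 1) a
  | mul_smul {n : ℤ} (c c' : k) (a : EPre G n) : ERel G (a.smul (c * c')) ((a.smul c').smul c)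
  | add_smul {n : ℤ} (c c' : k) (a : EPre G n) :
      ERel G (a.smul (c + c')) ((a.smul c).add (a.smul c'))
  | smul_add {n : ℤ} (c : k) (a b : EPre G n) :
      ERel G ((a.add b).smul c) ((a.smul c).add (b.smul c))
  | lie_add {n : ℤ} (h : n = 0) (a b : G.LieQuot) :
      ERel G (EPre.lie h (a + b)) ((EPre.lie h a).add (EPre.lie h b))
  | lie_smul {n : ℤ} (h : n = 0) (c : k) (a : G.LieQuot) :
      ERel G (EPre.lie h (c • a)) ((EPre.lie h a).smul c)
  | gen_add {n : ℤ} (h : n = 1) (x y : g) :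
      ERel G (EPre.gen h (x + y)) ((EPre.gen h x).add (EPre.gen h y))
  | gen_smul {n : ℤ} (h : n = 1) (c : k) (x : g) :
      ERel G (EPre.gen h (c • x)) ((EPre.gen h x).smul c)
  | br_add {i j n : ℤ} (h : i + j = n) (a : EPre G i) (b c : EPre G j) :
      ERel G (EPre.br h a (b.add c)) ((EPre.br h a b).add (EPre.br h a c))
  | add_br {i j n : ℤ} (h : i + j = n) (a b : EPre G i) (c : EPre G j) :
      ERel G (EPre.br h (a.add b) c) ((EPre.br h a c).add (EPre.br h b c))
  | br_smul {i j n : ℤ} (h : i + j = n) (c : k) (a : EPre G i) (b : EPre G j) :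
      ERel G (EPre.br h a (b.smul c)) ((EPre.br h a b).smul c)
  | smul_br {i j n : ℤ} (h : i + j = n) (c : k) (a : EPre G i) (b : EPre G j) :
      ERel G (EPre.br h (a.smul c) b) ((EPre.br h a b).smul c)
  | br_symm {i j n : ℤ} (h : i + j = n) (h' : j + i = n) (a : EPre G i) (b : EPre G j) :
      ERel G (EPre.br h a b) ((EPre.br h' b a).smul (sgn k (i * j + 1)))
  | jacobi {i j l ij jl li n : ℤ} (h₁ : j + l = jl) (h₂ : i + jl = n) (h₃ : l + i = li)
      (h₄ : j + li = n) (h₅ : i + j = ij) (h₆ : l + ij = n)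
      (a : EPre G i) (b : EPre G j) (c : EPre G l) :
      ERel G ((((EPre.br h₂ a (EPre.br h₁ b c)).smul (sgn k (i * l))).add
        ((EPre.br h₄ b (EPre.br h₃ c a)).smul (sgn k (j * i)))).add
        ((EPre.br h₆ c (EPre.br h₅ a b)).smul (sgn k (l * j)))) (EPre.zero n)
  | br_lie_lie {i j n : ℤ} (h : i + j = n) (hi : i = 0) (hj : j = 0) (hn : n = 0)
      (a b : G.LieQuot) : ERel G (EPre.br h (EPre.lie hi a) (EPre.lie hj b)) (EPre.lie hn ⁅a, b⁆)
  | br_lie_gen {i j n : ℤ} (h : i + j = n) (hi : i = 0) (hj : j = 1) (hn : n = 1)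
      (a : G.LieQuot) (y : g) :
      ERel G (EPre.br h (EPre.lie hi a) (EPre.gen hj y)) (EPre.gen hn (G.lieAct a y))

namespace LeftLeibniz

variable (G : LeftLeibniz k g)

/-- The setoid of the relations of `E(g)`. -/
def ESetoid (n : ℤ) : Setoid (EPre G n) where
  r := ERel G
  iseqv := ⟨ERel.refl, ERel.symm, ERel.trans⟩

/-- The degree `n` part of `E(g)`. -/
def EX (n : ℤ) : Type (max u v) := Quotient (G.ESetoid n)

/-- The class of a formal expression. -/
def Emk {n : ℤ} (a : EPre G n) : G.EX n := Quotient.mk (G.ESetoid n) a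

variable {G} in
lemma Emk_eq {n : ℤ} {a b : EPre G n} (h : ERel G a b) : G.Emk a = G.Emk b := Quotient.sound h

variable {G} in
lemma Emk_surj {n : ℤ} (a : G.EX n) : ∃ b, G.Emk b = a := Quotient.exists_rep a

/-- Addition in `E(g)`. -/
def Eadd {n : ℤ} : G.EX n → G.EX n → G.EX n :=
  Quotient.map₂ EPre.add fun _ _ h _ _ h' => ERel.add_congr h h'

/-- Scalar multiplication in `E(g)`. -/
def Esmul {n : ℤ} (c : k) : G.EX n → G.EX n :=
  Quotient.map (EPre.smul c) fun _ _ h => ERel.smul_congr c h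

instance (n : ℤ) : Add (G.EX n) := ⟨G.Eadd⟩
instance (n : ℤ) : Zero (G.EX n) := ⟨G.Emk (EPre.zero n)⟩
instance (n : ℤ) : Neg (G.EX n) := ⟨G.Esmul (-1)⟩

instance (n : ℤ) : AddCommGroup (G.EX n) where
  nsmul := nsmulRec
  zsmul := zsmulRec
  add_assoc := by
    rintro ⟨a⟩ ⟨b⟩ ⟨c⟩
    exact Emk_eq (.add_assoc a b c)
  add_comm := by
    rintro ⟨a⟩ ⟨b⟩
    exact Emk_eq (.add_comm a b)
  zero_add := by
    rintro ⟨a⟩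
    exact Emk_eq (.zero_add a)
  add_zero := by
    rintro ⟨a⟩
    exact Emk_eq (.trans (.add_comm _ _) (.zero_add a))
  neg_add_cancel := by
    rintro ⟨a⟩
    refine Emk_eq (.trans (.add_congr (.refl _) (.symm (.one_smul a))) ?_)
    refine .trans (.symm (.add_smul _ _ _)) ?_
    rw [neg_add_cancel]
    exact .zero_smul a

instance (n : ℤ) : Module k (G.EX n) where
  smul := G.Esmul
  one_smul := by
    rintro ⟨a⟩
    exact Emk_eq (.one_smul a)
  mul_smul := by
    rintro c c' ⟨a⟩
    exact Emk_eq (.mul_smul c c' a)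
  smul_zero c := by
    refine Emk_eq (.trans (.smul_congr c (.symm (.zero_smul (EPre.zero n)))) ?_)
    refine .trans (.symm (.mul_smul c 0 _)) ?_
    rw [mul_zero]
    exact .zero_smul _
  smul_add := by
    rintro c ⟨a⟩ ⟨b⟩
    exact Emk_eq (.smul_add c a b)
  add_smul := by
    rintro c c' ⟨a⟩
    exact Emk_eq (.add_smul c c' a)
  zero_smul := by
    rintro ⟨a⟩
    exact Emk_eq (.zero_smul a)

lemma Emk_add {n : ℤ} (a b : EPre G n) : G.Emk (a.add b) = G.Emk a + G.Emk b := rfl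
lemma Emk_smul {n : ℤ} (c : k) (a : EPre G n) : G.Emk (a.smul c) = c • G.Emk a := rfl
lemma Emk_zero (n : ℤ) : G.Emk (EPre.zero n) = 0 := rfl

/-- The bracket of `E(g)`. -/
def Ebr {i j n : ℤ} (h : i + j = n) : G.EX i →ₗ[k] G.EX j →ₗ[k] G.EX n :=
  LinearMap.mk₂ k (Quotient.map₂ (EPre.br h) fun _ _ h₁ _ _ h₂ => ERel.br_congr h h₁ h₂)
    (by rintro ⟨a⟩ ⟨b⟩ ⟨c⟩; exact Emk_eq (.add_br h a b c))
    (by rintro c ⟨a⟩ ⟨b⟩; exact Emk_eq (.smul_br h c a b))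
    (by rintro ⟨a⟩ ⟨b⟩ ⟨c⟩; exact Emk_eq (.br_add h a b c))
    (by rintro c ⟨a⟩ ⟨b⟩; exact Emk_eq (.br_smul h c a b))

lemma Emk_br {i j n : ℤ} (h : i + j = n) (a : EPre G i) (b : EPre G j) :
    G.Emk (EPre.br h a b) = G.Ebr h (G.Emk a) (G.Emk b) := rfl

/-- The generators `g_Lie → E(g)_0`. -/
def Elie {n : ℤ} (h : n = 0) : G.LieQuot →ₗ[k] G.EX n where
  toFun a := G.Emk (EPre.lie h a)
  map_add' a b := Emk_eq (.lie_add h a b)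
  map_smul' c a := Emk_eq (.lie_smul h c a)

/-- The generators `g → E(g)_1`. -/
def Egen {n : ℤ} (h : n = 1) : g →ₗ[k] G.EX n where
  toFun a := G.Emk (EPre.gen h a)
  map_add' a b := Emk_eq (.gen_add h a b)
  map_smul' c a := Emk_eq (.gen_smul h c a)

lemma Ebr_symm {i j n : ℤ} (h : i + j = n) (h' : j + i = n) (x : G.EX i) (y : G.EX j) :
    G.Ebr h x y = sgn k (i * j + 1) • G.Ebr h' y x := by
  obtain ⟨a, rfl⟩ := Emk_surj x
  obtain ⟨b, rfl⟩ := Emk_surj y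
  exact Emk_eq (.br_symm h h' a b)

lemma Ejacobi {i j l ij jl li n : ℤ} (h₁ : j + l = jl) (h₂ : i + jl = n) (h₃ : l + i = li)
    (h₄ : j + li = n) (h₅ : i + j = ij) (h₆ : l + ij = n)
    (x : G.EX i) (y : G.EX j) (z : G.EX l) :
    sgn k (i * l) • G.Ebr h₂ x (G.Ebr h₁ y z) + sgn k (j * i) • G.Ebr h₄ y (G.Ebr h₃ z x)
      + sgn k (l * j) • G.Ebr h₆ z (G.Ebr h₅ x y) = 0 := by
  obtain ⟨a, rfl⟩ := Emk_surj x
  obtain ⟨b, rfl⟩ := Emk_surj y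
  obtain ⟨c, rfl⟩ := Emk_surj z
  exact Emk_eq (.jacobi h₁ h₂ h₃ h₄ h₅ h₆ a b c)

lemma Ebr_lie_lie {i j n : ℤ} (h : i + j = n) (hi : i = 0) (hj : j = 0) (hn : n = 0)
    (a b : G.LieQuot) : G.Ebr h (G.Elie hi a) (G.Elie hj b) = G.Elie hn ⁅a, b⁆ :=
  Emk_eq (.br_lie_lie h hi hj hn a b)

lemma Ebr_lie_gen {i j n : ℤ} (h : i + j = n) (hi : i = 0) (hj : j = 1) (hn : n = 1)
    (a : G.LieQuot) (y : g) :
    G.Ebr h (G.Elie hi a) (G.Egen hj y) = G.Egen hn (G.lieAct a y) :=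
  Emk_eq (.br_lie_gen h hi hj hn a y)

variable {G}

/-- The differential of a formal expression: `d` is the quotient map `g → g_Lie` on generators
and satisfies the graded Leibniz rule. -/
def EdPre : ∀ {i : ℤ}, EPre G i → ∀ j : ℤ, j + 1 = i → G.EX j
  | _, .zero _, _, _ => 0
  | _, .add a b, j, h => EdPre a j h + EdPre b j h
  | _, .smul c a, j, h => c • EdPre a j h
  | _, .lie _ _, _, _ => 0
  | _, .gen hn x, _, h => G.Elie (by omega) (G.toLie x)
  | _, .br (i := i) (j := j) h a b, n, hn =>
      G.Ebr (by omega) (EdPre a (i - 1) (by omega)) (G.Emk b)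
        + sgn k i • G.Ebr (by omega) (G.Emk a) (EdPre b (j - 1) (by omega))

lemma EdPre_rel {i : ℤ} {a b : EPre G i} (r : ERel G a b) (j : ℤ) (h : j + 1 = i) :
    EdPre a j h = EdPre b j h := by
  induction r generalizing j with
  | refl a => rfl
  | symm _ ih => exact (ih j h).symm
  | trans _ _ ih ih' => exact (ih j h).trans (ih' j h)
  | add_congr _ _ ih ih' => simp only [EdPre, ih j h, ih' j h]
  | smul_congr c _ ih => simp only [EdPre, ih j h]
  | br_congr h r r' ih ih' => simp only [EdPre, ih, ih', Emk_eq r, Emk_eq r']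
  | add_assoc a b c => simp only [EdPre, add_assoc]
  | add_comm a b => simp only [EdPre, add_comm]
  | zero_add a => simp only [EdPre, zero_add]
  | zero_smul a => simp only [EdPre, zero_smul]
  | one_smul a => simp only [EdPre, one_smul]
  | mul_smul c c' a => simp only [EdPre, mul_smul]
  | add_smul c c' a => simp only [EdPre, add_smul]
  | smul_add c a b => simp only [EdPre, smul_add]
  | lie_add h a b => simp only [EdPre, add_zero]
  | lie_smul h c a => simp only [EdPre, smul_zero]
  | gen_add h x y => simp only [EdPre, map_add]
  | gen_smul h c x => simp only [EdPre, map_smul]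
  | br_add h a b c =>
    simp only [EdPre, Emk_add, map_add, smul_add]
    abel
  | add_br h a b c =>
    simp only [EdPre, Emk_add, map_add, smul_add, LinearMap.add_apply]
    abel
  | br_smul h c a b =>
    simp only [EdPre, Emk_smul, map_smul, smul_add, smul_comm c]
  | smul_br h c a b =>
    simp only [EdPre, Emk_smul, map_smul, smul_add, LinearMap.smul_apply, smul_comm c]
  | @br_symm p q n h1 h2 a b =>
    simp only [EdPre]
    rw [G.Ebr_symm (i := p - 1) (j := q) (by omega) (by omega : q + (p - 1) = j),
      G.Ebr_symm (i := p) (j := q - 1) (by omega) (by omega : (q - 1) + p = j)]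
    by_cases pi : Even p <;> by_cases pj : Even q <;>
      simp [sgn_eq_ite, parity_simps, pi, pj, ← Int.not_even_iff_odd] <;> abel
  | @jacobi p q l pq ql lp n h₁ h₂ h₃ h₄ h₅ h₆ a b c =>
    have J1 := G.Ejacobi (i := p - 1) (j := q) (l := l) (n := j) (ij := pq - 1) (li := lp - 1)
      h₁ (by omega) (by omega) (by omega) (by omega) (by omega)
      (EdPre a (p - 1) (by omega)) (G.Emk b) (G.Emk c)
    have J2 := G.Ejacobi (i := p) (j := q - 1) (l := l) (n := j) (ij := pq - 1) (jl := ql - 1)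
      (by omega) (by omega) h₃ (by omega) (by omega) (by omega)
      (G.Emk a) (EdPre b (q - 1) (by omega)) (G.Emk c)
    have J3 := G.Ejacobi (i := p) (j := q) (l := l - 1) (n := j) (jl := ql - 1) (li := lp - 1)
      (by omega) (by omega) (by omega) (by omega) h₅ (by omega)
      (G.Emk a) (G.Emk b) (EdPre c (l - 1) (by omega))
    simp only [EdPre, Emk_br, map_add, map_smul, smul_add]
    have J := congrArg₂ (· + ·) (congrArg₂ (· + ·) (congrArg (sgn k l • ·) J1)
      (congrArg (sgn k p • ·) J2)) (congrArg (sgn k q • ·) J3)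
    simp only [smul_zero, add_zero] at J
    refine Eq.trans ?_ J
    subst h₁ h₃ h₅
    by_cases pp : Even p <;> by_cases pq : Even q <;> by_cases pl : Even l <;>
      simp [sgn_eq_ite, Int.even_mul, pp, pq, pl, ← Int.not_even_iff_odd] <;> abel
  | br_lie_lie h1 hi hj hn a b => simp [EdPre]
  | br_lie_gen h1 hi hj hn a y =>
    subst hi
    simp only [EdPre, map_zero, LinearMap.zero_apply, zero_add]
    change sgn k 0 • G.Ebr _ (G.Elie rfl a) _ = _
    rw [G.Ebr_lie_lie _ rfl (by omega) (by omega), G.toLie_lieAct]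
    simp [sgn_eq_ite]


variable (G) in
/-- The differential of `E(g)`. -/
def Ed {i j : ℤ} (h : j + 1 = i) : G.EX i →ₗ[k] G.EX j where
  toFun := Quotient.lift (fun a => EdPre a j h) fun _ _ r => EdPre_rel r j h
  map_add' := by rintro ⟨a⟩ ⟨b⟩; rfl
  map_smul' := by rintro c ⟨a⟩; rfl

lemma Ed_Emk {i j : ℤ} (h : j + 1 = i) (a : EPre G i) : G.Ed h (G.Emk a) = EdPre a j h := rfl

lemma Ed_lie {i j : ℤ} (h : j + 1 = i) (hi : i = 0) (a : G.LieQuot) :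
    G.Ed h (G.Elie hi a) = 0 := rfl

lemma Ed_gen {i j : ℤ} (h : j + 1 = i) (hi : i = 1) (x : g) :
    G.Ed h (G.Egen hi x) = G.Elie (by omega) (G.toLie x) := rfl

lemma Ed_br {i j n i' j' n' : ℤ} (h : i + j = n) (hn : n' + 1 = n) (hi : i' + 1 = i)
    (hj : j' + 1 = j) (h₁ : i' + j = n') (h₂ : i + j' = n') (x : G.EX i) (y : G.EX j) :
    G.Ed hn (G.Ebr h x y) = G.Ebr h₁ (G.Ed hi x) y + sgn k i • G.Ebr h₂ x (G.Ed hj y) := by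
  obtain ⟨a, rfl⟩ := Emk_surj x
  obtain ⟨b, rfl⟩ := Emk_surj y
  obtain rfl : i' = i - 1 := by omega
  obtain rfl : j' = j - 1 := by omega
  rfl

lemma Ed_d {i j l : ℤ} (h : j + 1 = i) (h' : l + 1 = j) (x : G.EX i) :
    G.Ed h' (G.Ed h x) = 0 := by
  obtain ⟨a, rfl⟩ := Emk_surj x
  induction a generalizing j l with
  | zero n => rw [Emk_zero, map_zero, map_zero]
  | add a b iha ihb => rw [Emk_add, map_add, map_add, iha, ihb, add_zero]
  | smul c a ih => rw [Emk_smul, map_smul, map_smul, ih, smul_zero]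
  | lie hn a => rw [Ed_Emk, EdPre, map_zero]
  | gen hn a => rfl
  | @br p q n hpq a b iha ihb =>
    rw [Emk_br, Ed_br hpq h (sub_add_cancel p 1) (sub_add_cancel q 1) (by omega) (by omega),
      map_add, map_smul, Ed_br _ h' (sub_add_cancel (p - 1) 1) (sub_add_cancel q 1) (by omega)
        (by omega), Ed_br _ h' (sub_add_cancel p 1) (sub_add_cancel (q - 1) 1) (by omega)
        (by omega), iha, ihb]
    by_cases pp : Even p <;> simp [sgn_eq_ite, pp, parity_simps, ← Int.not_even_iff_odd]

variable (G) in
/-- The universal enveloping DG Lie algebra `E(g)`: the DG Lie algebra generated by the complex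
`g → g_Lie` (degrees `1` and `0`), with the relations `⟦x, y⟧ = [x, y]` for `x`, `y` in `g_Lie` and
`⟦x, y⟧ = x · y` for `x` in `g_Lie` and `y` in `g`. -/
def E : DGLie.{u, max u v} k where
  X := G.EX
  br := G.Ebr
  d := G.Ed
  br_symm := G.Ebr_symm
  jacobi := G.Ejacobi
  d_d := Ed_d
  d_br := Ed_br

lemma E_nonneg : ∀ i < 0, ∀ x : G.E.X i, x = 0 := by
  intro i hi x
  obtain ⟨a, rfl⟩ := Emk_surj x
  induction a with
  | zero n => rfl
  | add a b iha ihb =>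
    refine (Emk_add G a b).trans ?_
    have ha : G.Emk a = 0 := iha hi
    have hb : G.Emk b = 0 := ihb hi
    rw [ha, hb, add_zero]
    rfl
  | smul c a ih =>
    refine (Emk_smul G c a).trans ?_
    have ha : G.Emk a = 0 := ih hi
    rw [ha, smul_zero]
    rfl
  | lie hn a => omega
  | gen hn a => omega
  | @br p q n hpq a b iha ihb =>
    refine (Emk_br G hpq a b).trans ?_
    rcases lt_or_ge p 0 with hp | hp
    · have ha : G.Emk a = 0 := iha hp
      rw [ha, map_zero]
      rfl
    · have hb : G.Emk b = 0 := ihb (by omega)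
      rw [hb, map_zero]
      rfl

section Lift

variable {A : Type*} [Ring A] [Algebra k A] (f₀ : G.LieQuot →ₗ[k] A) (f₁ : g →ₗ[k] A)

/-- The value of a formal expression in a graded associative algebra, given the values of the
generators. -/
def EevalPre : ∀ {i : ℤ}, EPre G i → A
  | _, .zero _ => 0
  | _, .add a b => EevalPre a + EevalPre b
  | _, .smul c a => c • EevalPre a
  | _, .lie _ a => f₀ a
  | _, .gen _ x => f₁ x
  | _, .br (i := i) (j := j) _ a b =>
      EevalPre a * EevalPre b - sgn k (i * j) • (EevalPre b * EevalPre a)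

lemma EevalPre_rel (h₀ : ∀ a b, f₀ ⁅a, b⁆ = f₀ a * f₀ b - f₀ b * f₀ a)
    (h₁ : ∀ a y, f₁ (G.lieAct a y) = f₀ a * f₁ y - f₁ y * f₀ a) {i : ℤ} {a b : EPre G i} (r : ERel G a b) :
    EevalPre f₀ f₁ a = EevalPre f₀ f₁ b := by
  induction r with
  | refl a => rfl
  | symm _ ih => exact ih.symm
  | trans _ _ ih ih' => exact ih.trans ih'
  | add_congr _ _ ih ih' => simp only [EevalPre, ih, ih']
  | smul_congr c _ ih => simp only [EevalPre, ih]
  | br_congr h r r' ih ih' => simp only [EevalPre, ih, ih']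
  | add_assoc a b c => simp only [EevalPre, add_assoc]
  | add_comm a b => simp only [EevalPre, add_comm]
  | zero_add a => simp only [EevalPre, zero_add]
  | zero_smul a => simp only [EevalPre, zero_smul]
  | one_smul a => simp only [EevalPre, one_smul]
  | mul_smul c c' a => simp only [EevalPre, mul_smul]
  | add_smul c c' a => simp only [EevalPre, add_smul]
  | smul_add c a b => simp only [EevalPre, smul_add]
  | lie_add h a b => simp only [EevalPre, map_add]
  | lie_smul h c a => simp only [EevalPre, map_smul]
  | gen_add h x y => simp only [EevalPre, map_add]
  | gen_smul h c x => simp only [EevalPre, map_smul]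
  | br_add h a b c =>
    simp only [EevalPre, mul_add, add_mul, smul_add]
    abel
  | add_br h a b c =>
    simp only [EevalPre, mul_add, add_mul, smul_add]
    abel
  | br_smul h c a b =>
    simp only [EevalPre, mul_smul_comm, smul_mul_assoc, smul_sub, smul_comm c]
  | smul_br h c a b =>
    simp only [EevalPre, mul_smul_comm, smul_mul_assoc, smul_sub, smul_comm c]
  | @br_symm p q n h1 h2 a b =>
    simp only [EevalPre]
    by_cases pi : Even p <;> by_cases pj : Even q <;>
      simp [sgn_eq_ite, parity_simps, pi, pj, ← Int.not_even_iff_odd] <;> abel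
  | @jacobi p q l pq ql lp n h₁ h₂ h₃ h₄ h₅ h₆ a b c =>
    simp only [EevalPre]
    subst h₁ h₃ h₅
    by_cases pp : Even p <;> by_cases pq : Even q <;> by_cases pl : Even l <;>
      (simp [sgn_eq_ite, Int.even_add, Int.even_mul, pp, pq, pl]; noncomm_ring)
  | br_lie_lie h hi hj hn a b => subst hi; simp [EevalPre, h₀, sgn_eq_ite]
  | br_lie_gen h hi hj hn a y => subst hi; simp [EevalPre, h₁, sgn_eq_ite]

variable (h₀ : ∀ a b, f₀ ⁅a, b⁆ = f₀ a * f₀ b - f₀ b * f₀ a)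
  (h₁ : ∀ a y, f₁ (G.lieAct a y) = f₀ a * f₁ y - f₁ y * f₀ a)

/-- The extension of maps from the generators of `E(g)` to an associative algebra, compatible with
the defining relations, to a map that takes brackets to graded commutators. -/
def Eeval (i : ℤ) : G.EX i →ₗ[k] A where
  toFun := Quotient.lift (EevalPre f₀ f₁) fun _ _ r => EevalPre_rel f₀ f₁ h₀ h₁ r
  map_add' := by rintro ⟨a⟩ ⟨b⟩; rfl
  map_smul' := by rintro c ⟨a⟩; rfl

lemma Eeval_Emk {i : ℤ} (a : EPre G i) :
    Eeval f₀ f₁ h₀ h₁ i (G.Emk a) = EevalPre f₀ f₁ a := rfl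

lemma Eeval_br {i j n : ℤ} (h : i + j = n) (x : G.EX i) (y : G.EX j) :
    Eeval f₀ f₁ h₀ h₁ n (G.Ebr h x y) =
      Eeval f₀ f₁ h₀ h₁ i x * Eeval f₀ f₁ h₀ h₁ j y
        - sgn k (i * j) • (Eeval f₀ f₁ h₀ h₁ j y * Eeval f₀ f₁ h₀ h₁ i x) := by
  obtain ⟨a, rfl⟩ := Emk_surj x
  obtain ⟨b, rfl⟩ := Emk_surj y
  rfl

end Lift

section Modules

variable {m : Type w} [AddCommGroup m] [Module k m]

/-- The subspace `m^anti` spanned by the elements `[x, a] + [a, x]`. -/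
def Rep.anti (V : G.Rep m) : Submodule k m :=
  Submodule.span k {b | ∃ x a, b = V.l x a + V.r a x}

/-- The quotient `m_symm = m / m^anti`. -/
abbrev Rep.Symm (V : G.Rep m) : Type w := m ⧸ V.anti

lemma Rep.mem_anti (V : G.Rep m) (x : g) (a : m) : V.l x a + V.r a x ∈ V.anti :=
  Submodule.subset_span ⟨x, a, rfl⟩

lemma Rep.l_anti (V : G.Rep m) (x : g) {a : m} (ha : a ∈ V.anti) : V.l x a ∈ V.anti := by
  induction ha using Submodule.span_induction with
  | mem a h =>
    obtain ⟨y, a, rfl⟩ := h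
    convert add_mem (V.mem_anti (G.br x y) a) (V.mem_anti y (V.l x a)) using 1
    rw [map_add, V.llm, V.lml]
    abel
  | zero => simp
  | add a b _ _ ha hb => rw [map_add]; exact add_mem ha hb
  | smul c a _ ha => rw [map_smul]; exact Submodule.smul_mem _ _ ha

lemma Rep.r_anti (V : G.Rep m) (x : g) {a : m} (ha : a ∈ V.anti) : V.r a x = 0 := by
  induction ha using Submodule.span_induction with
  | mem a h =>
    obtain ⟨y, a, rfl⟩ := h
    rw [map_add, LinearMap.add_apply, V.lml, V.mll]
    abel
  | zero => simp
  | add a b _ _ ha hb => simp [ha, hb]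
  | smul c a _ ha => simp [ha]

lemma Rep.l_ann (V : G.Rep m) {x : g} (hx : x ∈ G.ann) : V.l x = 0 := by
  induction hx using Submodule.span_induction with
  | mem x h => obtain ⟨y, rfl⟩ := h; ext a; simp [V.llm]
  | zero => simp
  | add a b _ _ ha hb => simp [ha, hb]
  | smul c a _ ha => simp [ha]

/-- Formal homogeneous expressions for the elements of the `E(g)`-module `E(m)`, generated by
`m` in degree `0` and `m_symm` in degree `-1`. -/
inductive MPre (V : G.Rep m) : ℤ → Type (max u v w)
  | zero (n : ℤ) : MPre V n
  | add {n : ℤ} : MPre V n → MPre V n → MPre V n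
  | smul {n : ℤ} : k → MPre V n → MPre V n
  | gen {n : ℤ} : n = 0 → m → MPre V n
  | sym {n : ℤ} : n = -1 → V.Symm → MPre V n
  | act {i p n : ℤ} : i + p = n → G.EX i → MPre V p → MPre V n

/-- The relations of `E(m)`: the axioms of a graded `E(g)`-module, linearity of the generators,
`⟦dx, a⟧ = [x, a]` and `⟦x, da⟧ = -[a, x]` for `x` in `g` and `a` in `m`, and the relation
`⟦dx, da⟧ = d[x, a]` obtained from them by applying the differential. -/
inductive MRel (V : G.Rep m) : ∀ {n : ℤ}, MPre V n → MPre V n → Prop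
  | refl {n : ℤ} (a : MPre V n) : MRel V a a
  | symm {n : ℤ} {a b : MPre V n} : MRel V a b → MRel V b a
  | trans {n : ℤ} {a b c : MPre V n} : MRel V a b → MRel V b c → MRel V a c
  | add_congr {n : ℤ} {a a' b b' : MPre V n} :
      MRel V a a' → MRel V b b' → MRel V (a.add b) (a'.add b')
  | smul_congr {n : ℤ} (c : k) {a a' : MPre V n} : MRel V a a' → MRel V (a.smul c) (a'.smul c)
  | act_congr {i p n : ℤ} (h : i + p = n) (x : G.EX i) {a a' : MPre V p} :
      MRel V a a' → MRel V (MPre.act h x a) (MPre.act h x a')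
  | add_assoc {n : ℤ} (a b c : MPre V n) : MRel V ((a.add b).add c) (a.add (b.add c))
  | add_comm {n : ℤ} (a b : MPre V n) : MRel V (a.add b) (b.add a)
  | zero_add {n : ℤ} (a : MPre V n) : MRel V ((MPre.zero n).add a) a
  | zero_smul {n : ℤ} (a : MPre V n) : MRel V (a.smul 0) (MPre.zero n)
  | one_smul {n : ℤ} (a : MPre V n) : MRel V (a.smul 1) a
  | mul_smul {n : ℤ} (c c' : k) (a : MPre V n) : MRel V (a.smul (c * c')) ((a.smul c').smul c)
  | add_smul {n : ℤ} (c c' : k) (a : MPre V n) :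
      MRel V (a.smul (c + c')) ((a.smul c).add (a.smul c'))
  | smul_add {n : ℤ} (c : k) (a b : MPre V n) :
      MRel V ((a.add b).smul c) ((a.smul c).add (b.smul c))
  | gen_add {n : ℤ} (h : n = 0) (a b : m) :
      MRel V (MPre.gen h (a + b)) ((MPre.gen h a).add (MPre.gen h b))
  | gen_smul {n : ℤ} (h : n = 0) (c : k) (a : m) :
      MRel V (MPre.gen h (c • a)) ((MPre.gen h a).smul c)
  | sym_add {n : ℤ} (h : n = -1) (a b : V.Symm) :
      MRel V (MPre.sym h (a + b)) ((MPre.sym h a).add (MPre.sym h b))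
  | sym_smul {n : ℤ} (h : n = -1) (c : k) (a : V.Symm) :
      MRel V (MPre.sym h (c • a)) ((MPre.sym h a).smul c)
  | act_add {i p n : ℤ} (h : i + p = n) (x : G.EX i) (b c : MPre V p) :
      MRel V (MPre.act h x (b.add c)) ((MPre.act h x b).add (MPre.act h x c))
  | add_act {i p n : ℤ} (h : i + p = n) (x y : G.EX i) (c : MPre V p) :
      MRel V (MPre.act h (x + y) c) ((MPre.act h x c).add (MPre.act h y c))
  | act_smul {i p n : ℤ} (h : i + p = n) (c : k) (x : G.EX i) (b : MPre V p) :
      MRel V (MPre.act h x (b.smul c)) ((MPre.act h x b).smul c)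
  | smul_act {i p n : ℤ} (h : i + p = n) (c : k) (x : G.EX i) (b : MPre V p) :
      MRel V (MPre.act h (c • x) b) ((MPre.act h x b).smul c)
  | act_br {i j n p r s q : ℤ} (h : i + j = n) (h₀ : n + p = q) (h₁ : j + p = r)
      (h₂ : i + r = q) (h₃ : i + p = s) (h₄ : j + s = q) (x : G.EX i) (y : G.EX j) (a : MPre V p) :
      MRel V (MPre.act h₀ (G.Ebr h x y) a)
        ((MPre.act h₂ x (MPre.act h₁ y a)).add
          ((MPre.act h₄ y (MPre.act h₃ x a)).smul (-sgn k (j * i))))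
  | act_lie_gen {i p n : ℤ} (h : i + p = n) (hi : i = 0) (hp : p = 0) (hn : n = 0) (x : g) (a : m) :
      MRel V (MPre.act h (G.Elie hi (G.toLie x)) (MPre.gen hp a)) (MPre.gen hn (V.l x a))
  | act_gen_sym {i p n : ℤ} (h : i + p = n) (hi : i = 1) (hp : p = -1) (hn : n = 0)
      (x : g) (a : m) :
      MRel V (MPre.act h (G.Egen hi x) (MPre.sym hp (V.anti.mkQ a))) (MPre.gen hn (-V.r a x))
  | act_lie_sym {i p n : ℤ} (h : i + p = n) (hi : i = 0) (hp : p = -1) (hn : n = -1)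
      (x : g) (a : m) :
      MRel V (MPre.act h (G.Elie hi (G.toLie x)) (MPre.sym hp (V.anti.mkQ a)))
        (MPre.sym hn (V.anti.mkQ (V.l x a)))

namespace Rep

variable (V : G.Rep m)

/-- The setoid of the relations of `E(m)`. -/
def ESetoid (n : ℤ) : Setoid (MPre V n) where
  r := MRel V
  iseqv := ⟨MRel.refl, MRel.symm, MRel.trans⟩

/-- The degree `n` part of `E(m)`. -/
def EX (n : ℤ) : Type (max u v w) := Quotient (V.ESetoid n)

/-- The class of a formal expression. -/
def Emk {n : ℤ} (a : MPre V n) : V.EX n := Quotient.mk (V.ESetoid n) a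

variable {V} in
lemma Emk_eq {n : ℤ} {a b : MPre V n} (h : MRel V a b) : V.Emk a = V.Emk b := Quotient.sound h

variable {V} in
lemma Emk_surj {n : ℤ} (a : V.EX n) : ∃ b, V.Emk b = a := Quotient.exists_rep a

/-- Addition in `E(m)`. -/
def Eadd {n : ℤ} : V.EX n → V.EX n → V.EX n :=
  Quotient.map₂ MPre.add fun _ _ h _ _ h' => MRel.add_congr h h'

/-- Scalar multiplication in `E(m)`. -/
def Esmul {n : ℤ} (c : k) : V.EX n → V.EX n :=
  Quotient.map (MPre.smul c) fun _ _ h => MRel.smul_congr c h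

instance (n : ℤ) : Add (V.EX n) := ⟨V.Eadd⟩
instance (n : ℤ) : Zero (V.EX n) := ⟨V.Emk (MPre.zero n)⟩
instance (n : ℤ) : Neg (V.EX n) := ⟨V.Esmul (-1)⟩

instance (n : ℤ) : AddCommGroup (V.EX n) where
  nsmul := nsmulRec
  zsmul := zsmulRec
  add_assoc := by
    rintro ⟨a⟩ ⟨b⟩ ⟨c⟩
    exact Emk_eq (.add_assoc a b c)
  add_comm := by
    rintro ⟨a⟩ ⟨b⟩
    exact Emk_eq (.add_comm a b)
  zero_add := by
    rintro ⟨a⟩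
    exact Emk_eq (.zero_add a)
  add_zero := by
    rintro ⟨a⟩
    exact Emk_eq (.trans (.add_comm _ _) (.zero_add a))
  neg_add_cancel := by
    rintro ⟨a⟩
    refine Emk_eq (.trans (.add_congr (.refl _) (.symm (.one_smul a))) ?_)
    refine .trans (.symm (.add_smul _ _ _)) ?_
    rw [neg_add_cancel]
    exact .zero_smul a

instance (n : ℤ) : Module k (V.EX n) where
  smul := V.Esmul
  one_smul := by
    rintro ⟨a⟩
    exact Emk_eq (.one_smul a)
  mul_smul := by
    rintro c c' ⟨a⟩
    exact Emk_eq (.mul_smul c c' a)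
  smul_zero c := by
    refine Emk_eq (.trans (.smul_congr c (.symm (.zero_smul (MPre.zero n)))) ?_)
    refine .trans (.symm (.mul_smul c 0 _)) ?_
    rw [mul_zero]
    exact .zero_smul _
  smul_add := by
    rintro c ⟨a⟩ ⟨b⟩
    exact Emk_eq (.smul_add c a b)
  add_smul := by
    rintro c c' ⟨a⟩
    exact Emk_eq (.add_smul c c' a)
  zero_smul := by
    rintro ⟨a⟩
    exact Emk_eq (.zero_smul a)

lemma Emk_add {n : ℤ} (a b : MPre V n) : V.Emk (a.add b) = V.Emk a + V.Emk b := rfl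
lemma Emk_smul {n : ℤ} (c : k) (a : MPre V n) : V.Emk (a.smul c) = c • V.Emk a := rfl
lemma Emk_zero (n : ℤ) : V.Emk (MPre.zero n) = 0 := rfl

/-- The action of `E(g)` on `E(m)`. -/
def Eact {i p n : ℤ} (h : i + p = n) : G.EX i →ₗ[k] V.EX p →ₗ[k] V.EX n :=
  LinearMap.mk₂ k (fun x => Quotient.map (MPre.act h x) fun _ _ r => MRel.act_congr h x r)
    (by rintro x y ⟨c⟩; exact Emk_eq (.add_act h x y c))
    (by rintro c x ⟨b⟩; exact Emk_eq (.smul_act h c x b))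
    (by rintro x ⟨b⟩ ⟨c⟩; exact Emk_eq (.act_add h x b c))
    (by rintro c x ⟨b⟩; exact Emk_eq (.act_smul h c x b))

lemma Emk_act {i p n : ℤ} (h : i + p = n) (x : G.EX i) (b : MPre V p) :
    V.Emk (MPre.act h x b) = V.Eact h x (V.Emk b) := rfl

/-- The generators `m → E(m)_0`. -/
def Egen {n : ℤ} (h : n = 0) : m →ₗ[k] V.EX n where
  toFun a := V.Emk (MPre.gen h a)
  map_add' a b := Emk_eq (.gen_add h a b)
  map_smul' c a := Emk_eq (.gen_smul h c a)

/-- The generators `m_symm → E(m)_{-1}`. -/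
def Esym {n : ℤ} (h : n = -1) : V.Symm →ₗ[k] V.EX n where
  toFun a := V.Emk (MPre.sym h a)
  map_add' a b := Emk_eq (.sym_add h a b)
  map_smul' c a := Emk_eq (.sym_smul h c a)

lemma Eact_br {i j n p r s q : ℤ} (h : i + j = n) (h₀ : n + p = q) (h₁ : j + p = r)
    (h₂ : i + r = q) (h₃ : i + p = s) (h₄ : j + s = q) (x : G.EX i) (y : G.EX j) (e : V.EX p) :
    V.Eact h₀ (G.Ebr h x y) e =
      V.Eact h₂ x (V.Eact h₁ y e) - sgn k (j * i) • V.Eact h₄ y (V.Eact h₃ x e) := by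
  obtain ⟨a, rfl⟩ := Emk_surj e
  rw [sub_eq_add_neg, ← neg_smul]
  exact Emk_eq (.act_br h h₀ h₁ h₂ h₃ h₄ x y a)

lemma Eact_lie_gen {i p n : ℤ} (h : i + p = n) (hi : i = 0) (hp : p = 0) (hn : n = 0)
    (x : g) (a : m) :
    V.Eact h (G.Elie hi (G.toLie x)) (V.Egen hp a) = V.Egen hn (V.l x a) :=
  Emk_eq (.act_lie_gen h hi hp hn x a)

lemma Eact_gen_sym {i p n : ℤ} (h : i + p = n) (hi : i = 1) (hp : p = -1) (hn : n = 0)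
    (x : g) (a : m) :
    V.Eact h (G.Egen hi x) (V.Esym hp (V.anti.mkQ a)) = V.Egen hn (-V.r a x) :=
  Emk_eq (.act_gen_sym h hi hp hn x a)

lemma Eact_lie_sym {i p n : ℤ} (h : i + p = n) (hi : i = 0) (hp : p = -1) (hn : n = -1)
    (x : g) (a : m) :
    V.Eact h (G.Elie hi (G.toLie x)) (V.Esym hp (V.anti.mkQ a))
      = V.Esym hn (V.anti.mkQ (V.l x a)) :=
  Emk_eq (.act_lie_sym h hi hp hn x a)

variable {V}

/-- The differential of a formal expression: the quotient map `m → m_symm` on generators, extended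
by the graded Leibniz rule. -/
def EdPre : ∀ {p : ℤ}, MPre V p → ∀ q : ℤ, q + 1 = p → V.EX q
  | _, .zero _, _, _ => 0
  | _, .add a b, q, h => EdPre a q h + EdPre b q h
  | _, .smul c a, q, h => c • EdPre a q h
  | _, .gen hn a, _, h => V.Esym (by omega) (V.anti.mkQ a)
  | _, .sym _ _, _, _ => 0
  | _, .act (i := i) (p := p) h x a, n, hn =>
      V.Eact (by omega) (G.Ed (sub_add_cancel i 1) x) (V.Emk a)
        + sgn k i • V.Eact (by omega) x (EdPre a (p - 1) (by omega))

lemma EdPre_rel {p : ℤ} {a b : MPre V p} (r : MRel V a b) (q : ℤ) (h : q + 1 = p) :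
    EdPre a q h = EdPre b q h := by
  induction r generalizing q with
  | refl a => rfl
  | symm _ ih => exact (ih q h).symm
  | trans _ _ ih ih' => exact (ih q h).trans (ih' q h)
  | add_congr _ _ ih ih' => simp only [EdPre, ih q h, ih' q h]
  | smul_congr c _ ih => simp only [EdPre, ih q h]
  | act_congr h x r ih => simp only [EdPre, ih, Emk_eq r]
  | add_assoc a b c => simp only [EdPre, add_assoc]
  | add_comm a b => simp only [EdPre, add_comm]
  | zero_add a => simp only [EdPre, zero_add]
  | zero_smul a => simp only [EdPre, zero_smul]
  | one_smul a => simp only [EdPre, one_smul]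
  | mul_smul c c' a => simp only [EdPre, mul_smul]
  | add_smul c c' a => simp only [EdPre, add_smul]
  | smul_add c a b => simp only [EdPre, smul_add]
  | gen_add h a b => simp only [EdPre, map_add]
  | gen_smul h c a => simp only [EdPre, map_smul]
  | sym_add h a b => simp only [EdPre, add_zero]
  | sym_smul h c a => simp only [EdPre, smul_zero]
  | act_add h x b c =>
    simp only [EdPre, Emk_add, map_add, smul_add]
    abel
  | add_act h x y c =>
    simp only [EdPre, map_add, smul_add, LinearMap.add_apply]
    abel
  | act_smul h c x b =>
    simp only [EdPre, Emk_smul, map_smul, smul_add, smul_comm c]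
  | smul_act h c x b =>
    simp only [EdPre, map_smul, smul_add, LinearMap.smul_apply, smul_comm c]
  | @act_br i j n p r s t hij h₀ h₁ h₂ h₃ h₄ x y a =>
    have hi := sub_add_cancel i 1
    have hj := sub_add_cancel j 1
    have hn := sub_add_cancel n 1
    have k1 : (i - 1) + j = n - 1 := by omega
    have k2 : i + (j - 1) = n - 1 := by omega
    simp only [EdPre, Emk_act]
    rw [LeftLeibniz.Ed_br hij hn hi hj k1 k2, map_add, map_smul, LinearMap.add_apply,
      LinearMap.smul_apply,
      V.Eact_br k1 (by omega) h₁ (by omega) (by omega : (i - 1) + p = s - 1) (by omega),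
      V.Eact_br k2 (by omega) (by omega : (j - 1) + p = r - 1) (by omega) h₃ (by omega),
      V.Eact_br hij (by omega) (by omega : j + (p - 1) = r - 1) (by omega)
        (by omega : i + (p - 1) = s - 1) (by omega)]
    subst hij
    by_cases pi : Even i <;> by_cases pj : Even j <;>
      simp [sgn_eq_ite, parity_simps, pi, pj, ← Int.not_even_iff_odd] <;> abel
  | act_lie_gen h' hi hp hn x a =>
    subst hi
    simp only [EdPre, Ed_lie, map_zero, LinearMap.zero_apply, zero_add]
    rw [V.Eact_lie_sym _ rfl (by omega) (by omega)]
    simp [sgn_eq_ite]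
  | act_gen_sym h' hi hp hn x a =>
    subst hi
    simp only [EdPre, Ed_gen, map_zero, smul_zero, add_zero]
    change V.Eact _ (G.Elie _ (G.toLie x)) (V.Esym hp (V.anti.mkQ a)) = _
    rw [V.Eact_lie_sym _ (by omega) hp (by omega)]
    congr 1
    rw [← sub_eq_zero, ← map_sub, sub_neg_eq_add, Submodule.mkQ_apply,
      Submodule.Quotient.mk_eq_zero]
    exact V.mem_anti x a
  | act_lie_sym h' hi hp hn x a =>
    subst hi
    simp only [EdPre, Ed_lie, map_zero, LinearMap.zero_apply, zero_add, smul_zero]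

variable (V) in
/-- The differential of `E(m)`. -/
def Ed {p q : ℤ} (h : q + 1 = p) : V.EX p →ₗ[k] V.EX q where
  toFun := Quotient.lift (fun a => EdPre a q h) fun _ _ r => EdPre_rel r q h
  map_add' := by rintro ⟨a⟩ ⟨b⟩; rfl
  map_smul' := by rintro c ⟨a⟩; rfl

lemma Ed_act {i p n i' p' n' : ℤ} (h : i + p = n) (hn : n' + 1 = n) (hi : i' + 1 = i)
    (hp : p' + 1 = p) (h₁ : i' + p = n') (h₂ : i + p' = n') (x : G.EX i) (e : V.EX p) :
    V.Ed hn (V.Eact h x e) = V.Eact h₁ (G.Ed hi x) e + sgn k i • V.Eact h₂ x (V.Ed hp e) := by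
  obtain ⟨a, rfl⟩ := Emk_surj e
  obtain rfl : i' = i - 1 := by omega
  obtain rfl : p' = p - 1 := by omega
  rfl

lemma Ed_d {p q r : ℤ} (h : q + 1 = p) (h' : r + 1 = q) (e : V.EX p) :
    V.Ed h' (V.Ed h e) = 0 := by
  obtain ⟨a, rfl⟩ := Emk_surj e
  induction a generalizing q r with
  | zero n => rw [Emk_zero, map_zero, map_zero]
  | add a b iha ihb => rw [Emk_add, map_add, map_add, iha, ihb, add_zero]
  | smul c a ih => rw [Emk_smul, map_smul, map_smul, ih, smul_zero]
  | gen hn a => rfl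
  | sym hn a => exact map_zero (V.Ed h')
  | @act i p n hip x a ih =>
    rw [Emk_act, Ed_act hip h (sub_add_cancel i 1) (sub_add_cancel p 1) (by omega) (by omega),
      map_add, map_smul, Ed_act _ h' (sub_add_cancel (i - 1) 1) (sub_add_cancel p 1) (by omega)
        (by omega), Ed_act _ h' (sub_add_cancel i 1) (sub_add_cancel (p - 1) 1) (by omega)
        (by omega), ih, LeftLeibniz.Ed_d]
    by_cases pp : Even i <;> simp [sgn_eq_ite, pp, parity_simps, ← Int.not_even_iff_odd]

variable (V) in
/-- The DG module `E(m)` over `E(g)`: the DG module generated by the complex `m → m_symm` (degrees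
`0` and `-1`) with the relations `⟦dx, a⟧ = [x, a]` and `⟦x, da⟧ = -[a, x]`. -/
def E : DGModule.{u, max u v, max u v w} G.E where
  X := V.EX
  act := V.Eact
  act_br := V.Eact_br
  d := V.Ed
  d_d := Ed_d
  d_act := Ed_act

/-- The space `m^anti ⊕ m ⊕ m_symm` underlying `M(m)`. -/
abbrev W (V : G.Rep m) : Type w := V.anti × m × V.Symm

variable (V)

/-- The operators of the elements of `g`, acting on `m^anti ⊕ m ⊕ m_symm` through `g_Lie`. -/
def op₀ : g →ₗ[k] Module.End k V.W where
  toFun x :=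
    ((V.l x).restrict fun _ h => V.l_anti x h).prodMap
      ((V.l x).prodMap (V.anti.mapQ V.anti (V.l x) fun _ h => V.l_anti x h))
  map_add' x y := by ext <;> simp
  map_smul' c x := by ext <;> simp

/-- The action of `g_Lie` on `m^anti ⊕ m ⊕ m_symm`. -/
def opLie : G.LieQuot →ₗ[k] Module.End k V.W :=
  G.ann.liftQ V.op₀ fun x hx => by
    rw [LinearMap.mem_ker]
    ext <;> simp [op₀, V.l_ann hx]

lemma opLie_toLie (x : g) : V.opLie (G.toLie x) = V.op₀ x := rfl

/-- The map `m_symm → m`, `da ↦ -[a, x]`. -/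
def symR (x : g) : V.Symm →ₗ[k] m := V.anti.liftQ (-V.r.flip x) fun a h => by
  simp [V.r_anti x h]

lemma symR_mkQ (x : g) (a : m) : V.symR x (V.anti.mkQ a) = -V.r a x := rfl

/-- The action of `x` in `g` on `m^anti ⊕ m ⊕ m_symm`: `x · a = [x, a] + [a, x]` in `m^anti` for `a`
in `m`, and `x · da = -[a, x]` in `m` for `da` in `m_symm`. -/
def opGen : g →ₗ[k] Module.End k V.W :=
  LinearMap.mk₂ k (fun x z => (⟨V.l x z.2.1 + V.r z.2.1 x, V.mem_anti x z.2.1⟩,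
      V.symR x z.2.2, 0))
    (fun x y z => by
      obtain ⟨a, b, c⟩ := z
      obtain ⟨c, rfl⟩ := V.anti.mkQ_surjective c
      simp only [symR_mkQ]
      ext <;> simp <;> abel)
    (fun t x z => by
      obtain ⟨a, b, c⟩ := z
      obtain ⟨c, rfl⟩ := V.anti.mkQ_surjective c
      simp only [symR_mkQ]
      ext <;> simp)
    (fun x z z' => by ext <;> simp; abel)
    (fun t x z => by ext <;> simp)

lemma op₀_apply (x : g) (a : V.anti) (b c : m) :
    V.op₀ x (a, b, V.anti.mkQ c) = (⟨V.l x a, V.l_anti x a.2⟩, V.l x b, V.anti.mkQ (V.l x c)) := rfl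

lemma opGen_apply (x : g) (a : V.anti) (b c : m) :
    V.opGen x (a, b, V.anti.mkQ c) = (⟨V.l x b + V.r b x, V.mem_anti x b⟩, -V.r c x, 0) := rfl

lemma opLie_lie (a b : G.LieQuot) :
    V.opLie ⁅a, b⁆ = V.opLie a * V.opLie b - V.opLie b * V.opLie a := by
  obtain ⟨x, rfl⟩ := G.toLie_surjective a
  obtain ⟨y, rfl⟩ := G.toLie_surjective b
  rw [G.toLie_lie]
  simp only [opLie_toLie]
  ext <;> simp [op₀, V.llm]

lemma opGen_lieAct (a : G.LieQuot) (y : g) :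
    V.opGen (G.lieAct a y) = V.opLie a * V.opGen y - V.opGen y * V.opLie a := by
  obtain ⟨x, rfl⟩ := G.toLie_surjective a
  rw [G.lieAct_toLie, opLie_toLie]
  refine LinearMap.ext fun z => ?_
  obtain ⟨a, b, c⟩ := z
  obtain ⟨c, rfl⟩ := V.anti.mkQ_surjective c
  have e : V.op₀ x (V.opGen y (a, b, V.anti.mkQ c)) = (⟨V.l x (V.l y b + V.r b y),
      V.l_anti x (V.mem_anti y b)⟩, V.l x (-V.r c y), 0) := by
    rw [opGen_apply, ← map_zero V.anti.mkQ, op₀_apply, map_zero]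
  rw [LinearMap.sub_apply, Module.End.mul_apply, Module.End.mul_apply, e, op₀_apply, opGen_apply,
    opGen_apply]
  ext
  · simp [V.llm, V.lml]
    abel
  · simp [V.lml]
    abel
  · simp

/-- The action of the elements of `E(g)_i` on `m^anti ⊕ m ⊕ m_symm`. -/
def opE (i : ℤ) : G.EX i →ₗ[k] Module.End k V.W :=
  Eeval V.opLie V.opGen V.opLie_lie V.opGen_lieAct i

lemma opE_br {i j n : ℤ} (h : i + j = n) (x : G.EX i) (y : G.EX j) :
    V.opE n (G.Ebr h x y) =
      V.opE i x * V.opE j y - sgn k (i * j) • (V.opE j y * V.opE i x) :=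
  Eeval_br _ _ _ _ h x y

/-- The degree `p` part of `M(m)`: `m^anti`, `m`, `m_symm` in degrees `1`, `0`, `-1`. -/
def MX (p : ℤ) : Submodule k V.W where
  carrier := {z | (p ≠ 1 → z.1 = 0) ∧ (p ≠ 0 → z.2.1 = 0) ∧ (p ≠ -1 → z.2.2 = 0)}
  add_mem' := fun ha hb =>
    ⟨fun h => by simp [ha.1 h, hb.1 h], fun h => by simp [ha.2.1 h, hb.2.1 h],
      fun h => by simp [ha.2.2 h, hb.2.2 h]⟩
  zero_mem' := ⟨fun _ => rfl, fun _ => rfl, fun _ => rfl⟩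
  smul_mem' := fun c a ha =>
    ⟨fun h => by simp [ha.1 h], fun h => by simp [ha.2.1 h], fun h => by simp [ha.2.2 h]⟩

/-- The differential of `m^anti ⊕ m ⊕ m_symm`: the inclusion `m^anti → m` and the quotient map
`m → m_symm`. -/
def dW : V.W →ₗ[k] V.W where
  toFun z := (0, z.1, V.anti.mkQ z.2.1)
  map_add' z z' := by simp
  map_smul' c z := by simp

lemma dW_mem {p q : ℤ} (h : q + 1 = p) {z : V.W} (hz : z ∈ V.MX p) : V.dW z ∈ V.MX q :=
  ⟨fun _ => rfl,
    fun h' => by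
      change (z.1 : m) = 0
      rw [hz.1 (by omega)]; rfl,
    fun h' => by
      change V.anti.mkQ z.2.1 = 0
      rw [hz.2.1 (by omega), map_zero]⟩

lemma dW_dW (z : V.W) : V.dW (V.dW z) = 0 := by
  obtain ⟨a, b, c⟩ := z
  change ((0 : V.anti), ((0 : V.anti) : m), V.anti.mkQ (a : m)) = 0
  have : V.anti.mkQ (a : m) = 0 := (Submodule.Quotient.mk_eq_zero _).2 a.2
  rw [this]
  rfl

lemma opE_mem {i p q : ℤ} (h : i + p = q) (x : G.EX i) {z : V.W} (hz : z ∈ V.MX p) :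
    V.opE i x z ∈ V.MX q := by
  obtain ⟨t, rfl⟩ := LeftLeibniz.Emk_surj x
  induction t generalizing p q z with
  | zero n => rw [LeftLeibniz.Emk_zero, map_zero]; exact zero_mem _
  | add a b iha ihb =>
    rw [LeftLeibniz.Emk_add, map_add]
    exact add_mem (iha h hz) (ihb h hz)
  | smul c a ih =>
    rw [LeftLeibniz.Emk_smul, map_smul]
    exact Submodule.smul_mem _ _ (ih h hz)
  | lie hn a =>
    subst hn
    obtain rfl : q = p := by omega
    obtain ⟨x, rfl⟩ := G.toLie_surjective a
    change V.op₀ x z ∈ _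
    obtain ⟨a, b, c⟩ := z
    obtain ⟨c, rfl⟩ := V.anti.mkQ_surjective c
    exact ⟨fun h => by
        have : a = 0 := hz.1 h
        subst this
        change (⟨V.l x ((0 : V.anti) : m), _⟩ : V.anti) = 0
        ext; simp,
      fun h => by
        have : b = 0 := hz.2.1 h
        change V.l x b = 0
        rw [this, map_zero],
      fun h => by
        have e : V.anti.mkQ c = 0 := hz.2.2 h
        have : V.op₀ x (a, b, V.anti.mkQ c) = V.op₀ x (a, b, V.anti.mkQ 0) := by rw [e, map_zero]
        rw [this, op₀_apply]
        simp⟩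
  | gen hn x =>
    subst hn
    change V.opGen x z ∈ _
    obtain ⟨a, b, c⟩ := z
    exact ⟨fun h => by
        have : b = 0 := hz.2.1 (by omega)
        subst this
        change (⟨V.l x 0 + V.r 0 x, _⟩ : V.anti) = 0
        ext; simp,
      fun h => by
        have : c = 0 := hz.2.2 (by omega)
        subst this
        exact map_zero (V.symR x),
      fun h => rfl⟩
  | @br i j n hij a b iha ihb =>
    rw [LeftLeibniz.Emk_br, opE_br, LinearMap.sub_apply, LinearMap.smul_apply]
    exact sub_mem (iha (by omega) (ihb rfl hz))
      (Submodule.smul_mem _ _ (ihb (by omega) (iha rfl hz)))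

lemma dW_opE {i j : ℤ} (h : j + 1 = i) (x : G.EX i) (z : V.W) :
    V.dW (V.opE i x z) = V.opE j (G.Ed h x) z + sgn k i • V.opE i x (V.dW z) := by
  obtain ⟨t, rfl⟩ := LeftLeibniz.Emk_surj x
  induction t generalizing j z with
  | zero n => simp [LeftLeibniz.Emk_zero]
  | add a b iha ihb =>
    simp only [LeftLeibniz.Emk_add, map_add, LinearMap.add_apply, iha h, ihb h, smul_add]
    abel
  | smul c a ih =>
    simp only [LeftLeibniz.Emk_smul, map_smul, LinearMap.smul_apply, ih h, smul_add, smul_comm c]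
  | lie hn a =>
    subst hn
    obtain ⟨x, rfl⟩ := G.toLie_surjective a
    change V.dW (V.op₀ x z) = V.opE j 0 z + sgn k 0 • V.op₀ x (V.dW z)
    obtain ⟨a, b, c⟩ := z
    rw [map_zero, LinearMap.zero_apply, zero_add, sgn_eq_ite, if_pos (by simp), one_smul]
    change (0, V.l x a, V.anti.mkQ (V.l x b)) = V.op₀ x (0, a.1, V.anti.mkQ b)
    rw [op₀_apply]
    ext <;> simp
  | gen hn x =>
    subst hn
    obtain rfl : j = 0 := by omega
    obtain ⟨a, b, c⟩ := z
    obtain ⟨c, rfl⟩ := V.anti.mkQ_surjective c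
    change V.dW (V.opGen x (a, b, V.anti.mkQ c)) = V.op₀ x (a, b, V.anti.mkQ c)
      + sgn k 1 • V.opGen x (0, a.1, V.anti.mkQ b)
    rw [opGen_apply, opGen_apply, op₀_apply, sgn_eq_ite, if_neg (by simp), neg_one_smul]
    change (0, V.l x b + V.r b x, V.anti.mkQ (-V.r c x)) = _
    have e := V.r_anti x a.2
    ext
    · simp [e]
    · simp
    · have := (Submodule.Quotient.mk_eq_zero _).2 (V.mem_anti x c)
      rw [← Submodule.mkQ_apply, map_add] at this
      simp only [Prod.snd_add, Prod.snd_neg, neg_zero, add_zero, map_neg]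
      exact (eq_neg_of_add_eq_zero_left this).symm
  | @br p q n hij a b iha ihb =>
    rw [LeftLeibniz.Emk_br, Ed_br hij h (sub_add_cancel p 1) (sub_add_cancel q 1) (by omega)
      (by omega)]
    simp only [opE_br, map_add, map_smul, LinearMap.sub_apply, LinearMap.add_apply,
      LinearMap.smul_apply, Module.End.mul_apply, map_sub]
    simp only [iha (sub_add_cancel p 1), ihb (sub_add_cancel q 1), map_add, map_smul]
    subst hij
    by_cases pi : Even p <;> by_cases pj : Even q <;>
      simp [sgn_eq_ite, parity_simps, pi, pj, ← Int.not_even_iff_odd] <;> abel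

/-- The DG module `M(m)` over `E(g)`: the complex `m^anti → m → m_symm` in degrees `1`, `0`, `-1`,
where `g_Lie` acts through the left action of `g` on `m`, and `x` in `g` acts by
`⟦x, a⟧ = [x, a] + [a, x]` for `a` in `m` and `⟦x, da⟧ = -[a, x]` for `da` in `m_symm`. -/
def M : DGModule.{u, max u v, w} G.E where
  X p := V.MX p
  act {i p q} h := LinearMap.mk₂ k (fun x z => ⟨V.opE i x z, V.opE_mem h x z.2⟩)
    (fun x y z => by ext : 1; exact LinearMap.congr_fun (map_add (V.opE i) x y) z.1)
    (fun c x z => by ext : 1; exact LinearMap.congr_fun (map_smul (V.opE i) c x) z.1)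
    (fun x z z' => by ext : 1; exact map_add (V.opE i x) z.1 z'.1)
    (fun c x z => by ext : 1; exact map_smul (V.opE i x) c z.1)
  act_br {i j _ _ _ _ _} h _ _ _ _ _ x y z := by
    apply Subtype.ext
    have := LinearMap.congr_fun (V.opE_br h x y) z.1
    rw [mul_comm j i]
    exact this
  d h := V.dW.restrict fun _ hz => V.dW_mem h hz
  d_d _ _ z := Subtype.ext (V.dW_dW z.1)
  d_act _ _ hi _ _ _ x z := Subtype.ext (V.dW_opE hi x z.1)

end Rep
end Modules

attribute [local instance 100] LieRing.ofAssociativeRing LieAlgebra.ofAssociativeAlgebra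

variable (G)

/-- The identification of `g_Lie` with `E(g)_0`. -/
def eLie : G.LieQuot →ₗ[k] G.E.X 0 := G.Elie rfl

/-- The map from `g` to `E(g)_1`. -/
def eGen : g →ₗ[k] G.E.X 1 := G.Egen rfl

variable {G} in
/-- The map from `m` to `E(m)_0`. -/
def Rep.eGen {m : Type w} [AddCommGroup m] [Module k m] (V : G.Rep m) : m →ₗ[k] V.E.X 0 :=
  V.Egen rfl

/-- The homomorphism `U(g_Lie) → U(E(g))` induced by `g_Lie = E(g)_0 → U(E(g))`. -/
def uLie : UniversalEnvelopingAlgebra k G.LieQuot →ₐ[k] G.E.U :=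
  UniversalEnvelopingAlgebra.lift k
    { (G.E.ι 0 ∘ₗ G.eLie : G.LieQuot →ₗ[k] G.E.U) with
      map_lie' := fun {a b} => by
        change G.E.ι 0 (G.Elie rfl ⁅a, b⁆) = ⁅G.E.ι 0 (G.Elie rfl a), G.E.ι 0 (G.Elie rfl b)⁆
        have e := G.E.ι_br (add_zero 0) (G.Elie rfl a) (G.Elie rfl b)
        rw [LieRing.of_associative_ring_bracket, ← G.Ebr_lie_lie (add_zero 0) rfl rfl rfl]
        refine e.symm.trans ?_
        simp [sgn_eq_ite] }

/-- `U(E(g))` as a left `U(g_Lie)`-module. -/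
instance : Module (UniversalEnvelopingAlgebra k G.LieQuot) G.E.U :=
  Module.compHom _ G.uLie.toRingHom

/-- The homomorphism `T(g) → U(E(g))` induced by the inclusion of `g` in `E(g)_1`. -/
def uGen : TensorAlgebra k g →ₐ[k] G.E.U :=
  TensorAlgebra.lift k (G.E.ι 1 ∘ₗ G.eGen)

/-- The product `x_1 ⋯ x_n` in `U(E(g))_n` of elements of `g`. -/
def uProd {n : ℕ} (x : Fin n → g) : G.E.Udeg n :=
  ⟨(List.ofFn fun i => G.E.ι 1 (G.eGen (x i))).prod,
    Submodule.subset_span ⟨List.ofFn fun i => ⟨1, G.eGen (x i)⟩, by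
      simp [List.map_ofFn, Function.comp_def], by
      rw [List.map_ofFn]
      rfl⟩⟩

/-- The action of `a` in `g_Lie` on `U(E(g))_n` by left multiplication. -/
def lieMul (n : ℤ) : G.LieQuot →ₗ[k] G.E.Udeg n →ₗ[k] G.E.Udeg n :=
  G.E.mulUdeg (zero_add n) ∘ₗ G.eLie

lemma dUdeg_lieMul {n n' : ℤ} (h : n' + 1 = n) (a : G.LieQuot) (u : G.E.Udeg n) :
    G.E.dUdeg h (G.lieMul n a u) = G.lieMul n' a (G.E.dUdeg h u) := by
  have e := G.E.dUdeg_mulUdeg (zero_add n) (sub_add_cancel 0 1) h h (by omega) (zero_add n')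
    (G.Elie rfl a) u
  have e0 : G.E.d (sub_add_cancel 0 1) (G.Elie rfl a) = 0 := rfl
  rw [e0, map_zero, LinearMap.zero_apply, zero_add, sgn_eq_ite, if_pos (by simp), one_smul] at e
  exact e

section LieCoefficients

variable (m : Type w) [AddCommGroup m] [Module k m] [LieRingModule G.LieQuot m]
  [LieModule k G.LieQuot m]

/-- The relations `v a ⊗ u = v ⊗ a u` for `a` in `g_Lie`, where `v a = -a v`. -/
def lieTensRel (n : ℤ) : Submodule k (m ⊗[k] G.E.Udeg n) :=
  Submodule.span k {t | ∃ (v : m) (a : G.LieQuot) (u : G.E.Udeg n),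
    t = (-⁅a, v⁆) ⊗ₜ u - v ⊗ₜ G.lieMul n a u}

/-- The degree `n` part of `m ⊗_{g_Lie} U(E(g))`. -/
abbrev LieTens (n : ℤ) : Type (max u v w) := (m ⊗[k] G.E.Udeg n) ⧸ G.lieTensRel m n

variable {m} in
/-- The class of `v ⊗ u` in `m ⊗_{g_Lie} U(E(g))`. -/
def lieTmk {n : ℤ} (v : m) (u : G.E.Udeg n) : G.LieTens m n := (G.lieTensRel m n).mkQ (v ⊗ₜ u)

/-- The differential `v ⊗ u ↦ v ⊗ du` of the chain complex `m ⊗_{g_Lie} U(E(g))`. -/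
def lieTensD {n n' : ℤ} (h : n' + 1 = n) : G.LieTens m n →ₗ[k] G.LieTens m n' :=
  (G.lieTensRel m n).mapQ (G.lieTensRel m n') (LinearMap.lTensor m (G.E.dUdeg h)) <| by
    rw [lieTensRel, Submodule.span_le]
    rintro _ ⟨v, a, u, rfl⟩
    refine Submodule.subset_span ⟨v, a, G.E.dUdeg h u, ?_⟩
    rw [map_sub, LinearMap.lTensor_tmul, LinearMap.lTensor_tmul, dUdeg_lieMul]

/-- The degree `n` part of `Hom_{g_Lie}(U(E(g)), m)`. -/
def lieHom (n : ℤ) : Submodule k (G.E.Udeg n →ₗ[k] m) where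
  carrier := {f | ∀ a u, f (G.lieMul n a u) = ⁅a, f u⁆}
  add_mem' hf hf' a u := by simp [hf a u, hf' a u]
  zero_mem' a u := by simp
  smul_mem' c f hf a u := by simp [hf a u]

/-- The differential `f ↦ f ∘ d` of the cochain complex `Hom_{g_Lie}(U(E(g)), m)`. -/
def lieHomD {n n' : ℤ} (h : n + 1 = n') : G.lieHom m n →ₗ[k] G.lieHom m n' where
  toFun f := ⟨f.1 ∘ₗ G.E.dUdeg h, fun a u => by
    rw [LinearMap.comp_apply, dUdeg_lieMul]
    exact f.2 a _⟩
  map_add' f f' := by ext; rfl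
  map_smul' c f := by ext; rfl

end LieCoefficients

section RepCoefficients

variable {G} {m : Type w} [AddCommGroup m] [Module k m] (V : G.Rep m)

/-- The element `v ⊗ x_1 ⋯ x_n` of `E(m) ⊗_{E(g)} U(E(g))`, for `v` in `m` and `x_i` in `g`. -/
def Rep.tensProd {n : ℕ} (v : m) (x : Fin n → g) : V.E.tensDeg n :=
  ⟨V.E.tmk (V.eGen v) (G.uProd x : G.E.U),
    V.E.tmk_mem (zero_add _) _ (G.uProd x).2⟩

/-- The truncated graded `E(g)`-module `Ē(m)`. -/
abbrev Rep.Ebar : GrModule.{u, max u v, max u v w} G.E := V.E.trunc E_nonneg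

/-- The truncated graded `E(g)`-module `M̄(m)`. -/
abbrev Rep.Mbar : GrModule.{u, max u v, w} G.E := V.M.trunc E_nonneg

/-- The identification of the degree `0` part of `M̄(m)` with `m`. -/
def Rep.Mbar₀ : V.Mbar.X 0 →ₗ[k] m :=
  LinearMap.fst k m V.Symm ∘ₗ LinearMap.snd k V.anti (m × V.Symm) ∘ₗ (V.MX 0).subtype
    ∘ₗ V.M.truncIncl E_nonneg 0

end RepCoefficients

end LeftLeibniz
end Universal
end DG
end Leib

open Leib

/-! The relations of `E(g)` prescribe the brackets of `g_Lie` with itself and with `g`, and nothing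
about the brackets of elements of `g` with each other. So `U(E(g))` is generated by `g_Lie` and `g`
with the relations `a b - b a = [a, b]` and `x a = a x - a · x` only: it is the smash product of
`U(g_Lie)` with `T(g)`, on which `g_Lie` acts by derivations. Moving `g_Lie` to the left shows that
`a ⊗ t ↦ a t` is onto (`smash_surjective`). The formulas `(u ⊗ t) a = u a ⊗ t - u ⊗ (a · t)` and `(u
⊗ t) x = u ⊗ t x` make `U(g_Lie) ⊗ T(g)` a right `U(E(g))`-module (`smashRight`), and acting on `1 ⊗
1` inverts the map (`smashInv_smash`).

Hence the degree `n` part of `U(E(g))` is the `U(g_Lie)`-module induced from `g^{⊗ n}`: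
`g_Lie`-linear maps out of it are the same as `n`-linear maps on `g` (`uExt`, `Udeg_hom_ext`). The
four comparisons with Loday's differentials rest on one computation, `dU_uProd`. By the Leibniz
rule, `d(x_0 ⋯ x_n)` is the alternating sum of the words in which `x_j` is replaced by `dx_j`;
moving `dx_j` to the left past `x_i`, `i < j`, costs `-[x_j, x_i] = -[x_i, x_j]_opp`. These
corrections form the double sum of Loday's formulas with the opposite sign, and the factors `dx_j`
that arrive at the left act on the coefficients.

For a representation `m`, the tensor product `N ⊗_L U(L)` is `N` itself (`toTensDeg_injective`,
`toTensDeg_surjective`), so its degree `n` part sees only `N_n`; this gives the statement on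
truncation. In degrees `n ≥ 0` the elements `v ⊗ x_1 ⋯ x_n` span, because `dv ⊗ x = -[v, x] ⊗ 1`
removes `m_symm` as soon as an element of `g` acts (`tensOf_surjective`). They are independent
because `E(m)` maps to an explicit module `m ⊗ T(g) ⊕ m_symm` (`toModel`, `tensDegTo_tensProd`). The
summand `dv ⊗ x_0 ⋯ x_n` of the differential supplies the missing `-[v, x_0]`.

In cohomology, `M̄(m)` lives in degrees `0` and `1`. A morphism of degree `-n` is therefore
determined by its values on words of length `n`, and is prolonged to words of length `n + 1` in the
only possible way, `f(x u) = (-1)^n x f(u)` (`extW`, `homTo_injective`). The term `d ∘ f` then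
subtracts `[x_0, f] + [f, x_0]`, which turns the first summand `[x_0, f]` of `f ∘ d` into `-[f,
x_0]`. -/

namespace TensorAlgebra

/-! ### Derivations of the tensor algebra. -/

variable {k : Type*} [CommRing k] {V : Type*} [AddCommGroup V] [Module k V]

/-- The homomorphism `t ↦ (t, D t; 0, t)`, where `D` is the derivation of the tensor algebra that
extends the operator `f`. -/
def derivMat (f : Module.End k V) :
    TensorAlgebra k V →ₐ[k] Matrix (Fin 2) (Fin 2) (TensorAlgebra k V) :=
  TensorAlgebra.lift k
    { toFun := fun v => !![ι k v, ι k (f v); 0, ι k v]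
      map_add' := fun a b => by ext i j; fin_cases i <;> fin_cases j <;> simp
      map_smul' := fun c a => by ext i j; fin_cases i <;> fin_cases j <;> simp }

lemma derivMat_ι (f : Module.End k V) (v : V) :
    derivMat f (ι k v) = !![ι k v, ι k (f v); 0, ι k v] := by
  simp [derivMat]

/-- The matrices are upper triangular with `t` twice on the diagonal, so multiplicativity of
`derivMat` is the Leibniz rule for its upper right entry. -/
lemma derivMat_diag (f : Module.End k V) (t : TensorAlgebra k V) :
    derivMat f t 0 0 = t ∧ derivMat f t 1 0 = 0 ∧ derivMat f t 1 1 = t := by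
  induction t using TensorAlgebra.induction with
  | algebraMap c => simp [Algebra.algebraMap_eq_smul_one]
  | ι v => simp [derivMat_ι]
  | mul a b ha hb => simp [Matrix.mul_apply, ha, hb]
  | add a b ha hb => simp [ha, hb]

/-- The derivation of the tensor algebra that extends the operator `f`. -/
def deriv (f : Module.End k V) : Module.End k (TensorAlgebra k V) where
  toFun t := derivMat f t 0 1
  map_add' := by simp
  map_smul' := by simp

lemma deriv_one (f : Module.End k V) : deriv f 1 = 0 := by simp [deriv]

lemma deriv_ι (f : Module.End k V) (v : V) : deriv f (ι k v) = ι k (f v) := by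
  simp [deriv, derivMat_ι]

lemma deriv_mul (f : Module.End k V) (s t : TensorAlgebra k V) :
    deriv f (s * t) = deriv f s * t + s * deriv f t := by
  simp [deriv, Matrix.mul_apply, Fin.sum_univ_two, derivMat_diag, add_comm]

lemma deriv_algebraMap (f : Module.End k V) (c : k) : deriv f (algebraMap k _ c) = 0 := by
  rw [Algebra.algebraMap_eq_smul_one, map_smul, deriv_one, smul_zero]

/-- A derivation of the tensor algebra is determined by its values on the generators. -/
lemma eq_deriv (f : Module.End k V) (D : Module.End k (TensorAlgebra k V)) (h1 : D 1 = 0)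
    (hι : ∀ v, D (ι k v) = ι k (f v)) (hmul : ∀ s t, D (s * t) = D s * t + s * D t) :
    D = deriv f := by
  ext t
  induction t using TensorAlgebra.induction with
  | algebraMap c => rw [deriv_algebraMap, Algebra.algebraMap_eq_smul_one, map_smul, h1, smul_zero]
  | ι v => rw [hι, deriv_ι]
  | mul a b ha hb => rw [hmul, deriv_mul, ha, hb]
  | add a b ha hb => rw [map_add, map_add, ha, hb]

lemma deriv_add (f f' : Module.End k V) : deriv (f + f') = deriv f + deriv f' := by
  refine (eq_deriv _ _ (by simp [deriv_one]) (by simp [deriv_ι]) fun s t => ?_).symm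
  simp only [LinearMap.add_apply, deriv_mul, add_mul, mul_add]
  abel

lemma deriv_smul (c : k) (f : Module.End k V) : deriv (c • f) = c • deriv f := by
  refine (eq_deriv _ _ (by simp [deriv_one]) (by simp [deriv_ι]) fun s t => ?_).symm
  simp only [LinearMap.smul_apply, deriv_mul, smul_add, smul_mul_assoc, mul_smul_comm]

/-- A commutator of derivations is again a derivation, the mixed terms cancelling, so only the
values on generators matter. -/
lemma deriv_commutator (f f' : Module.End k V) :
    deriv (f * f' - f' * f) = deriv f * deriv f' - deriv f' * deriv f := by
  refine (eq_deriv _ _ (by simp [deriv_one]) (by simp [deriv_ι]) fun s t => ?_).symm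
  simp only [LinearMap.sub_apply, Module.End.mul_apply, deriv_mul, map_add, sub_mul, mul_sub]
  abel

end TensorAlgebra

/-! ### Generation of an enveloping algebra by its Lie algebra. -/

namespace UniversalEnvelopingAlgebra

variable {k : Type*} [CommRing k] {L : Type*} [LieRing L] [LieAlgebra k L]

attribute [local instance 100] LieRing.ofAssociativeRing LieAlgebra.ofAssociativeAlgebra

lemma ι_lie (x y : L) : ι k ⁅x, y⁆ = ι k x * ι k y - ι k y * ι k x := by
  rw [LieHom.map_lie, LieRing.of_associative_ring_bracket]

/-- The map `L → S` lifts to the enveloping algebra, and the lift followed by the inclusion of `S`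
is the identity by the universal property. So every element is a value in `S`. -/
lemma subalgebra_eq_top (S : Subalgebra k (UniversalEnvelopingAlgebra k L))
    (h : ∀ x, ι k x ∈ S) : S = ⊤ := by
  let f : L →ₗ⁅k⁆ S :=
    { toFun := fun x => ⟨ι k x, h x⟩
      map_add' := fun x y => by ext; simp
      map_smul' := fun c x => by ext; simp
      map_lie' := fun {x y} => by
        apply Subtype.ext
        simp [LieRing.of_associative_ring_bracket] }
  have e : S.val.comp (lift k f) = AlgHom.id k _ := by
    ext x
    simp [f]
  rw [eq_top_iff]
  intro u _
  have := AlgHom.congr_fun e u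
  simp only [AlgHom.comp_apply, AlgHom.id_apply] at this
  rw [← this]
  exact (lift k f u).2

-- The elements whose left multiplication preserves `P` form a subalgebra that contains `L`, hence
-- everything; apply this to `1`.
@[elab_as_elim]
lemma induction_left {P : UniversalEnvelopingAlgebra k L → Prop} (one : P 1)
    (smul : ∀ (c : k) a, P a → P (c • a)) (add : ∀ a b, P a → P b → P (a + b))
    (ι_mul : ∀ x b, P b → P (ι k x * b)) (u : UniversalEnvelopingAlgebra k L) : P u := by
  let S : Subalgebra k (UniversalEnvelopingAlgebra k L) :=
    { carrier := {a | ∀ b, P b → P (a * b)}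
      mul_mem' := fun ha hb c hc => by rw [mul_assoc]; exact ha _ (hb _ hc)
      add_mem' := fun ha hb c hc => by rw [add_mul]; exact add _ _ (ha _ hc) (hb _ hc)
      algebraMap_mem' := fun r c hc => by
        rw [Algebra.algebraMap_eq_smul_one, smul_mul_assoc, one_mul]
        exact smul _ _ hc }
  have hu : u ∈ S := by
    rw [subalgebra_eq_top S ι_mul]
    trivial
  simpa using hu 1 one

end UniversalEnvelopingAlgebra

/-! ### The action of `g_Lie` on `T(g)` and the presentation of `U(E(g))` by generators. -/

namespace Leib.LeftLeibniz

variable {k : Type*} [Field k] {g : Type*} [AddCommGroup g] [Module k g] {G : LeftLeibniz k g}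

lemma lieAct_lie (a b : G.LieQuot) :
    G.lieAct ⁅a, b⁆ = (G.lieAct a * G.lieAct b - G.lieAct b * G.lieAct a : Module.End k g) := by
  obtain ⟨x, rfl⟩ := G.toLie_surjective a
  obtain ⟨y, rfl⟩ := G.toLie_surjective b
  ext z
  simp [G.toLie_lie, G.leibniz]

variable (G) in
/-- The derivation of `T(g)` that extends the action of an element of `g_Lie` on `g`. -/
def der : G.LieQuot →ₗ[k] Module.End k (TensorAlgebra k g) where
  toFun a := TensorAlgebra.deriv (G.lieAct a)
  map_add' a b := by rw [map_add, ← TensorAlgebra.deriv_add]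
  map_smul' c a := by rw [map_smul, ← TensorAlgebra.deriv_smul]; rfl

lemma der_one (a : G.LieQuot) : G.der a 1 = 0 := TensorAlgebra.deriv_one _

lemma der_ι (a : G.LieQuot) (x : g) :
    G.der a (TensorAlgebra.ι k x) = TensorAlgebra.ι k (G.lieAct a x) := TensorAlgebra.deriv_ι _ _

lemma der_mul (a : G.LieQuot) (s t : TensorAlgebra k g) :
    G.der a (s * t) = G.der a s * t + s * G.der a t := TensorAlgebra.deriv_mul _ _ _

lemma der_lie (a b : G.LieQuot) : G.der ⁅a, b⁆ = G.der a * G.der b - G.der b * G.der a := by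
  change TensorAlgebra.deriv _ = _
  rw [lieAct_lie]
  exact TensorAlgebra.deriv_commutator _ _

section Lift

variable {A : Type*} [Ring A] [Algebra k A] (f₀ : G.LieQuot →ₗ[k] A) (f₁ : g →ₗ[k] A)
  (h₀ : ∀ a b, f₀ ⁅a, b⁆ = f₀ a * f₀ b - f₀ b * f₀ a)
  (h₁ : ∀ a y, f₁ (G.lieAct a y) = f₀ a * f₁ y - f₁ y * f₀ a)

/-- The extension of compatible maps from the generators of `E(g)` to its homogeneous elements. -/
def EXeval (i : ℤ) : G.E.X i →ₗ[k] A := Eeval f₀ f₁ h₀ h₁ i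

/-- The homomorphism from `U(E(g))` given by compatible maps on the generators. -/
def EUlift : G.E.U →ₐ[k] A :=
  -- The relation of `U(E(g))` for arbitrary homogeneous elements holds because `Eeval` takes every
  -- bracket to a graded commutator. No condition on two elements of `g` is needed, their brackets
  -- being free in `E(g)`.
  G.E.Ulift (DirectSum.toModule k ℤ A (EXeval f₀ f₁ h₀ h₁)) fun h x y => by
    simp only [DirectSum.toModule_lof]
    exact (Eeval_br f₀ f₁ h₀ h₁ h x y).symm

lemma EUlift_ι (i : ℤ) (x : G.E.X i) :
    EUlift f₀ f₁ h₀ h₁ (G.E.ι i x) = EXeval f₀ f₁ h₀ h₁ i x := by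
  rw [← DGLie.totι_of, EUlift, DGLie.Ulift_totι, DirectSum.toModule_lof]

lemma EUlift_eLie (a : G.LieQuot) : EUlift f₀ f₁ h₀ h₁ (G.E.ι 0 (G.eLie a)) = f₀ a :=
  EUlift_ι _ _ _ _ _ _

lemma EUlift_eGen (x : g) : EUlift f₀ f₁ h₀ h₁ (G.E.ι 1 (G.eGen x)) = f₁ x :=
  EUlift_ι _ _ _ _ _ _

end Lift

/-- An induction principle for the homogeneous elements of `E(g)`. -/
@[elab_as_elim]
lemma E_induction {P : ∀ i : ℤ, G.E.X i → Prop} (zero : ∀ i, P i 0)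
    (add : ∀ i x y, P i x → P i y → P i (x + y)) (smul : ∀ i (c : k) x, P i x → P i (c • x))
    (lie : ∀ a, P 0 (G.eLie a)) (gen : ∀ x, P 1 (G.eGen x))
    (br : ∀ (i j n : ℤ) (h : i + j = n) (x : G.E.X i) (y : G.E.X j), P i x → P j y →
      P n (G.E.br h x y)) {i : ℤ} (x : G.E.X i) : P i x := by
  obtain ⟨t, rfl⟩ := Emk_surj x
  induction t with
  | zero n => exact zero n
  | add a b iha ihb => exact add _ _ _ iha ihb
  | smul c a ih => exact smul _ c _ ih
  | lie hn a => subst hn; exact lie a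
  | gen hn x => subst hn; exact gen x
  | br h a b iha ihb => exact br _ _ _ h _ _ iha ihb

/-- Brackets become graded commutators in `U(E(g))`, so a subalgebra that contains `g_Lie` and `g`
contains the image of all of `E(g)`. -/
lemma EU_subalgebra_eq_top (S : Subalgebra k G.E.U) (h₀ : ∀ a, G.E.ι 0 (G.eLie a) ∈ S)
    (h₁ : ∀ x, G.E.ι 1 (G.eGen x) ∈ S) : S = ⊤ := by
  have hι : ∀ (i : ℤ) (x : G.E.X i), G.E.ι i x ∈ S := fun i x => by
    induction x using E_induction with
    | zero i => rw [map_zero]; exact zero_mem _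
    | add i x y hx hy => rw [map_add]; exact add_mem hx hy
    | smul i c x hx => rw [map_smul]; exact S.smul_mem hx c
    | lie a => exact h₀ a
    | gen x => exact h₁ x
    | br i j n h x y hx hy =>
      rw [← G.E.ι_br h]
      exact sub_mem (mul_mem hx hy) (S.smul_mem (mul_mem hy hx) _)
  refine Algebra.eq_top_iff.2 fun u => ?_
  induction u using G.E.U_induction with
  | algebraMap c => exact S.algebraMap_mem c
  | gen z =>
    induction z using DirectSum.induction_on with
    | zero => rw [map_zero]; exact zero_mem _
    | of i x => exact hι i x
    | add a b ha hb => rw [map_add]; exact add_mem ha hb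
  | mul u v hu hv => exact mul_mem hu hv
  | add u v hu hv => exact add_mem hu hv

-- The elements by which right multiplication preserves `P` form a subalgebra. Right factors are
-- used because the smash product is handled through its right action.
@[elab_as_elim]
lemma EU_induction_right {P : G.E.U → Prop} (one : P 1) (smul : ∀ (c : k) a, P a → P (c • a))
    (add : ∀ a b, P a → P b → P (a + b)) (mul_lie : ∀ b a, P b → P (b * G.E.ι 0 (G.eLie a)))
    (mul_gen : ∀ b x, P b → P (b * G.E.ι 1 (G.eGen x))) (u : G.E.U) : P u := by
  let S : Subalgebra k G.E.U :=
    { carrier := {a | ∀ b, P b → P (b * a)}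
      mul_mem' := fun ha hb c hc => by rw [← mul_assoc]; exact hb _ (ha _ hc)
      add_mem' := fun ha hb c hc => by rw [mul_add]; exact add _ _ (ha _ hc) (hb _ hc)
      algebraMap_mem' := fun r c hc => by
        rw [Algebra.algebraMap_eq_smul_one, mul_smul_comm, mul_one]
        exact smul _ _ hc }
  have hu : u ∈ S := by
    rw [EU_subalgebra_eq_top S (fun a b hb => mul_lie b a hb) (fun x b hb => mul_gen b x hb)]
    trivial
  simpa using hu 1 one

lemma ι_lie_gen (a : G.LieQuot) (y : g) :
    G.E.ι 1 (G.eGen (G.lieAct a y)) = G.E.ι 0 (G.eLie a) * G.E.ι 1 (G.eGen y)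
      - G.E.ι 1 (G.eGen y) * G.E.ι 0 (G.eLie a) := by
  have e := G.E.ι_br (zero_add 1) (G.eLie a) (G.eGen y)
  have e' : G.E.br (zero_add 1) (G.eLie a) (G.eGen y) = G.eGen (G.lieAct a y) :=
    G.Ebr_lie_gen (zero_add 1) rfl rfl rfl a y
  rw [e'] at e
  rw [← e, zero_mul, sgn_eq_ite, if_pos (by simp), one_smul]

lemma ι_gen_mul_lie (a : G.LieQuot) (y : g) :
    G.E.ι 1 (G.eGen y) * G.E.ι 0 (G.eLie a) =
      G.E.ι 0 (G.eLie a) * G.E.ι 1 (G.eGen y) - G.E.ι 1 (G.eGen (G.lieAct a y)) := by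
  rw [ι_lie_gen]
  abel

lemma uLie_ι (a : G.LieQuot) :
    G.uLie (UniversalEnvelopingAlgebra.ι k a) = G.E.ι 0 (G.eLie a) :=
  UniversalEnvelopingAlgebra.lift_ι_apply ..

lemma uGen_ι (x : g) : G.uGen (TensorAlgebra.ι k x) = G.E.ι 1 (G.eGen x) :=
  TensorAlgebra.lift_ι_apply ..

/-- The commutator with `a` is a derivation of `U(E(g))` and agrees with the action of `a` on the
generators `g`. -/
lemma uGen_der (a : G.LieQuot) (t : TensorAlgebra k g) :
    G.uGen (G.der a t) = G.E.ι 0 (G.eLie a) * G.uGen t - G.uGen t * G.E.ι 0 (G.eLie a) := by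
  induction t using TensorAlgebra.induction with
  | algebraMap c =>
    simp [Algebra.algebraMap_eq_smul_one, der_one]
  | ι v => rw [der_ι, uGen_ι, uGen_ι, ι_lie_gen]
  | mul s t hs ht =>
    rw [der_mul, map_add, map_mul, map_mul, map_mul, hs, ht]
    noncomm_ring
  | add s t hs ht => rw [map_add, map_add, map_add, hs, ht]; noncomm_ring

/-! ### The isomorphism of `U(g_Lie) ⊗ T(g)` with `U(E(g))`. -/

section Smash

local notation "𝓤" => UniversalEnvelopingAlgebra k (LieQuot G)
local notation "𝓣" => TensorAlgebra k g

variable (G) in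
/-- The map `a ⊗ t ↦ a t` from `U(g_Lie) ⊗ T(g)` to `U(E(g))`. -/
def smash : 𝓤 ⊗[k] 𝓣 →ₗ[k] G.E.U :=
  TensorProduct.lift ((LinearMap.mul k G.E.U).compl₁₂ G.uLie.toLinearMap G.uGen.toLinearMap)

lemma smash_tmul (a : 𝓤) (t : 𝓣) : G.smash (a ⊗ₜ t) = G.uLie a * G.uGen t := rfl

variable (G) in
/-- The right action of `U(E(g))` on `U(g_Lie) ⊗ T(g)`. -/
def smashRight : G.E.U →ₐ[k] (Module.End k (𝓤 ⊗[k] 𝓣))ᵐᵒᵖ :=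
  EUlift
    -- Since `t a = a t - a · t` in `U(E(g))`, right multiplication by `a` must send `u ⊗ t` to `u a
    -- ⊗ t - u ⊗ (a · t)`. The opposite algebra makes a right action a homomorphism.
    { toFun := fun a => MulOpposite.op
        (TensorProduct.map (LinearMap.mulRight k (UniversalEnvelopingAlgebra.ι k a)) LinearMap.id
          - TensorProduct.map LinearMap.id (G.der a))
      map_add' := fun a b => by
        apply MulOpposite.unop_injective
        ext u t
        simp [mul_add, TensorProduct.add_tmul, TensorProduct.tmul_add]
        abel
      map_smul' := fun c a => by
        apply MulOpposite.unop_injective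
        ext u t
        simp [TensorProduct.smul_tmul', smul_sub] }
    { toFun := fun x => MulOpposite.op
        (TensorProduct.map LinearMap.id (LinearMap.mulRight k (TensorAlgebra.ι k x)))
      map_add' := fun a b => by
        apply MulOpposite.unop_injective
        ext u t
        simp [mul_add, TensorProduct.tmul_add]
      map_smul' := fun c a => by
        apply MulOpposite.unop_injective
        ext u t
        simp }
    -- The opposite product reverses the sign of the commutator of the two derivations; the minus
    -- sign in front of `G.der` compensates.
    (fun a b => by
      apply MulOpposite.unop_injective
      ext u t
      simp [-UniversalEnvelopingAlgebra.ι_apply, -LieHom.map_lie,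
        UniversalEnvelopingAlgebra.ι_lie, der_lie,
        mul_sub, TensorProduct.sub_tmul, TensorProduct.tmul_sub, mul_assoc]
      abel)
    (fun a y => by
      apply MulOpposite.unop_injective
      ext u t
      simp [der_mul, der_ι, TensorProduct.tmul_add])

lemma smashRight_eLie (a : G.LieQuot) (u : 𝓤) (t : 𝓣) :
    (G.smashRight (G.E.ι 0 (G.eLie a))).unop (u ⊗ₜ t) =
      (u * UniversalEnvelopingAlgebra.ι k a) ⊗ₜ t - u ⊗ₜ G.der a t := by
  rw [smashRight, EUlift_eLie]
  rfl

lemma smashRight_eGen (x : g) (u : 𝓤) (t : 𝓣) :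
    (G.smashRight (G.E.ι 1 (G.eGen x))).unop (u ⊗ₜ t) = u ⊗ₜ (t * TensorAlgebra.ι k x) := by
  rw [smashRight, EUlift_eGen]
  rfl

/-- Derivations kill `1`, so on `u ⊗ 1` only the right multiplication of the first factor survives.
-/
lemma smashRight_uLie (a u : 𝓤) :
    (G.smashRight (G.uLie a)).unop (u ⊗ₜ 1) = (u * a) ⊗ₜ 1 := by
  induction a using UniversalEnvelopingAlgebra.induction_left generalizing u with
  | one => simp
  | smul c a ih => simp [ih, TensorProduct.smul_tmul']
  | add a b iha ihb => simp [iha, ihb, mul_add, TensorProduct.add_tmul]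
  | ι_mul x b ih =>
    rw [map_mul, map_mul, uLie_ι, MulOpposite.unop_mul, Module.End.mul_apply, smashRight_eLie,
      der_one, TensorProduct.tmul_zero, sub_zero, ih, mul_assoc]

lemma smashRight_uGen (u : 𝓤) (s t : 𝓣) :
    (G.smashRight (G.uGen t)).unop (u ⊗ₜ s) = u ⊗ₜ (s * t) := by
  induction t using TensorAlgebra.induction generalizing s with
  | algebraMap c => simp [Algebra.algebraMap_eq_smul_one]
  | ι v => rw [uGen_ι, smashRight_eGen]
  | mul a b iha ihb => simp [iha, ihb, mul_assoc]
  | add a b iha ihb => simp [iha, ihb, mul_add, TensorProduct.tmul_add]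

variable (G) in
/-- The inverse of `a ⊗ t ↦ a t`: the right action on `1 ⊗ 1`. -/
def smashInv : G.E.U →ₗ[k] 𝓤 ⊗[k] 𝓣 where
  toFun w := (G.smashRight w).unop (1 ⊗ₜ 1)
  map_add' := by simp
  map_smul' := by simp

/-- In a right action the left factor acts first: `1 ⊗ 1` goes to `a ⊗ 1` under `a`, and then to `a
⊗ t` under `t`. -/
lemma smashInv_smash (z : 𝓤 ⊗[k] 𝓣) : G.smashInv (G.smash z) = z := by
  induction z with
  | zero => simp
  | add a b ha hb => rw [map_add, map_add, ha, hb]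
  | tmul a t =>
    rw [smash_tmul]
    change (G.smashRight (G.uLie a * G.uGen t)).unop (1 ⊗ₜ 1) = _
    rw [map_mul, MulOpposite.unop_mul, Module.End.mul_apply, smashRight_uLie, smashRight_uGen,
      one_mul, one_mul]

/-- The range contains `1` and is stable under right multiplication by the generators, since `(u t)
a = (u a) t - u (a · t)`. -/
lemma smash_surjective : Function.Surjective G.smash := by
  intro w
  rw [← LinearMap.mem_range]
  induction w using EU_induction_right with
  | one => exact ⟨1 ⊗ₜ 1, by rw [smash_tmul, map_one, map_one, one_mul]⟩
  | smul c a ha => exact Submodule.smul_mem _ c ha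
  | add a b ha hb => exact add_mem ha hb
  | mul_lie b a hb =>
    obtain ⟨z, rfl⟩ := hb
    induction z with
    | zero => rw [map_zero, zero_mul]; exact zero_mem _
    | add x y hx hy => rw [map_add, add_mul]; exact add_mem hx hy
    | tmul u t =>
      refine ⟨(u * UniversalEnvelopingAlgebra.ι k a) ⊗ₜ t - u ⊗ₜ G.der a t, ?_⟩
      rw [map_sub, smash_tmul, smash_tmul, smash_tmul, uGen_der, map_mul, uLie_ι]
      noncomm_ring
  | mul_gen b x hb =>
    obtain ⟨z, rfl⟩ := hb
    induction z with
    | zero => rw [map_zero, zero_mul]; exact zero_mem _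
    | add x y hx hy => rw [map_add, add_mul]; exact add_mem hx hy
    | tmul u t =>
      exact ⟨u ⊗ₜ (t * TensorAlgebra.ι k x), by
        rw [smash_tmul, smash_tmul, map_mul, uGen_ι, mul_assoc]⟩

variable (G) in
/-- The isomorphism `a ⊗ t ↦ a t` of left `U(g_Lie)`-modules from `U(g_Lie) ⊗ T(g)` to
`U(E(g))`. -/
noncomputable def smashEquiv : (𝓤 ⊗[k] 𝓣) ≃ₗ[𝓤] G.E.U :=
  LinearEquiv.ofBijective
    { G.smash with
      map_smul' := fun b z => by
        change G.smash (b • z) = G.uLie b * G.smash z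
        induction z with
        | zero => simp
        | add x y hx hy => rw [smul_add, map_add, map_add, hx, hy, mul_add]
        | tmul u t =>
          rw [TensorProduct.smul_tmul', smash_tmul, smash_tmul, smul_eq_mul, map_mul, mul_assoc] }
    ⟨Function.LeftInverse.injective smashInv_smash, smash_surjective⟩

lemma smashEquiv_apply (z : 𝓤 ⊗[k] 𝓣) : G.smashEquiv z = G.smash z := rfl

lemma smashEquiv_symm_apply (w : G.E.U) : G.smashEquiv.symm w = G.smashInv w := by
  rw [LinearEquiv.symm_apply_eq, smashEquiv_apply]
  obtain ⟨z, rfl⟩ := smash_surjective w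
  rw [smashInv_smash]

end Smash
end Leib.LeftLeibniz

/-! ### The grading of `U(E(g))`. -/

namespace Leib

namespace DGLie

variable {k : Type*} [Field k] (L : DGLie k)

lemma Udeg_mul_le (p q : ℤ) : L.Udeg p * L.Udeg q ≤ L.Udeg (p + q) := by
  rw [Udeg, Udeg, Submodule.span_mul_span, Submodule.span_le]
  rintro _ ⟨_, ⟨l, rfl, rfl⟩, _, ⟨l', rfl, rfl⟩, rfl⟩
  exact Submodule.subset_span ⟨l ++ l', by simp, by simp⟩

lemma mul_mem_Udeg {p q n : ℤ} (h : p + q = n) {u v : L.U} (hu : u ∈ L.Udeg p)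
    (hv : v ∈ L.Udeg q) : u * v ∈ L.Udeg n :=
  h ▸ L.Udeg_mul_le p q (Submodule.mul_mem_mul hu hv)

lemma ι_mem_Udeg {i : ℤ} (x : L.X i) : L.ι i x ∈ L.Udeg i := by
  simpa using L.ι_mul_mem (add_zero i) x L.one_mem_Udeg

end DGLie

namespace LeftLeibniz

variable {k : Type*} [Field k] {g : Type*} [AddCommGroup g] [Module k g] {G : LeftLeibniz k g}

variable (G) in
/-- The image of `U(g_Lie)` in `U(E(g))`. -/
def lieRange : Submodule k G.E.U := LinearMap.range G.uLie.toLinearMap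

variable (G) in
/-- The image of `g` in `U(E(g))`. -/
def genRange : Submodule k G.E.U := LinearMap.range (G.E.ι 1 ∘ₗ G.eGen)

lemma uLie_mem_lieRange (a : UniversalEnvelopingAlgebra k G.LieQuot) : G.uLie a ∈ G.lieRange :=
  ⟨a, rfl⟩

lemma ι_eGen_mem_genRange (x : g) : G.E.ι 1 (G.eGen x) ∈ G.genRange := ⟨x, rfl⟩

lemma one_mem_lieRange : 1 ∈ G.lieRange := ⟨1, map_one G.uLie⟩

lemma lieRange_mul_self : G.lieRange * G.lieRange = G.lieRange := by
  apply le_antisymm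
  · rw [Submodule.mul_le]
    rintro _ ⟨a, rfl⟩ _ ⟨b, rfl⟩
    exact ⟨a * b, map_mul G.uLie a b⟩
  · exact fun u hu => by simpa using Submodule.mul_mem_mul one_mem_lieRange hu

/-- The relation `x a = a x - a · x` moves one letter of `g_Lie` to the left, and `a · x` is again
in `g`; this is iterated over the factors of an element of `U(g_Lie)`. -/
lemma genRange_mul_lieRange_le : G.genRange * G.lieRange ≤ G.lieRange * G.genRange := by
  rw [Submodule.mul_le]
  rintro _ ⟨x, rfl⟩ _ ⟨a, rfl⟩
  change G.E.ι 1 (G.eGen x) * G.uLie a ∈ _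
  induction a using UniversalEnvelopingAlgebra.induction_left generalizing x with
  | one =>
    rw [map_one, mul_one, ← one_mul (G.E.ι 1 _)]
    exact Submodule.mul_mem_mul one_mem_lieRange ⟨x, rfl⟩
  | smul c a ih => rw [map_smul, mul_smul_comm]; exact Submodule.smul_mem _ c (ih x)
  | add a b iha ihb => rw [map_add, mul_add]; exact add_mem (iha x) (ihb x)
  | ι_mul a b ih =>
    rw [map_mul, uLie_ι, ← mul_assoc, ι_gen_mul_lie, sub_mul, mul_assoc]
    -- The correction `(a · x) b` has another element of `g` in place of `x`, hence the induction
    -- over all `x`.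
    refine sub_mem ?_ (ih _)
    rw [← lieRange_mul_self, mul_assoc]
    refine Submodule.mul_mem_mul ?_ (ih x)
    rw [← uLie_ι]
    exact uLie_mem_lieRange _

lemma genRange_pow_mul_lieRange_le (n : ℕ) :
    G.genRange ^ n * G.lieRange ≤ G.lieRange * G.genRange ^ n := by
  induction n with
  | zero => simp
  | succ n ih =>
    calc G.genRange ^ (n + 1) * G.lieRange
        = G.genRange ^ n * (G.genRange * G.lieRange) := by rw [pow_succ, mul_assoc]
      _ ≤ G.genRange ^ n * (G.lieRange * G.genRange) :=
        mul_le_mul' le_rfl genRange_mul_lieRange_le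
      _ = (G.genRange ^ n * G.lieRange) * G.genRange := by rw [mul_assoc]
      _ ≤ (G.lieRange * G.genRange ^ n) * G.genRange := mul_le_mul' ih le_rfl
      _ = _ := by rw [mul_assoc, pow_succ]

/-- The spaces `U(g_Lie) g^p` multiply as in a graded algebra, because `g^p` can be moved past
`U(g_Lie)`. -/
lemma mul_mem_lieRange_mul {p q : ℕ} {u v : G.E.U} (hu : u ∈ G.lieRange * G.genRange ^ p)
    (hv : v ∈ G.lieRange * G.genRange ^ q) : u * v ∈ G.lieRange * G.genRange ^ (p + q) := by
  have h : (G.lieRange * G.genRange ^ p) * (G.lieRange * G.genRange ^ q) ≤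
      G.lieRange * G.genRange ^ (p + q) :=
    calc (G.lieRange * G.genRange ^ p) * (G.lieRange * G.genRange ^ q)
        = G.lieRange * (G.genRange ^ p * G.lieRange) * G.genRange ^ q := by simp only [mul_assoc]
      _ ≤ G.lieRange * (G.lieRange * G.genRange ^ p) * G.genRange ^ q :=
        mul_le_mul'
          (mul_le_mul' le_rfl (genRange_pow_mul_lieRange_le p)) le_rfl
      _ = _ := by rw [← mul_assoc, lieRange_mul_self, mul_assoc, pow_add]
  exact h (Submodule.mul_mem_mul hu hv)

lemma ι_mem_lieRange_mul {i : ℤ} (x : G.E.X i) (n : ℕ) (h : i = n) :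
    G.E.ι i x ∈ G.lieRange * G.genRange ^ n := by
  induction x using E_induction generalizing n with
  | zero i => rw [map_zero]; exact zero_mem _
  | add i x y hx hy => rw [map_add]; exact add_mem (hx n h) (hy n h)
  | smul i c x hx => rw [map_smul]; exact Submodule.smul_mem _ c (hx n h)
  | lie a =>
    obtain rfl : n = 0 := by omega
    rw [pow_zero, mul_one, ← uLie_ι]
    exact uLie_mem_lieRange _
  | gen x =>
    obtain rfl : n = 1 := by omega
    rw [pow_one, ← one_mul (G.E.ι 1 _)]
    exact Submodule.mul_mem_mul (one_mem_lieRange) (ι_eGen_mem_genRange x)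
  | br i j r hij x y hx hy =>
    -- `E(g)` vanishes in negative degrees, so both factors may be assumed to have natural degrees.
    -- Their bracket is then a graded commutator, to which multiplicativity applies.
    rcases lt_or_ge i 0 with hi | hi
    · rw [E_nonneg i hi x, map_zero, LinearMap.zero_apply, map_zero]; exact zero_mem _
    rcases lt_or_ge j 0 with hj | hj
    · rw [E_nonneg j hj y, map_zero, map_zero]; exact zero_mem _
    lift i to ℕ using hi
    lift j to ℕ using hj
    obtain rfl : n = i + j := by omega
    rw [← G.E.ι_br hij]
    refine sub_mem (mul_mem_lieRange_mul (hx i rfl) (hy j rfl)) (Submodule.smul_mem _ _ ?_)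
    rw [add_comm]
    exact mul_mem_lieRange_mul (hy j rfl) (hx i rfl)

/-- A word with a letter of negative degree is zero even if its total degree is natural; this is why
vanishing is a separate alternative. -/
lemma list_prod_mem_lieRange_mul (l : List (Σ i, G.E.X i)) :
    (∃ n : ℕ, (l.map Sigma.fst).sum = n ∧
      (l.map fun x => G.E.ι x.1 x.2).prod ∈ G.lieRange * G.genRange ^ n) ∨
    (l.map fun x => G.E.ι x.1 x.2).prod = 0 := by
  induction l with
  | nil =>
    refine .inl ⟨0, by simp, ?_⟩
    rw [pow_zero, mul_one, List.map_nil, List.prod_nil]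
    exact one_mem_lieRange
  | cons x l ih =>
    obtain ⟨i, x⟩ := x
    rcases ih with ⟨n, hn, hl⟩ | hl
    · rcases lt_or_ge i 0 with hi | hi
      · right
        simp [E_nonneg i hi x]
      · left
        lift i to ℕ using hi
        exact ⟨i + n, by simp [hn], by
          simpa using mul_mem_lieRange_mul (ι_mem_lieRange_mul x i rfl) hl⟩
    · right
      simp [hl]

lemma lieRange_le_Udeg : G.lieRange ≤ G.E.Udeg 0 := by
  rintro _ ⟨a, rfl⟩
  change G.uLie a ∈ _
  induction a using UniversalEnvelopingAlgebra.induction_left with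
  | one => rw [map_one]; exact G.E.one_mem_Udeg
  | smul c a ih => rw [map_smul]; exact Submodule.smul_mem _ c ih
  | add a b iha ihb => rw [map_add]; exact add_mem iha ihb
  | ι_mul a b ih =>
    rw [map_mul, uLie_ι]
    exact G.E.ι_mul_mem (zero_add 0) _ ih

lemma genRange_pow_le_Udeg (n : ℕ) : G.genRange ^ n ≤ G.E.Udeg n := by
  induction n with
  | zero =>
    rw [pow_zero, Submodule.one_le]
    exact G.E.one_mem_Udeg
  | succ n ih =>
    rw [pow_succ, Submodule.mul_le]
    rintro u hu _ ⟨x, rfl⟩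
    exact G.E.mul_mem_Udeg (by simp) (ih hu) (G.E.ι_mem_Udeg _)

/-- The degree `n` part of `U(E(g))` is `U(g_Lie) g^n`. -/
lemma Udeg_eq (n : ℕ) : G.E.Udeg n = G.lieRange * G.genRange ^ n := by
  apply le_antisymm
  · rw [DGLie.Udeg, Submodule.span_le]
    rintro _ ⟨l, hl, rfl⟩
    rcases list_prod_mem_lieRange_mul l with ⟨n', hn', h⟩ | h
    · obtain rfl : n' = n := by omega
      exact h
    · rw [h]; exact zero_mem _
  · rw [Submodule.mul_le]
    exact fun u hu v hv =>
      G.E.mul_mem_Udeg (zero_add _) (lieRange_le_Udeg hu) (genRange_pow_le_Udeg n hv)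

lemma Udeg_eq_bot {n : ℤ} (hn : n < 0) : G.E.Udeg n = ⊥ := by
  rw [eq_bot_iff, DGLie.Udeg, Submodule.span_le]
  rintro _ ⟨l, hl, rfl⟩
  rcases list_prod_mem_lieRange_mul l with ⟨n', hn', h⟩ | h
  · omega
  · exact h

/-- The smash isomorphism respects degrees: `g^n` is the image of the degree `n` part of `T(g)`, and
the degree `n` part of `U(E(g))` is `U(g_Lie) g^n`. -/
lemma map_smash_range_lTensor (n : ℕ) :
    (LinearMap.range (LinearMap.lTensor (UniversalEnvelopingAlgebra k G.LieQuot)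
      (LinearMap.range (TensorAlgebra.ι k : g →ₗ[k] TensorAlgebra k g) ^ n).subtype)).map G.smash
      = G.E.Udeg n := by
  have hX : G.genRange ^ n =
      (LinearMap.range (TensorAlgebra.ι k : g →ₗ[k] TensorAlgebra k g) ^ n).map
        G.uGen.toLinearMap := by
    rw [Submodule.map_pow, genRange, ← LinearMap.range_comp]
    congr 2
    ext x
    exact (uGen_ι x).symm
  rw [Udeg_eq, hX]
  apply le_antisymm
  · rintro _ ⟨_, ⟨z, rfl⟩, rfl⟩
    induction z with
    | zero => simp
    | add a b ha hb => rw [map_add, map_add]; exact add_mem ha hb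
    | tmul a t => exact Submodule.mul_mem_mul (uLie_mem_lieRange a) ⟨t, t.2, rfl⟩
  · rw [Submodule.mul_le]
    rintro _ ⟨a, rfl⟩ _ ⟨t, ht, rfl⟩
    exact ⟨_, ⟨a ⊗ₜ ⟨t, ht⟩, rfl⟩, rfl⟩

lemma mem_Udeg_iff (n : ℕ) (u : G.E.U) : u ∈ G.E.Udeg n ↔
    G.smashEquiv.symm u ∈ LinearMap.range (LinearMap.lTensor
      (UniversalEnvelopingAlgebra k G.LieQuot)
      (LinearMap.range (TensorAlgebra.ι k : g →ₗ[k] TensorAlgebra k g) ^ n).subtype) := by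
  rw [← map_smash_range_lTensor, smashEquiv_symm_apply]
  constructor
  · rintro ⟨z, hz, rfl⟩
    rwa [smashInv_smash]
  · intro h
    refine ⟨_, h, ?_⟩
    obtain ⟨z, rfl⟩ := smash_surjective u
    rw [smashInv_smash]

/-- The product `x_1 ⋯ x_n` in `U(E(g))` as a multilinear map. -/
def uMul (G : LeftLeibniz k g) (n : ℕ) : MultilinearMap k (fun _ : Fin n => g) G.E.U :=
  (MultilinearMap.mkPiAlgebraFin k n G.E.U).compLinearMap fun _ => G.E.ι 1 ∘ₗ G.eGen

lemma uMul_apply {n : ℕ} (x : Fin n → g) : G.uMul n x = (G.uProd x : G.E.U) := by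
  simp [uMul, uProd]

/-- The product `x_1 ⋯ x_n` in `U(E(g))_n` as a multilinear map. -/
def uMulDeg (G : LeftLeibniz k g) (n : ℕ) : MultilinearMap k (fun _ : Fin n => g) (G.E.Udeg n) :=
  (G.uMul n).codRestrict (G.E.Udeg n) fun x => by rw [uMul_apply]; exact (G.uProd x).2

lemma uMulDeg_apply {n : ℕ} (x : Fin n → g) : G.uMulDeg n x = G.uProd x :=
  Subtype.ext (uMul_apply x)

lemma uProd_zero (x : Fin 0 → g) : (G.uProd x : G.E.U) = 1 := by simp [uProd]

lemma uProd_cons {n : ℕ} (x : Fin (n + 1) → g) :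
    (G.uProd x : G.E.U) = G.E.ι 1 (G.eGen (x 0)) * G.uProd (fun i => x i.succ) := by
  simp [uProd]

lemma uProd_eq_uGen {n : ℕ} (x : Fin n → g) :
    (G.uProd x : G.E.U) = G.uGen (TensorAlgebra.tprod k g n x) := by
  simp only [uProd, TensorAlgebra.tprod_apply, map_list_prod, List.map_ofFn, Function.comp_def,
    uGen_ι]

lemma genRange_pow_eq_span (n : ℕ) :
    G.genRange ^ n = Submodule.span k (Set.range fun x : Fin n → g => (G.uProd x : G.E.U)) := by
  induction n with
  | zero =>
    rw [pow_zero, Submodule.one_eq_span]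
    congr 1
    ext u
    simp [uProd_zero]
  | succ n ih =>
    rw [pow_succ', ih, genRange, ← Submodule.span_eq (LinearMap.range _), Submodule.span_mul_span]
    congr 1
    ext u
    constructor
    · rintro ⟨_, ⟨x, rfl⟩, _, ⟨y, rfl⟩, rfl⟩
      exact ⟨Fin.cons x y, by simp [uProd_cons]⟩
    · rintro ⟨x, rfl⟩
      exact ⟨_, ⟨x 0, rfl⟩, _, ⟨fun i => x i.succ, rfl⟩, (uProd_cons x).symm⟩

/-- The degree `n` part of `U(E(g))` is spanned by the elements `a x_1 ⋯ x_n` with `a` in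
`U(g_Lie)` and `x_i` in `g`. -/
lemma Udeg_eq_span (n : ℕ) : G.E.Udeg n = Submodule.span k
    {u | ∃ (a : UniversalEnvelopingAlgebra k G.LieQuot) (x : Fin n → g),
      u = G.uLie a * (G.uProd x : G.E.U)} := by
  refine (Udeg_eq n).trans ?_
  rw [genRange_pow_eq_span, ← Submodule.span_eq G.lieRange, Submodule.span_mul_span]
  congr 1
  ext u
  constructor
  · rintro ⟨_, ⟨a, rfl⟩, _, ⟨y, rfl⟩, rfl⟩
    exact ⟨a, y, rfl⟩
  · rintro ⟨a, y, rfl⟩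
    exact ⟨_, ⟨a, rfl⟩, _, ⟨y, rfl⟩, rfl⟩

lemma uLie_mul_mem {n : ℤ} (a : UniversalEnvelopingAlgebra k G.LieQuot) {u : G.E.U}
    (hu : u ∈ G.E.Udeg n) : G.uLie a * u ∈ G.E.Udeg n :=
  G.E.mul_mem_Udeg (zero_add _) (lieRange_le_Udeg (uLie_mem_lieRange a)) hu

end LeftLeibniz
end Leib

/-! ### The differential of `U(E(g))` on words in `g`. -/

namespace Leib

namespace DGLie

variable {k : Type*} [Field k] (L : DGLie k)

/-- In `d(d(x u))` the two terms `dx · du` carry the signs `(-1)^{|x| - 1}` and `(-1)^{|x|}` and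
cancel. -/
lemma dU_dU (u : L.U) : L.dU (L.dU u) = 0 := by
  have hι : ∀ (z : L.Tot) (u : L.U), L.dU (L.dU u) = 0 → L.dU (L.dU (L.totι z * u)) = 0 := by
    intro z u hu
    induction z using DirectSum.induction_on with
    | zero => simp
    | of i x =>
      change L.dU (L.dU (L.ι i x * u)) = 0
      have h1 := sub_add_cancel i 1
      have h2 := sub_add_cancel (i - 1) 1
      rw [L.dU_ι_mul h1, map_add, map_smul, L.dU_ι_mul h2, L.dU_ι_mul h1, hu, L.d_d]
      by_cases hi : Even i <;> simp [sgn_eq_ite, hi, parity_simps, ← Int.not_even_iff_odd]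
    | add a b ha hb => rw [map_add, add_mul, map_add, map_add, ha, hb, add_zero]
  -- In the form "left multiplication by `u` preserves the kernel of `d ∘ d`" the claim passes to
  -- products of `u`'s without a Leibniz rule for general elements.
  have : ∀ w, L.dU (L.dU w) = 0 → L.dU (L.dU (u * w)) = 0 := by
    induction u using L.U_induction with
    | algebraMap c =>
      intro w hw
      rw [Algebra.algebraMap_eq_smul_one, smul_mul_assoc, one_mul, map_smul, map_smul, hw,
        smul_zero]
    | gen z => exact hι z
    | mul u v hu hv => intro w hw; rw [mul_assoc]; exact hu _ (hv _ hw)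
    | add u v hu hv => intro w hw; rw [add_mul, map_add, map_add, hu _ hw, hv _ hw, add_zero]
  simpa using this 1 (by rw [dU_one, map_zero])

lemma dUdeg_dUdeg {p q r : ℤ} (h : q + 1 = p) (h' : r + 1 = q) (u : L.Udeg p) :
    L.dUdeg h' (L.dUdeg h u) = 0 := Subtype.ext (L.dU_dU u)

end DGLie

namespace LeftLeibniz

variable {k : Type*} [Field k] {g : Type*} [AddCommGroup g] [Module k g] {G : LeftLeibniz k g}

/-- The differential of a product of elements of `g` in `U(E(g))`, with the elements of `g_Lie`
moved to the left. -/
lemma dU_uProd {n : ℕ} (x : Fin (n + 1) → g) :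
    G.E.dU (G.uProd x) =
      ∑ j : Fin (n + 1), (-1 : k) ^ (j : ℕ) •
        (G.E.ι 0 (G.eLie (G.toLie (x j))) * (G.uProd fun l => x (j.succAbove l) : G.E.U))
      - ∑ j : Fin (n + 1), ∑ i : Fin n with i.castSucc < j, (-1 : k) ^ (j : ℕ) •
          (G.uProd (Function.update (fun l => x (j.succAbove l)) i
            (G.opp.br (x i.castSucc) (x j))) : G.E.U) := by
  have hd : ∀ y : g, G.E.d (zero_add 1) (G.eGen y) = G.eLie (G.toLie y) := fun _ => rfl
  induction n with
  | zero =>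
    rw [uProd_cons, G.E.dU_ι_mul (zero_add 1), hd]
    simp [uProd_zero, G.E.dU_one]
  | succ n ih =>
    -- Induction on the length: `d(x_0 w) = dx_0 w - x_0 dw`, the sign coming from `|x_0| = 1`.
    rw [uProd_cons, G.E.dU_ι_mul (zero_add 1), hd, ih, sgn_eq_ite, if_neg (by simp), neg_one_smul]
    simp only [Finset.sum_filter]
    -- On the right hand side the summands with `j = 0` and with `i = 0` are split off; the rest has
    -- to match the formula for `w = x_1 ⋯ x_{n+1}`.
    rw [Fin.sum_univ_succ (n := n + 1), Fin.sum_univ_succ (n := n + 1)]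
    simp only [Fin.sum_univ_succ (n := n) (f := fun i : Fin (n + 1) => ite _ _ _)]
    simp only [Fin.not_lt_zero, if_false, Finset.sum_const_zero, Fin.castSucc_zero,
      Fin.succ_pos, if_true, Fin.succ_lt_succ_iff, ← Fin.succ_castSucc]
    -- When the omitted letter is not the first one, the first letter (`x_0`, or the bracket that
    -- replaces it) factors out of the word. The next identities do this for the three kinds of
    -- words that occur.
    have e1 : ∀ j : Fin (n + 1), (G.uProd fun l => x (j.succ.succAbove l) : G.E.U) =
        G.E.ι 1 (G.eGen (x 0)) * (G.uProd fun l => x (j.succAbove l).succ : G.E.U) := by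
      intro j
      rw [uProd_cons]
      simp
    have e2 : ∀ (j : Fin (n + 1)) (y : g),
        (G.uProd (Function.update (fun l => x (j.succ.succAbove l)) 0 y) : G.E.U) =
        G.E.ι 1 (G.eGen y) * (G.uProd fun l => x (j.succAbove l).succ : G.E.U) := by
      intro j y
      rw [uProd_cons]
      simp [Fin.succ_ne_zero]
    have e3 : ∀ (j : Fin (n + 1)) (i : Fin n) (y : g),
        (G.uProd (Function.update (fun l => x (j.succ.succAbove l)) i.succ y) : G.E.U) =
        G.E.ι 1 (G.eGen (x 0)) *
          (G.uProd (Function.update (fun l => x (j.succAbove l).succ) i y) : G.E.U) := by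
      intro j i y
      rw [uProd_cons]
      congr 3
      ext l
      by_cases h : l = i
      · subst h; simp
      · rw [Function.update_of_ne (by simpa using h), Function.update_of_ne h,
          Fin.succ_succAbove_succ]
    have e4 : ∀ (c : Prop) [Decidable c] (u : G.E.U), (if c then -u else 0) = -(if c then u else 0) :=
      fun c _ u => by split_ifs <;> simp
    have e5 : ∀ a b, G.opp.br a b = G.br b a := fun _ _ => rfl
    -- In `x_0 dw` the elements `dx_j` stand behind `x_0`. The rule `x_0 dx_j = dx_j x_0 - [x_j,
    -- x_0]` moves them to the left, and the corrections are exactly the summands with `i = 0`.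
    simp only [e1, e2, e3, e5, mul_sub, Finset.mul_sum, mul_smul_comm, mul_ite, mul_zero, ← mul_assoc,
      ι_gen_mul_lie, sub_mul, lieAct_toLie, Fin.val_succ, pow_succ, mul_neg_one, neg_smul, e4,
      Finset.sum_neg_distrib, Finset.sum_add_distrib, smul_sub, Finset.sum_sub_distrib,
      Fin.val_zero, pow_zero, one_smul, Fin.succAbove_zero]
    abel

end LeftLeibniz
end Leib

namespace Leib
namespace LeftLeibniz

attribute [local instance 100] LieRing.ofAssociativeRing LieAlgebra.ofAssociativeAlgebra

variable {k : Type*} [Field k] {g : Type*} [AddCommGroup g] [Module k g] {G : LeftLeibniz k g}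

/-! ### `g_Lie`-linear maps on `U(E(g))` and multilinear maps on `g`. -/

section Extension

/-- The homomorphism from `U(g_Lie)` given by a map that takes brackets to commutators. -/
def lieLift {A : Type*} [Ring A] [Algebra k A] (f : G.LieQuot →ₗ[k] A)
    (hf : ∀ a b, f ⁅a, b⁆ = f a * f b - f b * f a) :
    UniversalEnvelopingAlgebra k G.LieQuot →ₐ[k] A :=
  UniversalEnvelopingAlgebra.lift k
    { f with map_lie' := fun {a b} => by rw [LieRing.of_associative_ring_bracket]; exact hf a b }

lemma lieLift_ι {A : Type*} [Ring A] [Algebra k A] (f : G.LieQuot →ₗ[k] A)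
    (hf : ∀ a b, f ⁅a, b⁆ = f a * f b - f b * f a) (a : G.LieQuot) :
    lieLift f hf (UniversalEnvelopingAlgebra.ι k a) = f a :=
  UniversalEnvelopingAlgebra.lift_ι_apply ..

/-- The projection of the tensor algebra to its degree `n` part. -/
def tensorProj (k g : Type*) [Field k] [AddCommGroup g] [Module k g] (n : ℕ) :
    TensorAlgebra k g →ₗ[k] ⨂[k]^n g :=
  DirectSum.component k ℕ (fun n => ⨂[k]^n g) n ∘ₗ TensorAlgebra.toDirectSum.toLinearMap

lemma tensorProj_tprod (n : ℕ) (x : Fin n → g) :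
    tensorProj k g n (TensorAlgebra.tprod k g n x) = PiTensorProduct.tprod k x := by
  simp only [tensorProj, LinearMap.comp_apply, AlgHom.toLinearMap_apply,
    TensorAlgebra.toDirectSum_tensorPower_tprod]
  exact DirectSum.component.lof_self k n _

lemma tensorProj_tprod_of_ne {n n' : ℕ} (h : n' ≠ n) (x : Fin n' → g) :
    tensorProj k g n (TensorAlgebra.tprod k g n' x) = 0 := by
  simp only [tensorProj, LinearMap.comp_apply, AlgHom.toLinearMap_apply,
    TensorAlgebra.toDirectSum_tensorPower_tprod]
  exact (DirectSum.component.of (R := k) n n' _).trans (dif_neg h)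

lemma smashInv_uLie_mul (a : UniversalEnvelopingAlgebra k G.LieQuot) (u : G.E.U) :
    G.smashInv (G.uLie a * u) = a • G.smashInv u := by
  rw [← smashEquiv_symm_apply, ← smashEquiv_symm_apply, ← map_smul]
  rfl

lemma smashInv_uProd {n : ℕ} (x : Fin n → g) :
    G.smashInv (G.uProd x) = 1 ⊗ₜ TensorAlgebra.tprod k g n x := by
  rw [uProd_eq_uGen, ← one_mul (G.uGen _), ← map_one G.uLie, ← smash_tmul, smashInv_smash]

variable {Z : Type*} [AddCommGroup Z] [Module k Z] (ρ : G.LieQuot →ₗ[k] Module.End k Z)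
  (hρ : ∀ a b, ρ ⁅a, b⁆ = ρ a * ρ b - ρ b * ρ a) {n : ℕ}
  (φ : MultilinearMap k (fun _ : Fin n => g) Z)

/-- The extension of an `n`-linear map on `g` with values in a representation of `g_Lie` to a
`g_Lie`-linear map on `U(E(g))` that vanishes in the degrees other than `n`. -/
def uExt : G.E.U →ₗ[k] Z :=
  -- Through `U(E(g)) = U(g_Lie) ⊗ T(g)` the map is `a t ↦ ρ(a) φ(t_n)`, where `t_n` is the degree
  -- `n` component of `t`.
  TensorProduct.lift (((lieLift ρ hρ).toLinearMap.compl₂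
    (PiTensorProduct.lift φ ∘ₗ tensorProj k g n))) ∘ₗ G.smashInv

lemma uExt_uLie_mul (a : UniversalEnvelopingAlgebra k G.LieQuot) (u : G.E.U) :
    uExt ρ hρ φ (G.uLie a * u) = lieLift ρ hρ a (uExt ρ hρ φ u) := by
  rw [uExt, LinearMap.comp_apply, smashInv_uLie_mul, LinearMap.comp_apply]
  induction G.smashInv u with
  | zero => simp
  | add x y hx hy => rw [smul_add, map_add, map_add, map_add, hx, hy]
  | tmul b t => simp [TensorProduct.smul_tmul']

lemma uExt_eLie_mul (a : G.LieQuot) (u : G.E.U) :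
    uExt ρ hρ φ (G.E.ι 0 (G.eLie a) * u) = ρ a (uExt ρ hρ φ u) := by
  rw [← uLie_ι, uExt_uLie_mul, lieLift_ι]

lemma uExt_uProd (x : Fin n → g) : uExt ρ hρ φ (G.uProd x) = φ x := by
  rw [uExt, LinearMap.comp_apply, smashInv_uProd, TensorProduct.lift.tmul, LinearMap.compl₂_apply,
    LinearMap.comp_apply, tensorProj_tprod, PiTensorProduct.lift.tprod, AlgHom.toLinearMap_apply,
    map_one, Module.End.one_apply]

lemma uExt_uProd_of_ne {n' : ℕ} (h : n' ≠ n) (x : Fin n' → g) :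
    uExt ρ hρ φ (G.uProd x) = 0 := by
  rw [uExt, LinearMap.comp_apply, smashInv_uProd, TensorProduct.lift.tmul, LinearMap.compl₂_apply,
    LinearMap.comp_apply, tensorProj_tprod_of_ne h, map_zero, map_zero]

lemma uExt_eq_zero {n' : ℤ} (h : n' ≠ n) {u : G.E.U} (hu : u ∈ G.E.Udeg n') :
    uExt ρ hρ φ u = 0 := by
  rcases lt_or_ge n' 0 with hn | hn
  · rw [Udeg_eq_bot hn, Submodule.mem_bot] at hu
    rw [hu, map_zero]
  lift n' to ℕ using hn
  rw [Udeg_eq_span] at hu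
  induction hu using Submodule.span_induction with
  | mem u hu =>
    obtain ⟨a, x, rfl⟩ := hu
    rw [uExt_uLie_mul, uExt_uProd_of_ne _ _ _ (by exact_mod_cast h), map_zero]
  | zero => simp
  | add u v _ _ hu hv => rw [map_add, hu, hv, add_zero]
  | smul c u _ hu => rw [map_smul, hu, smul_zero]

/-- A `g_Lie`-linear map on `U(E(g))_n` is determined by its values on the products of elements
of `g`. -/
lemma Udeg_hom_ext {n : ℕ} {f f' : G.E.Udeg n →ₗ[k] Z}
    (hf : ∀ a u, f (G.lieMul n a u) = ρ a (f u)) (hf' : ∀ a u, f' (G.lieMul n a u) = ρ a (f' u))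
    (h : ∀ x : Fin n → g, f (G.uProd x) = f' (G.uProd x)) : f = f' := by
  -- Equality on words extends to `a x_1 ⋯ x_n` by induction on the factors of `a`, the two maps
  -- commuting with `g_Lie`; such elements span the degree `n` part.
  have key : ∀ (a : UniversalEnvelopingAlgebra k G.LieQuot) (x : Fin n → g) (hu),
      f ⟨G.uLie a * G.uProd x, hu⟩ = f' ⟨G.uLie a * G.uProd x, hu⟩ := by
    intro a x hu
    induction a using UniversalEnvelopingAlgebra.induction_left with
    | one => simpa using h x
    | smul c a ih =>
      have e : (⟨G.uLie (c • a) * G.uProd x, hu⟩ : G.E.Udeg n)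
          = c • ⟨G.uLie a * G.uProd x, uLie_mul_mem a (G.uProd x).2⟩ := by
        ext; simp
      rw [e, map_smul, map_smul, ih]
    | add a b iha ihb =>
      have e : (⟨G.uLie (a + b) * G.uProd x, hu⟩ : G.E.Udeg n)
          = ⟨G.uLie a * G.uProd x, uLie_mul_mem a (G.uProd x).2⟩
            + ⟨G.uLie b * G.uProd x, uLie_mul_mem b (G.uProd x).2⟩ := by
        ext; simp [add_mul]
      rw [e, map_add, map_add, iha, ihb]
    | ι_mul a b ih =>
      have e : (⟨G.uLie (UniversalEnvelopingAlgebra.ι k a * b) * G.uProd x, hu⟩ : G.E.Udeg n)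
          = G.lieMul n a ⟨G.uLie b * G.uProd x, uLie_mul_mem b (G.uProd x).2⟩ := by
        apply Subtype.ext
        change G.uLie _ * _ = G.E.ι 0 (G.eLie a) * (G.uLie b * G.uProd x)
        rw [map_mul, uLie_ι, mul_assoc]
      rw [e, hf, hf', ih]
  ext ⟨u, hu⟩
  have hu' := hu
  rw [Udeg_eq_span] at hu'
  induction hu' using Submodule.span_induction with
  | mem u hu' =>
    obtain ⟨a, x, rfl⟩ := hu'
    exact key a x hu
  | zero => exact (map_zero f).trans (map_zero f').symm
  | add u v hu₁ hv₁ hu₂ hv₂ =>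
    rw [← Udeg_eq_span] at hu₁ hv₁
    have e : (⟨u + v, hu⟩ : G.E.Udeg n) = ⟨u, hu₁⟩ + ⟨v, hv₁⟩ := rfl
    rw [e, map_add, map_add, hu₂, hv₂]
  | smul c u hu₁ hu₂ =>
    rw [← Udeg_eq_span] at hu₁
    have e : (⟨c • u, hu⟩ : G.E.Udeg n) = c • ⟨u, hu₁⟩ := rfl
    rw [e, map_smul, map_smul, hu₂]

end Extension

/-! ### Coefficients in a `g_Lie`-module. -/

section LieCoefficients

variable (m : Type*) [AddCommGroup m] [Module k m] [LieRingModule G.LieQuot m]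
  [LieModule k G.LieQuot m]

variable (G) in
/-- The action of `g_Lie` on a module. -/
def modAct : G.LieQuot →ₗ[k] Module.End k m := LieModule.toEnd k G.LieQuot m

lemma modAct_apply (a : G.LieQuot) (v : m) : G.modAct m a v = ⁅a, v⁆ := rfl

lemma modAct_lie (a b : G.LieQuot) :
    G.modAct m ⁅a, b⁆ = G.modAct m a * G.modAct m b - G.modAct m b * G.modAct m a := by
  ext v
  simp [modAct_apply]

variable (G) in
/-- The isomorphism of `Hom_{g_Lie}(U(E(g))_n, m)` with the space of `n`-linear maps. -/
def lieHomEquiv (n : ℕ) : G.lieHom m n ≃ₗ[k] MultilinearMap k (fun _ : Fin n => g) m where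
  toFun f := f.1.compMultilinearMap (G.uMulDeg n)
  map_add' f f' := by ext; rfl
  map_smul' c f := by ext; rfl
  invFun φ := ⟨uExt (G.modAct m) (modAct_lie m) φ ∘ₗ (G.E.Udeg n).subtype,
    fun a u => uExt_eLie_mul _ _ _ _ _⟩
  left_inv f := by
    apply Subtype.ext
    refine Udeg_hom_ext (G.modAct m) (fun a u => uExt_eLie_mul _ _ _ _ _) f.2 fun x => ?_
    refine (uExt_uProd _ _ _ x).trans ?_
    rw [LinearMap.compMultilinearMap_apply, uMulDeg_apply]
  right_inv φ := by
    ext x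
    rw [LinearMap.compMultilinearMap_apply, uMulDeg_apply]
    exact uExt_uProd _ _ _ x

lemma lieHomEquiv_apply (n : ℕ) (f : G.lieHom m n) (x : Fin n → g) :
    G.lieHomEquiv m n f x = f.1 (G.uProd x) := by
  rw [← uMulDeg_apply]; rfl

lemma dUdeg_uProd {n : ℕ} (x : Fin (n + 1) → g) :
    G.E.dUdeg (Nat.cast_succ n).symm (G.uProd x) =
      ∑ j : Fin (n + 1), (-1 : k) ^ (j : ℕ) •
        G.lieMul n (G.toLie (x j)) (G.uProd fun l => x (j.succAbove l))
      - ∑ j : Fin (n + 1), ∑ i : Fin n with i.castSucc < j, (-1 : k) ^ (j : ℕ) •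
          G.uProd (Function.update (fun l => x (j.succAbove l)) i
            (G.opp.br (x i.castSucc) (x j))) := by
  apply Subtype.ext
  refine (dU_uProd x).trans ?_
  push_cast
  rfl

/-- By linearity `f(dx_j w) = dx_j · f(w)`, so `f` applied to the formula for `d(x_0 ⋯ x_n)` has the
terms of `-δ`. The summand `j = 0` is the one where the bracket is on the other side, and there
`[x_0, v]_opp = -dx_0 · v`. -/
lemma lieHomEquiv_lieHomD (n : ℕ) (f : G.lieHom m n) :
    G.lieHomEquiv m (n + 1) (G.lieHomD m (Nat.cast_succ n).symm f)
      = -(G.lieRep m).opp.cohomD n (G.lieHomEquiv m n f) := by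
  ext x
  rw [lieHomEquiv_apply]
  change f.1 (G.E.dUdeg _ (G.uProd x)) = -(G.lieRep m).opp.cohomFun (G.lieHomEquiv m n f) x
  rw [dUdeg_uProd, RightLeibniz.Rep.cohomFun_apply, Fin.sum_univ_succ]
  simp only [map_sub, map_add, map_sum, map_smul, f.2 _ _, lieHomEquiv_apply]
  have e1 : ∀ x v, (G.lieRep m).opp.l x v = -⁅G.toLie x, v⁆ := fun _ _ => rfl
  have e2 : ∀ x v, (G.lieRep m).opp.r v x = ⁅G.toLie x, v⁆ := fun _ _ => rfl
  simp only [e1, e2, Fin.val_succ, pow_succ, mul_neg_one, neg_smul, Finset.sum_neg_distrib,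
    Fin.val_zero, pow_zero, one_smul, Fin.succAbove_zero]
  abel

lemma lieHomD_lieHomD {p q r : ℤ} (h : p + 1 = q) (h' : q + 1 = r) (f : G.lieHom m p) :
    G.lieHomD m h' (G.lieHomD m h f) = 0 := by
  apply Subtype.ext
  ext u
  change f.1 (G.E.dUdeg h (G.E.dUdeg h' u)) = 0
  rw [G.E.dUdeg_dUdeg, map_zero]

lemma lieTensD_lieTensD {p q r : ℤ} (h : q + 1 = p) (h' : r + 1 = q) (z : G.LieTens m p) :
    G.lieTensD m h' (G.lieTensD m h z) = 0 := by
  obtain ⟨z, rfl⟩ := Submodule.mkQ_surjective _ z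
  change Submodule.mkQ _ (LinearMap.lTensor m (G.E.dUdeg h') (LinearMap.lTensor m (G.E.dUdeg h) z))
    = 0
  have e : G.E.dUdeg h' ∘ₗ G.E.dUdeg h = 0 := LinearMap.ext fun u => G.E.dUdeg_dUdeg h h' u
  rw [← LinearMap.comp_apply (LinearMap.lTensor m _), ← LinearMap.lTensor_comp, e,
    LinearMap.lTensor_zero, LinearMap.zero_apply, map_zero]

variable (G) in
/-- The action of `g_Lie` on `Hom(m, W)` through `m`. -/
def modCoact (W : Type*) [AddCommGroup W] [Module k W] :
    G.LieQuot →ₗ[k] Module.End k (m →ₗ[k] W) where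
  toFun a := -LinearMap.lcomp k W (G.modAct m a)
  map_add' a b := by ext; simp; abel
  map_smul' c a := by ext; simp

lemma modCoact_apply {W : Type*} [AddCommGroup W] [Module k W] (a : G.LieQuot) (h : m →ₗ[k] W)
    (v : m) : G.modCoact m W a h v = -h ⁅a, v⁆ := rfl

lemma modCoact_lie {W : Type*} [AddCommGroup W] [Module k W] (a b : G.LieQuot) :
    G.modCoact m W ⁅a, b⁆ = G.modCoact m W a * G.modCoact m W b
      - G.modCoact m W b * G.modCoact m W a := by
  ext h v
  simp [modCoact_apply]

variable (G) in
/-- The map `m ⊗_{g_Lie} U(E(g))_n → m ⊗ g^{⊗ n}`. -/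
def lieTensTo (n : ℕ) : G.LieTens m n →ₗ[k] m ⊗[k] (⨂[k] (_ : Fin n), g) :=
  (G.lieTensRel m n).liftQ
    -- A linear map from `m ⊗ U` to `W` that kills the relations is a `g_Lie`-linear map from `U` to
    -- `Hom(m, W)`, for the action `(a h)(v) = -h(a v)`. So the inverse is again an instance of
    -- `uExt`.
    (TensorProduct.lift (uExt (G.modCoact m _) (modCoact_lie m) (tensorPure k g m n)
      ∘ₗ (G.E.Udeg n).subtype).flip) <| by
    rw [lieTensRel, Submodule.span_le]
    rintro _ ⟨v, a, u, rfl⟩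
    have e := uExt_eLie_mul (G.modCoact m _) (modCoact_lie m) (tensorPure k g m n) a u.1
    rw [SetLike.mem_coe, LinearMap.mem_ker, map_sub, TensorProduct.lift.tmul,
      TensorProduct.lift.tmul, sub_eq_zero]
    refine Eq.trans ?_ (LinearMap.congr_fun e v).symm
    rw [modCoact_apply, ← map_neg]
    rfl

lemma lieTensTo_lieTmk_uProd (n : ℕ) (v : m) (x : Fin n → g) :
    G.lieTensTo m n (G.lieTmk v (G.uProd x)) = v ⊗ₜ PiTensorProduct.tprod k x := by
  change uExt (G.modCoact m _) (modCoact_lie m) (tensorPure k g m n) (G.uProd x) v = _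
  rw [uExt_uProd, tensorPure_apply]

variable (G) in
/-- The map `m ⊗ g^{⊗ n} → m ⊗_{g_Lie} U(E(g))_n`. -/
def lieTensOf (n : ℕ) : m ⊗[k] (⨂[k] (_ : Fin n), g) →ₗ[k] G.LieTens m n :=
  (G.lieTensRel m n).mkQ ∘ₗ LinearMap.lTensor m (PiTensorProduct.lift (G.uMulDeg n))

lemma lieTensOf_tmul (n : ℕ) (v : m) (x : Fin n → g) :
    G.lieTensOf m n (v ⊗ₜ PiTensorProduct.tprod k x) = G.lieTmk v (G.uProd x) := by
  simp [lieTensOf, lieTmk, uMulDeg_apply]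

lemma lieTmk_lieMul {n : ℤ} (v : m) (a : G.LieQuot) (u : G.E.Udeg n) :
    G.lieTmk v (G.lieMul n a u) = G.lieTmk (-⁅a, v⁆) u := by
  symm
  rw [← sub_eq_zero, lieTmk, lieTmk, ← map_sub, Submodule.mkQ_apply,
    Submodule.Quotient.mk_eq_zero]
  exact Submodule.subset_span ⟨v, a, u, rfl⟩

/-- Modulo the range, `u ↦ (v ↦ v ⊗ u)` is a `g_Lie`-linear map that vanishes on words in `g`; by
uniqueness it is zero. -/
lemma lieTensOf_surjective (n : ℕ) : Function.Surjective (G.lieTensOf m n) := by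
  set R := LinearMap.range (G.lieTensOf m n)
  let f : G.E.Udeg n →ₗ[k] m →ₗ[k] (G.LieTens m n ⧸ R) :=
    ((TensorProduct.mk k m (G.E.Udeg n)).compr₂ (R.mkQ ∘ₗ (G.lieTensRel m n).mkQ)).flip
  have hf : ∀ v (u : G.E.Udeg n), f u v = R.mkQ (G.lieTmk v u) := fun _ _ => rfl
  have h0 : f = 0 := by
    refine Udeg_hom_ext (G.modCoact m _) (fun a u => ?_) (fun a u => ?_) fun x => ?_
    · ext v
      rw [modCoact_apply, hf, hf, lieTmk_lieMul, ← map_neg]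
      simp [lieTmk, TensorProduct.neg_tmul]
    · simp
    · ext v
      rw [hf, ← lieTensOf_tmul]
      exact (Submodule.Quotient.mk_eq_zero R).2 ⟨_, rfl⟩
  intro z
  obtain ⟨z, rfl⟩ := Submodule.mkQ_surjective _ z
  rw [← LinearMap.mem_range]
  induction z with
  | zero => rw [map_zero]; exact zero_mem _
  | add a b ha hb => rw [map_add]; exact add_mem ha hb
  | tmul v u =>
    rw [← Submodule.Quotient.mk_eq_zero]
    exact (hf v u).symm.trans (by rw [h0]; rfl)

lemma lieTensTo_lieTensOf (n : ℕ) (t : m ⊗[k] (⨂[k] (_ : Fin n), g)) :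
    G.lieTensTo m n (G.lieTensOf m n t) = t := by
  have e : G.lieTensTo m n ∘ₗ G.lieTensOf m n = LinearMap.id := by
    ext v x
    simp [lieTensOf_tmul, lieTensTo_lieTmk_uProd]
  exact LinearMap.congr_fun e t

variable (G) in
/-- The isomorphism of `m ⊗_{g_Lie} U(E(g))_n` with `m ⊗ g^{⊗ n}`. -/
noncomputable def lieTensEquiv (n : ℕ) : G.LieTens m n ≃ₗ[k] m ⊗[k] (⨂[k] (_ : Fin n), g) :=
  (LinearEquiv.ofBijective (G.lieTensOf m n)
    ⟨Function.LeftInverse.injective (lieTensTo_lieTensOf m n), lieTensOf_surjective m n⟩).symm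

lemma lieTensEquiv_lieTmk (n : ℕ) (v : m) (x : Fin n → g) :
    G.lieTensEquiv m n (G.lieTmk v (G.uProd x)) = v ⊗ₜ PiTensorProduct.tprod k x := by
  rw [lieTensEquiv, LinearEquiv.symm_apply_eq]
  exact (lieTensOf_tmul m n v x).symm

/-- Balancing gives `v ⊗ dx_j w = -(dx_j · v) ⊗ w`. For `j = 0` this is `-[v, x_0]`; for `j > 0` the
sign is absorbed by `[x_j, v] = -dx_j · v` and the shift of the exponent. -/
lemma lieTensEquiv_lieTensD (n : ℕ) (z : G.LieTens m (n + 1 : ℕ)) :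
    G.lieTensEquiv m n (G.lieTensD m (Nat.cast_succ n).symm z)
      = -(G.lieCorep m).homD n (G.lieTensEquiv m (n + 1) z) := by
  have e : (G.lieTensEquiv m n).toLinearMap ∘ₗ G.lieTensD m (Nat.cast_succ n).symm
      ∘ₗ G.lieTensOf m (n + 1) = -(G.lieCorep m).homD n := by
    ext v x
    -- The class of `v ⊗ u` is written as a linear map in `u`, so that it can be distributed over
    -- the sums in `d(x_0 ⋯ x_n)`.
    have hT : ∀ u : G.E.Udeg n, G.lieTmk v u
        = ((G.lieTensRel m n).mkQ ∘ₗ TensorProduct.mk k m (G.E.Udeg n) v) u := fun _ => rfl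
    change G.lieTensEquiv m n (G.lieTensD m _ (G.lieTensOf m (n + 1)
      (v ⊗ₜ PiTensorProduct.tprod k x))) = -(G.lieCorep m).homD n (v ⊗ₜ PiTensorProduct.tprod k x)
    rw [lieTensOf_tmul, RightLeibniz.Corep.homD_tmul]
    change G.lieTensEquiv m n (G.lieTmk v (G.E.dUdeg _ (G.uProd x))) = _
    rw [dUdeg_uProd, hT, Fin.sum_univ_succ]
    simp only [map_sub, map_add, map_sum, map_smul]
    simp only [← hT, lieTmk_lieMul, lieTensEquiv_lieTmk]
    have e1 : ∀ x v, (G.lieCorep m).l x v = -⁅G.toLie x, v⁆ := fun _ _ => rfl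
    have e2 : ∀ x v, (G.lieCorep m).r v x = ⁅G.toLie x, v⁆ := fun _ _ => rfl
    simp only [e1, e2, Fin.val_succ, pow_succ, mul_neg_one, neg_smul, Finset.sum_neg_distrib,
      Fin.val_zero, pow_zero, one_smul, Fin.succAbove_zero, TensorProduct.neg_tmul, smul_neg]
    abel
  obtain ⟨t, rfl⟩ := (G.lieTensEquiv m (n + 1)).symm.surjective z
  rw [LinearEquiv.apply_symm_apply]
  exact LinearMap.congr_fun e t

end LieCoefficients
end LeftLeibniz
end Leib

/-! ### The tensor product `N ⊗_L U(L)` for a graded module `N`. -/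

namespace Leib

lemma sgn_add_one {k : Type*} [Field k] (n : ℤ) : sgn k (n + 1) = -sgn k n := by
  by_cases h : Even n <;> simp [sgn_eq_ite, h, parity_simps, ← Int.not_even_iff_odd]

lemma sgn_mul_self {k : Type*} [Field k] (n : ℤ) : sgn k n * sgn k n = 1 := by
  by_cases h : Even n <;> simp [sgn_eq_ite, h]

namespace GrModule

variable {k : Type*} [Field k] {L : DGLie k} (N : GrModule L)

/-- The operators of the right action on the total space. -/
def totRact (i : ℤ) : L.X i →ₗ[k] Module.End k N.Tot where
  toFun x := DirectSum.toModule k ℤ _ fun p => sgn k (i * p + 1) • (N.of (i + p) ∘ₗ N.act rfl x)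
  map_add' x y := by
    refine DirectSum.linearMap_ext k fun p => LinearMap.ext fun e => ?_
    simp
  map_smul' c x := by
    refine DirectSum.linearMap_ext k fun p => LinearMap.ext fun e => ?_
    simp [smul_comm c]

lemma totRact_of {i p q : ℤ} (h : i + p = q) (x : L.X i) (e : N.X p) :
    N.totRact i x (N.of p e) = N.of q (N.ract h e x) := by
  subst h
  simp [totRact, ract]

/-- The right action of `U(L)` on the total space of an `L`-module. -/
def rightAct : L.U →ₐ[k] (Module.End k N.Tot)ᵐᵒᵖ :=
  L.Ulift (DirectSum.toModule k ℤ _ fun i =>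
    (MulOpposite.opLinearEquiv k).toLinearMap ∘ₗ N.totRact i) fun {i j n} h x y => by
    apply MulOpposite.unop_injective
    refine DirectSum.linearMap_ext k fun p => LinearMap.ext fun e => ?_
    simp only [DirectSum.toModule_lof, LinearMap.comp_apply, LinearEquiv.coe_coe,
      MulOpposite.coe_opLinearEquiv, MulOpposite.unop_sub, MulOpposite.unop_smul,
      MulOpposite.unop_mul, MulOpposite.unop_op, LinearMap.sub_apply, LinearMap.smul_apply,
      Module.End.mul_apply]
    rw [N.totRact_of rfl x e, N.totRact_of (by omega : j + (i + p) = n + p) y,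
      N.totRact_of rfl y e, N.totRact_of (by omega : i + (j + p) = n + p) x, N.totRact_of rfl,
      ← map_smul, ← map_sub]
    congr 1
    simp only [ract, map_smul]
    -- In `e x y` the element `x` acts first. After the right actions are written as signed left
    -- actions, the relation of `U(L)` becomes the left module identity up to signs that depend on
    -- the three parities.
    rw [N.act_br h rfl rfl (by omega) rfl (by omega)]
    subst h
    by_cases pi : Even i <;> by_cases pj : Even j <;> by_cases pp : Even p <;>
      simp [sgn_eq_ite, parity_simps, pi, pj, pp, ← Int.not_even_iff_odd] <;> abel

lemma rightAct_ι {i : ℤ} (x : L.X i) (z : N.Tot) :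
    (N.rightAct (L.ι i x)).unop z = N.totRact i x z := by
  rw [← DGLie.totι_of, rightAct, DGLie.Ulift_totι, DirectSum.toModule_lof]
  rfl

/-- The map `e ⊗ u ↦ e u` from `N ⊗_L U(L)` to `N`. -/
def tensTo : N.Tens →ₗ[k] N.Tot :=
  N.tensRel.liftQ (TensorProduct.lift
      ((MulOpposite.opLinearEquiv k).symm.toLinearMap ∘ₗ N.rightAct.toLinearMap).flip) <| by
    rw [tensRel, Submodule.span_le]
    rintro _ ⟨i, p, q, h, e, x, u, rfl⟩
    rw [SetLike.mem_coe, LinearMap.mem_ker, map_sub, TensorProduct.lift.tmul,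
      TensorProduct.lift.tmul, sub_eq_zero]
    change (N.rightAct u).unop (N.of q (N.ract h e x)) = (N.rightAct (L.ι i x * u)).unop (N.of p e)
    rw [map_mul, MulOpposite.unop_mul, Module.End.mul_apply, rightAct_ι, N.totRact_of h]

lemma tensTo_tmk {p : ℤ} (e : N.X p) (u : L.U) :
    N.tensTo (N.tmk e u) = (N.rightAct u).unop (N.of p e) := rfl

lemma tmk_ι_mul {i p q : ℤ} (h : i + p = q) (e : N.X p) (x : L.X i) (u : L.U) :
    N.tmk e (L.ι i x * u) = N.tmk (N.ract h e x) u := by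
  symm
  rw [← sub_eq_zero, tmk, tmk, ← map_sub, Submodule.mkQ_apply, Submodule.Quotient.mk_eq_zero]
  exact Submodule.subset_span ⟨i, p, q, h, e, x, u, rfl⟩

/-- `e ⊗ u` as a bilinear map. -/
def tmkHom (p : ℤ) : N.X p →ₗ[k] L.U →ₗ[k] N.Tens :=
  (TensorProduct.mk k N.Tot L.U ∘ₗ N.of p).compr₂ N.tensRel.mkQ

lemma tmkHom_apply {p : ℤ} (e : N.X p) (u : L.U) : N.tmkHom p e u = N.tmk e u := rfl

/-- The letters of a word `u` are moved across the tensor sign one at a time, each acting on `e`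
from the right. -/
lemma tmk_eq_tmk_one {p q n : ℤ} (h : p + q = n) (e : N.X p) {u : L.U} (hu : u ∈ L.Udeg q) :
    ∃ e' : N.X n, N.tmk e u = N.tmk e' 1 := by
  subst h
  induction hu using Submodule.span_induction with
  | mem u hu =>
    obtain ⟨l, rfl, rfl⟩ := hu
    induction l generalizing p with
    | nil =>
      have h0 : p + (List.map Sigma.fst ([] : List (Σ i, L.X i))).sum = p := by simp
      rw [h0]
      exact ⟨e, by simp⟩
    | cons x l ih =>
      obtain ⟨e', he'⟩ := ih (N.ract (add_comm x.1 p) e x.2)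
      have h0 : p + (List.map Sigma.fst (x :: l)).sum
          = p + x.1 + (List.map Sigma.fst l).sum := by simp [add_assoc]
      rw [h0]
      exact ⟨e', by rw [← he', List.map_cons, List.prod_cons, N.tmk_ι_mul (add_comm x.1 p)]⟩
  | zero => exact ⟨0, by rw [← tmkHom_apply, ← tmkHom_apply, map_zero, map_zero]; rfl⟩
  | add u v _ _ hu hv =>
    obtain ⟨a, ha⟩ := hu
    obtain ⟨b, hb⟩ := hv
    refine ⟨a + b, ?_⟩
    rw [← tmkHom_apply, ← tmkHom_apply, map_add, map_add, LinearMap.add_apply, tmkHom_apply,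
      tmkHom_apply, ha, hb]
    rfl
  | smul c u _ hu =>
    obtain ⟨a, ha⟩ := hu
    refine ⟨c • a, ?_⟩
    rw [← tmkHom_apply, ← tmkHom_apply, map_smul, map_smul, LinearMap.smul_apply, tmkHom_apply, ha]
    rfl

/-- The isomorphism `e ↦ e ⊗ 1` of `N_n` with the degree `n` part of `N ⊗_L U(L)`. -/
def toTensDeg (n : ℤ) : N.X n →ₗ[k] N.tensDeg n :=
  ((N.tmkHom n).flip 1).codRestrict _ fun e => N.tmk_mem (add_zero n) e L.one_mem_Udeg

lemma toTensDeg_coe {n : ℤ} (e : N.X n) : (N.toTensDeg n e : N.Tens) = N.tmk e 1 := rfl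

/-- The multiplication map `e ⊗ u ↦ e u` is a left inverse: it sends `e ⊗ 1` to `e`. -/
lemma toTensDeg_injective (n : ℤ) : Function.Injective (N.toTensDeg n) := by
  intro e e' h
  have := congrArg (fun t : N.tensDeg n => N.tensTo t) h
  simp only [toTensDeg_coe, tensTo_tmk, map_one, MulOpposite.unop_one, Module.End.one_apply] at this
  exact DirectSum.of_injective n this

lemma toTensDeg_surjective (n : ℤ) : Function.Surjective (N.toTensDeg n) := by
  rintro ⟨t, ht⟩
  suffices h : ∃ e, N.tmk e 1 = t by
    obtain ⟨e, he⟩ := h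
    exact ⟨e, Subtype.ext he⟩
  induction ht using Submodule.span_induction with
  | mem t ht =>
    obtain ⟨p, q, h, e, u, hu, rfl⟩ := ht
    obtain ⟨e', he'⟩ := N.tmk_eq_tmk_one h e hu
    exact ⟨e', he'.symm⟩
  | zero => exact ⟨0, by rw [← tmkHom_apply, map_zero]; rfl⟩
  | add u v _ _ hu hv =>
    obtain ⟨a, rfl⟩ := hu
    obtain ⟨b, rfl⟩ := hv
    exact ⟨a + b, by rw [← tmkHom_apply, map_add]; rfl⟩
  | smul c u _ hu =>
    obtain ⟨a, rfl⟩ := hu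
    exact ⟨c • a, by rw [← tmkHom_apply, map_smul]; rfl⟩

/-- The truncation does not change the tensor product with `U(L)` in non-negative degrees. -/
lemma truncTensDeg_bijective (hL : ∀ i < 0, ∀ x : L.X i, x = 0) {n : ℤ} (hn : 0 ≤ n) :
    Function.Bijective (N.truncTensDeg hL n) := by
  -- Both tensor products are identified with the degree `n` parts of the modules, and for `n ≥ 0`
  -- the truncation leaves `N_n` unchanged.
  have hc : ∀ e, N.truncTensDeg hL n ((N.trunc hL).toTensDeg n e)
      = N.toTensDeg n (N.truncIncl hL n e) := fun e => Subtype.ext (N.truncTens_tmk hL e 1)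
  constructor
  · intro s t h
    obtain ⟨e, rfl⟩ := (N.trunc hL).toTensDeg_surjective n s
    obtain ⟨e', rfl⟩ := (N.trunc hL).toTensDeg_surjective n t
    rw [hc, hc] at h
    rw [Subtype.ext (N.toTensDeg_injective n h)]
  · intro t
    obtain ⟨e, rfl⟩ := N.toTensDeg_surjective n t
    exact ⟨(N.trunc hL).toTensDeg n ⟨e, fun h => absurd h (by omega)⟩, hc _⟩

/-- Right multiplication by `w` on `N ⊗_L U(L)`. -/
def tensMul (w : L.U) : N.Tens →ₗ[k] N.Tens :=
  N.tensRel.mapQ N.tensRel (LinearMap.lTensor _ (LinearMap.mulRight k w)) <| by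
    rw [tensRel, Submodule.span_le]
    rintro _ ⟨i, p, q, h, e, x, u, rfl⟩
    exact Submodule.subset_span ⟨i, p, q, h, e, x, u * w, by simp [mul_assoc]⟩

lemma tensMul_tmk {p : ℤ} (e : N.X p) (u w : L.U) :
    N.tensMul w (N.tmk e u) = N.tmk e (u * w) := by
  simp [tensMul, tmk]

end GrModule

namespace DGModule

variable {k : Type*} [Field k] {L : DGLie k} (M : DGModule L)

/-- The two terms `de ⊗ du` have the signs `(-1)^{p - 1}` and `(-1)^p`, where `p = |e|`. -/
lemma tensD_tensD {n : ℤ} {t : M.Tens} (ht : t ∈ M.tensDeg n) : M.tensD (M.tensD t) = 0 := by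
  induction ht using Submodule.span_induction with
  | mem t ht =>
    obtain ⟨p, q, hpq, e, u, hu, rfl⟩ := ht
    rw [M.tensD_tmk (sub_add_cancel p 1), map_add, map_smul,
      M.tensD_tmk (sub_add_cancel (p - 1) 1), M.tensD_tmk (sub_add_cancel p 1), M.d_d, L.dU_dU]
    simp only [← GrModule.tmkHom_apply, map_zero, LinearMap.zero_apply, smul_zero, zero_add,
      add_zero]
    rw [← add_smul]
    have := sgn_add_one (k := k) (p - 1)
    rw [sub_add_cancel] at this
    rw [this, add_neg_cancel, zero_smul]
  | zero => simp
  | add u v _ _ hu hv => rw [map_add, map_add, hu, hv, add_zero]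
  | smul c u _ hu => rw [map_smul, map_smul, hu, smul_zero]

lemma tensDdeg_tensDdeg {p q r : ℤ} (h : q + 1 = p) (h' : r + 1 = q) (z : M.tensDeg p) :
    M.tensDdeg h' (M.tensDdeg h z) = 0 := Subtype.ext (M.tensD_tensD z.2)

end DGModule

end Leib

/-! ### The chain complex of a representation. -/

namespace Leib

lemma GrModule.act_eq_ract {k : Type*} [Field k] {L : DGLie k} (N : GrModule L) {i p q : ℤ}
    (h : i + p = q) (x : L.X i) (e : N.X p) :
    N.act h x e = sgn k (i * p + 1) • N.ract h e x := by
  rw [ract, smul_smul, sgn_mul_self, one_smul]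

namespace LeftLeibniz
namespace Rep

variable {k : Type*} [Field k] {g : Type*} [AddCommGroup g] [Module k g] {G : LeftLeibniz k g}
  {m : Type*} [AddCommGroup m] [Module k m] (V : G.Rep m)

/-- The map from `m_symm` to `E(m)_{-1}`. -/
def eSym : V.Symm →ₗ[k] V.E.X (-1) := V.Esym rfl

/-- An induction principle for the homogeneous elements of `E(m)`. -/
@[elab_as_elim]
lemma E_induction {P : ∀ p : ℤ, V.E.X p → Prop} (zero : ∀ p, P p 0)
    (add : ∀ p x y, P p x → P p y → P p (x + y)) (smul : ∀ p (c : k) x, P p x → P p (c • x))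
    (gen : ∀ v, P 0 (V.eGen v)) (sym : ∀ s, P (-1) (V.eSym s))
    (act : ∀ (i p q : ℤ) (h : i + p = q) (x : G.E.X i) (e : V.E.X p), P p e →
      P q (V.E.act h x e)) {p : ℤ} (e : V.E.X p) : P p e := by
  obtain ⟨t, rfl⟩ := Emk_surj e
  induction t with
  | zero n => exact zero n
  | add a b iha ihb => exact add _ _ _ iha ihb
  | smul c a ih => exact smul _ c _ ih
  | gen hn v => subst hn; exact gen v
  | sym hn s => subst hn; exact sym s
  | act h x a ih => exact act _ _ _ h x _ ih

/-! ### Spanning of `E(m) ⊗_{E(g)} U(E(g))` by `v ⊗ x_1 ⋯ x_n`. -/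

section Spanning

lemma ract_eGen_eLie (v : m) (x : g) :
    V.E.ract (zero_add 0) (V.eGen v) (G.eLie (G.toLie x)) = -V.eGen (V.l x v) := by
  have e : V.E.act (zero_add 0) (G.eLie (G.toLie x)) (V.eGen v) = V.eGen (V.l x v) :=
    V.Eact_lie_gen (zero_add 0) rfl rfl rfl x v
  rw [GrModule.ract, e, sgn_eq_ite, if_neg (by simp), neg_one_smul]

lemma ract_eSym_eLie (v : m) (x : g) :
    V.E.ract (zero_add (-1)) (V.eSym (V.anti.mkQ v)) (G.eLie (G.toLie x))
      = -V.eSym (V.anti.mkQ (V.l x v)) := by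
  have e : V.E.act (zero_add (-1)) (G.eLie (G.toLie x)) (V.eSym (V.anti.mkQ v))
      = V.eSym (V.anti.mkQ (V.l x v)) :=
    V.Eact_lie_sym (zero_add (-1)) rfl rfl rfl x v
  rw [GrModule.ract, e, sgn_eq_ite, if_neg (by simp), neg_one_smul]

/-- The exponent `1 · (-1) + 1` is even, so the right action equals the left one here, whereas the
two actions of `g_Lie` differ by a sign. -/
lemma ract_eSym_eGen (v : m) (x : g) :
    V.E.ract (add_neg_cancel 1) (V.eSym (V.anti.mkQ v)) (G.eGen x) = -V.eGen (V.r v x) := by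
  have e : V.E.act (add_neg_cancel 1) (G.eGen x) (V.eSym (V.anti.mkQ v)) = V.eGen (-V.r v x) :=
    V.Eact_gen_sym (add_neg_cancel 1) rfl rfl rfl x v
  rw [GrModule.ract, e, sgn_eq_ite, if_pos (by simp), one_smul, map_neg]

lemma d_eGen (v : m) : V.E.d (neg_add_cancel 1) (V.eGen v) = V.eSym (V.anti.mkQ v) := rfl

/-- The subspace of `E(m) ⊗_{E(g)} U(E(g))` spanned by the elements `v ⊗ u`, for `v` in `m` and `u`
of degree `n`, and, for `n = -1`, the elements `dv ⊗ 1`. -/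
def genSpan (n : ℤ) : Submodule k V.E.Tens :=
  Submodule.span k ({t | ∃ (v : m), ∃ u ∈ G.E.Udeg n, t = V.E.tmk (V.eGen v) u} ∪
    {t | n = -1 ∧ ∃ s : V.Symm, t = V.E.tmk (V.eSym s) 1})

lemma tmk_eGen_mem (v : m) {n : ℤ} {u : G.E.U} (hu : u ∈ G.E.Udeg n) :
    V.E.tmk (V.eGen v) u ∈ V.genSpan n := Submodule.subset_span (.inl ⟨v, u, hu, rfl⟩)

lemma tmk_eSym_mem (s : V.Symm) : V.E.tmk (V.eSym s) 1 ∈ V.genSpan (-1) :=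
  Submodule.subset_span (.inr ⟨rfl, s, rfl⟩)

/-- Right multiplication visibly preserves the elements `v ⊗ u`; only `dv ⊗ 1` is in question. That
case is kept as the hypothesis `hx`, because its proof for a bracket needs the present lemma for the
two factors. -/
lemma tensMul_mem_of {i p q : ℤ} (h : i + p = q) (x : G.E.X i)
    (hx : ∀ (s : V.Symm) (q : ℤ), i + -1 = q → V.E.tmk (V.eSym s) (G.E.ι i x) ∈ V.genSpan q)
    {t : V.E.Tens} (ht : t ∈ V.genSpan p) : V.E.tensMul (G.E.ι i x) t ∈ V.genSpan q := by
  subst h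
  induction ht using Submodule.span_induction with
  | mem t ht =>
    rcases ht with ⟨v, u, hu, rfl⟩ | ⟨rfl, s, rfl⟩
    · rw [GrModule.tensMul_tmk]
      exact V.tmk_eGen_mem v (G.E.mul_mem_Udeg (add_comm p i) hu (G.E.ι_mem_Udeg x))
    · rw [GrModule.tensMul_tmk, one_mul]
      exact hx s _ rfl
  | zero => rw [map_zero]; exact zero_mem _
  | add a b _ _ ha hb => rw [map_add]; exact add_mem ha hb
  | smul c a _ ha => rw [map_smul]; exact Submodule.smul_mem _ c ha

/-- For the generators, `dv ⊗ dx = -d[x, v] ⊗ 1` and `dv ⊗ x = -[v, x] ⊗ 1`; brackets are graded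
commutators of right multiplications. -/
lemma tmk_eSym_ι_mem {i q : ℤ} (h : i + -1 = q) (x : G.E.X i) (s : V.Symm) :
    V.E.tmk (V.eSym s) (G.E.ι i x) ∈ V.genSpan q := by
  induction x using LeftLeibniz.E_induction generalizing s q with
  | zero i => rw [← GrModule.tmkHom_apply, map_zero, map_zero]; exact zero_mem _
  | add i x y hx hy =>
    rw [← GrModule.tmkHom_apply, map_add, map_add]
    exact add_mem (hx h s) (hy h s)
  | smul i c x hx =>
    rw [← GrModule.tmkHom_apply, map_smul, map_smul]
    exact Submodule.smul_mem _ c (hx h s)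
  | lie a =>
    obtain rfl : q = -1 := by omega
    obtain ⟨x, rfl⟩ := G.toLie_surjective a
    obtain ⟨v, rfl⟩ := V.anti.mkQ_surjective s
    rw [← mul_one (G.E.ι 0 _), V.E.tmk_ι_mul (zero_add (-1)), ract_eSym_eLie, ← map_neg]
    exact V.tmk_eSym_mem _
  | gen x =>
    obtain rfl : q = 0 := by omega
    obtain ⟨v, rfl⟩ := V.anti.mkQ_surjective s
    rw [← mul_one (G.E.ι 1 _), V.E.tmk_ι_mul (add_neg_cancel 1), ract_eSym_eGen, ← map_neg]
    exact V.tmk_eGen_mem _ G.E.one_mem_Udeg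
  | br i j n hij x y hx hy =>
    rw [← G.E.ι_br hij, ← GrModule.tmkHom_apply, map_sub, map_smul, GrModule.tmkHom_apply,
      GrModule.tmkHom_apply, ← GrModule.tensMul_tmk, ← GrModule.tensMul_tmk]
    exact sub_mem (V.tensMul_mem_of (by omega) y (fun s q hq => hy hq s) (hx rfl s))
      (Submodule.smul_mem _ _
        (V.tensMul_mem_of (by omega) x (fun s q hq => hx hq s) (hy rfl s)))

lemma tensMul_mem {i p q : ℤ} (h : i + p = q) (x : G.E.X i) {t : V.E.Tens}
    (ht : t ∈ V.genSpan p) : V.E.tensMul (G.E.ι i x) t ∈ V.genSpan q :=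
  V.tensMul_mem_of h x (fun s _ hq => V.tmk_eSym_ι_mem hq x s) ht

/-- Up to sign, acting by `x` on `e` is right multiplication of `e ⊗ 1` by `x`. So the claim follows
by induction on how `e` is built from `m` and `m_symm`. -/
lemma tmk_one_mem {p : ℤ} (e : V.E.X p) : V.E.tmk e 1 ∈ V.genSpan p := by
  induction e using E_induction with
  | zero n => rw [← GrModule.tmkHom_apply, map_zero]; exact zero_mem _
  | add n a b iha ihb => rw [← GrModule.tmkHom_apply, map_add]; exact add_mem iha ihb
  | smul n c a ih => rw [← GrModule.tmkHom_apply, map_smul]; exact Submodule.smul_mem _ c ih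
  | gen v => exact V.tmk_eGen_mem v G.E.one_mem_Udeg
  | sym s => exact V.tmk_eSym_mem s
  | act i p n h x a ih =>
    rw [GrModule.act_eq_ract, ← GrModule.tmkHom_apply, map_smul]
    refine Submodule.smul_mem _ _ ?_
    rw [GrModule.tmkHom_apply, ← V.E.tmk_ι_mul h, mul_one, ← one_mul (G.E.ι i x),
      ← GrModule.tensMul_tmk]
    exact V.tensMul_mem h x ih

/-- The map `v ⊗ x_1 ⋯ x_n ↦ v ⊗ x_1 ⋯ x_n` from `m ⊗ g^{⊗ n}` to `E(m) ⊗_{E(g)} U(E(g))`. -/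
def tensOfTens (n : ℕ) : m ⊗[k] (⨂[k] (_ : Fin n), g) →ₗ[k] V.E.Tens :=
  TensorProduct.lift ((V.E.tmkHom 0 ∘ₗ V.eGen).compl₂ (PiTensorProduct.lift (G.uMul n)))

lemma tensOfTens_tmul {n : ℕ} (v : m) (x : Fin n → g) :
    V.tensOfTens n (v ⊗ₜ PiTensorProduct.tprod k x) = V.tensProd v x := by
  simp only [tensOfTens, TensorProduct.lift.tmul, LinearMap.compl₂_apply,
    PiTensorProduct.lift.tprod, uMul_apply]
  rfl

/-- The map `m ⊗ g^{⊗ n} → (E(m) ⊗_{E(g)} U(E(g)))_n`. -/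
def tensOf (n : ℕ) : m ⊗[k] (⨂[k] (_ : Fin n), g) →ₗ[k] V.E.tensDeg n :=
  (V.tensOfTens n).codRestrict _ fun t => by
    induction t with
    | zero => rw [map_zero]; exact zero_mem _
    | add a b ha hb => rw [map_add]; exact add_mem ha hb
    | tmul v t =>
      induction t using PiTensorProduct.induction_on with
      | smul_tprod c x =>
        rw [TensorProduct.tmul_smul, map_smul, tensOfTens_tmul]
        exact Submodule.smul_mem _ c (V.tensProd v x).2
      | add a b ha hb => rw [TensorProduct.tmul_add, map_add]; exact add_mem ha hb

lemma tensOf_tmul {n : ℕ} (v : m) (x : Fin n → g) :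
    V.tensOf n (v ⊗ₜ PiTensorProduct.tprod k x) = V.tensProd v x :=
  Subtype.ext (V.tensOfTens_tmul v x)

/-- Since `v ⊗ dy w = -[y, v] ⊗ w`, factors from `g_Lie` are absorbed into `v`; this is why `v`
varies in the induction. -/
lemma tmk_eGen_uLie_mul_mem {n : ℕ} (v : m) (b : UniversalEnvelopingAlgebra k G.LieQuot)
    (x : Fin n → g) :
    V.E.tmk (V.eGen v) (G.uLie b * G.uProd x) ∈ LinearMap.range (V.tensOfTens n) := by
  induction b using UniversalEnvelopingAlgebra.induction_left generalizing v with
  | one =>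
    rw [map_one, one_mul]
    exact ⟨_, V.tensOfTens_tmul v x⟩
  | smul c a ih =>
    rw [map_smul, smul_mul_assoc, ← GrModule.tmkHom_apply, map_smul]
    exact Submodule.smul_mem _ c (ih v)
  | add a b iha ihb =>
    rw [map_add, add_mul, ← GrModule.tmkHom_apply, map_add]
    exact add_mem (iha v) (ihb v)
  | ι_mul a b ih =>
    obtain ⟨y, rfl⟩ := G.toLie_surjective a
    rw [map_mul, uLie_ι, mul_assoc, V.E.tmk_ι_mul (zero_add 0), ract_eGen_eLie, ← map_neg]
    exact ih _

/-- Every element of degree `n` is `e ⊗ 1` with `e` in `E(m)_n`, hence a combination of elements `v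
⊗ u`: the other generators `dv ⊗ 1` occur only in degree `-1`. -/
lemma tensOf_surjective (n : ℕ) : Function.Surjective (V.tensOf n) := by
  intro t
  obtain ⟨e, rfl⟩ := V.E.toTensDeg_surjective n t
  suffices h : V.E.tmk e 1 ∈ LinearMap.range (V.tensOfTens n) by
    obtain ⟨z, hz⟩ := h
    exact ⟨z, Subtype.ext hz⟩
  have h := V.tmk_one_mem e
  generalize V.E.tmk e 1 = t at h
  induction h using Submodule.span_induction with
  | mem t ht =>
    rcases ht with ⟨v, u, hu, rfl⟩ | ⟨hn, -⟩
    · rw [Udeg_eq_span] at hu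
      induction hu using Submodule.span_induction with
      | mem u hu =>
        obtain ⟨b, x, rfl⟩ := hu
        exact V.tmk_eGen_uLie_mul_mem v b x
      | zero => rw [← GrModule.tmkHom_apply, map_zero]; exact zero_mem _
      | add a b _ _ ha hb => rw [← GrModule.tmkHom_apply, map_add]; exact add_mem ha hb
      | smul c a _ ha =>
        rw [← GrModule.tmkHom_apply, map_smul]; exact Submodule.smul_mem _ c ha
    · omega
  | zero => exact zero_mem _
  | add a b _ _ ha hb => exact add_mem ha hb
  | smul c a _ ha => exact Submodule.smul_mem _ c ha

end Spanning

/-! ### The model `m ⊗ T(g) ⊕ m_symm` of `E(m)` and the boundary. -/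

section Model

/-- The action of `g_Lie` on `m`. -/
def lieOn : G.LieQuot →ₗ[k] Module.End k m :=
  G.ann.liftQ V.l fun _ hx => V.l_ann hx

lemma lieOn_toLie (x : g) : V.lieOn (G.toLie x) = V.l x := rfl

lemma lieOn_lie (a b : G.LieQuot) :
    V.lieOn ⁅a, b⁆ = V.lieOn a * V.lieOn b - V.lieOn b * V.lieOn a := by
  obtain ⟨x, rfl⟩ := G.toLie_surjective a
  obtain ⟨y, rfl⟩ := G.toLie_surjective b
  ext v
  simp [G.toLie_lie, lieOn_toLie, V.llm]

lemma lieOn_anti (a : G.LieQuot) : V.anti ≤ V.anti.comap (V.lieOn a) := fun v hv => by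
  obtain ⟨x, rfl⟩ := G.toLie_surjective a
  exact V.l_anti x hv

/-- The operators of `g_Lie` on `m ⊗ T(g) ⊕ m_symm`. -/
def modelLie : G.LieQuot →ₗ[k] Module.End k ((m ⊗[k] TensorAlgebra k g) × V.Symm) where
  toFun a := (TensorProduct.map (V.lieOn a) LinearMap.id
    + TensorProduct.map LinearMap.id (G.der a)).prodMap
      (V.anti.mapQ V.anti (V.lieOn a) (V.lieOn_anti a))
  map_add' a b := by
    ext <;> simp [TensorProduct.add_tmul, TensorProduct.tmul_add]
    abel
  map_smul' c a := by
    ext <;> simp [TensorProduct.smul_tmul']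

lemma symR_mk (x : g) (v : m) :
    V.symR x (Submodule.Quotient.mk v) = -V.r v x := rfl

/-- The operators of `g` on `m ⊗ T(g) ⊕ m_symm`: `x (v ⊗ t) = v ⊗ t x` and
`x dv = -[v, x] ⊗ 1`. -/
def modelGen : g →ₗ[k] Module.End k ((m ⊗[k] TensorAlgebra k g) × V.Symm) where
  -- The left action of `x` appends `x` at the right end: `v ⊗ x_1 ⋯ x_n` stands for `x_n` applied
  -- after `x_{n-1}`, and so on down to `x_1` applied to `v`.
  toFun x := LinearMap.inl k _ _ ∘ₗ
    (TensorProduct.map LinearMap.id (LinearMap.mulRight k (TensorAlgebra.ι k x))).coprod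
      ((TensorProduct.mk k m (TensorAlgebra k g)).flip 1 ∘ₗ V.symR x)
  map_add' a b := by
    ext <;> simp [TensorProduct.tmul_add, mul_add, symR_mk, add_comm]
  map_smul' c a := by
    ext <;> simp [TensorProduct.smul_tmul', symR_mk]

lemma modelLie_lie (a b : G.LieQuot) :
    V.modelLie ⁅a, b⁆ = V.modelLie a * V.modelLie b - V.modelLie b * V.modelLie a := by
  ext <;> simp [modelLie, lieOn_lie, der_lie, TensorProduct.sub_tmul, TensorProduct.tmul_sub]
  abel

/-- On `m ⊗ T(g)` this is the derivation property; on `m_symm` it is the identity `[[x, v], y] = [x,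
[v, y]] - [v, [x, y]]`. -/
lemma modelGen_lieAct (a : G.LieQuot) (y : g) :
    V.modelGen (G.lieAct a y) = V.modelLie a * V.modelGen y - V.modelGen y * V.modelLie a := by
  obtain ⟨x, rfl⟩ := G.toLie_surjective a
  ext <;> simp [modelLie, modelGen, der_mul, der_ι, der_one, lieOn_toLie, TensorProduct.tmul_add,
    symR_mk, V.lml]
  abel

lemma modelGen_apply (x : g) (v : m) (t : TensorAlgebra k g) :
    V.modelGen x (v ⊗ₜ t, 0) = (v ⊗ₜ (t * TensorAlgebra.ι k x), 0) := by
  simp [modelGen]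

/-- The operators of `E(g)` on `m ⊗ T(g) ⊕ m_symm`. -/
def modelE (i : ℤ) : G.E.X i →ₗ[k] Module.End k ((m ⊗[k] TensorAlgebra k g) × V.Symm) :=
  EXeval V.modelLie V.modelGen V.modelLie_lie V.modelGen_lieAct i

lemma modelE_br {i j n : ℤ} (h : i + j = n) (x : G.EX i) (y : G.EX j) :
    V.modelE n (G.Ebr h x y) =
      V.modelE i x * V.modelE j y - sgn k (i * j) • (V.modelE j y * V.modelE i x) :=
  Eeval_br _ _ V.modelLie_lie V.modelGen_lieAct h x y

lemma modelE_eGen (x : g) : V.modelE 1 (G.eGen x) = V.modelGen x := rfl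

variable {V} in
/-- The value of a formal expression in `m ⊗ T(g) ⊕ m_symm`. -/
def modelPre : ∀ {p : ℤ}, MPre V p → (m ⊗[k] TensorAlgebra k g) × V.Symm
  | _, .zero _ => 0
  | _, .add a b => modelPre a + modelPre b
  | _, .smul c a => c • modelPre a
  | _, .gen _ v => (v ⊗ₜ 1, 0)
  | _, .sym _ s => (0, s)
  | _, .act (i := i) _ x a => V.modelE i x (modelPre a)

-- The module axioms hold because brackets act as graded commutators of operators, and the relations
-- on generators hold by the choice of the operators. No grading of the model is needed.
variable {V} in
lemma modelPre_rel {p : ℤ} {a b : MPre V p} (r : MRel V a b) : modelPre a = modelPre b := by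
  induction r with
  | refl a => rfl
  | symm _ ih => exact ih.symm
  | trans _ _ ih ih' => exact ih.trans ih'
  | add_congr _ _ ih ih' => simp only [modelPre, ih, ih']
  | smul_congr c _ ih => simp only [modelPre, ih]
  | act_congr h x r ih => simp only [modelPre, ih]
  | add_assoc a b c => simp only [modelPre, add_assoc]
  | add_comm a b => simp only [modelPre, add_comm]
  | zero_add a => simp only [modelPre, zero_add]
  | zero_smul a => simp only [modelPre, zero_smul]
  | one_smul a => simp only [modelPre, one_smul]
  | mul_smul c c' a => simp only [modelPre, mul_smul]
  | add_smul c c' a => simp only [modelPre, add_smul]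
  | smul_add c a b => simp only [modelPre, smul_add]
  | gen_add h a b => simp [modelPre, TensorProduct.add_tmul]
  | gen_smul h c a => simp [modelPre, TensorProduct.smul_tmul']
  | sym_add h a b => simp [modelPre]
  | sym_smul h c a => simp [modelPre]
  | act_add h x b c => simp only [modelPre, map_add]
  | add_act h x y c => exact LinearMap.congr_fun (map_add (V.modelE _) x y) _
  | act_smul h c x b => simp only [modelPre, map_smul]
  | smul_act h c x b => exact LinearMap.congr_fun (map_smul (V.modelE _) c x) _
  | act_br hij h₀ h₁ h₂ h₃ h₄ x y a =>
    simp only [modelPre]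
    rw [modelE_br, LinearMap.sub_apply, LinearMap.smul_apply, mul_comm, neg_smul, sub_eq_add_neg]
    rfl
  | act_lie_gen h hi hp hn x v =>
    subst hi
    change V.modelLie (G.toLie x) (v ⊗ₜ 1, 0) = (V.l x v ⊗ₜ 1, 0)
    simp [modelLie, der_one, lieOn_toLie]
  | act_gen_sym h hi hp hn x v =>
    subst hi
    change V.modelGen x (0, V.anti.mkQ v) = ((-V.r v x) ⊗ₜ 1, 0)
    simp [modelGen, symR_mk, TensorProduct.neg_tmul]
  | act_lie_sym h hi hp hn x v =>
    subst hi
    change V.modelLie (G.toLie x) (0, V.anti.mkQ v) = (0, V.anti.mkQ (V.l x v))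
    simp [modelLie, lieOn_toLie]

/-- The map from `E(m)` to the model `m ⊗ T(g) ⊕ m_symm`. -/
def toModel (p : ℤ) : V.E.X p →ₗ[k] (m ⊗[k] TensorAlgebra k g) × V.Symm where
  toFun := Quotient.lift modelPre fun _ _ r => modelPre_rel r
  map_add' := by rintro ⟨a⟩ ⟨b⟩; rfl
  map_smul' := by rintro c ⟨a⟩; rfl

lemma toModel_eGen (v : m) : V.toModel 0 (V.eGen v) = (v ⊗ₜ 1, 0) := rfl

lemma toModel_act {i p q : ℤ} (h : i + p = q) (x : G.E.X i) (e : V.E.X p) :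
    V.toModel q (V.E.act h x e) = V.modelE i x (V.toModel p e) := by
  obtain ⟨a, rfl⟩ := Emk_surj e
  rfl

/-- The sign of the right action of `n` elements of `g` on an element of degree `p`. -/
def ractSign (k : Type*) [Field k] : ℤ → ℕ → k
  | _, 0 => 1
  | p, n + 1 => sgn k (1 * p + 1) * ractSign k (1 + p) n

lemma ractSign_mul_self (p : ℤ) (n : ℕ) : ractSign k p n * ractSign k p n = 1 := by
  induction n generalizing p with
  | zero => simp [ractSign]
  | succ n ih => rw [ractSign, mul_mul_mul_comm, ih, sgn_mul_self, one_mul]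

/-- The map from the total space of `E(m)` to the model. -/
def totModel : V.E.Tot →ₗ[k] (m ⊗[k] TensorAlgebra k g) × V.Symm :=
  DirectSum.toModule k ℤ _ V.toModel

lemma totModel_of {p : ℤ} (e : V.E.X p) : V.totModel (V.E.of p e) = V.toModel p e := by
  simp [totModel]

/-- Right multiplication by a letter is its left action with a sign that depends on the current
degree, and in the model the left action appends the letter. Each letter raises the degree `p` by
one, so `p` varies in the induction. -/
lemma totModel_rightAct {n : ℕ} (x : Fin n → g) {p : ℤ} (e : V.E.X p) (v : m)
    (t : TensorAlgebra k g) (he : V.toModel p e = (v ⊗ₜ t, 0)) :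
    V.totModel ((V.E.rightAct (G.uProd x)).unop (V.E.of p e))
      = ractSign k p n • (v ⊗ₜ (t * TensorAlgebra.tprod k g n x), 0) := by
  induction n generalizing p e t with
  | zero => simp [uProd_zero, ractSign, totModel_of, he]
  | succ n ih =>
    rw [uProd_cons, map_mul, MulOpposite.unop_mul, Module.End.mul_apply, GrModule.rightAct_ι,
      V.E.totRact_of rfl, GrModule.ract, map_smul, map_smul, map_smul,
      ih (fun i => x i.succ) _ (t * TensorAlgebra.ι k (x 0)) (by
        rw [toModel_act, he, modelE_eGen, modelGen_apply]), smul_smul, ractSign]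
    simp [mul_assoc]

/-- The map `(E(m) ⊗_{E(g)} U(E(g)))_n → m ⊗ g^{⊗ n}`. -/
def tensDegTo (n : ℕ) : V.E.tensDeg n →ₗ[k] m ⊗[k] (⨂[k] (_ : Fin n), g) :=
  -- The sign accumulated by `n` right actions on degree `0` is its own inverse and is cancelled
  -- here.
  ractSign k 0 n • (LinearMap.lTensor m (tensorProj k g n) ∘ₗ LinearMap.fst k _ V.Symm
    ∘ₗ V.totModel ∘ₗ V.E.tensTo ∘ₗ (V.E.tensDeg n).subtype)

lemma tensDegTo_tensProd {n : ℕ} (v : m) (x : Fin n → g) :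
    V.tensDegTo n (V.tensProd v x) = v ⊗ₜ PiTensorProduct.tprod k x := by
  have h : V.totModel (V.E.tensTo (V.tensProd v x)) = _ :=
    V.totModel_rightAct x (V.eGen v) v 1 (V.toModel_eGen v)
  simp only [tensDegTo, LinearMap.smul_apply, LinearMap.comp_apply, Submodule.subtype_apply, h,
    LinearMap.fst_apply, map_smul, one_mul, LinearMap.lTensor_tmul,
    tensorProj_tprod, smul_smul, ractSign_mul_self, one_smul]

lemma tensDegTo_tensOf (n : ℕ) (t : m ⊗[k] (⨂[k] (_ : Fin n), g)) :
    V.tensDegTo n (V.tensOf n t) = t := by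
  have e : V.tensDegTo n ∘ₗ V.tensOf n = LinearMap.id := by
    ext v x
    change V.tensDegTo n (V.tensOf n (v ⊗ₜ PiTensorProduct.tprod k x)) = _
    rw [tensOf_tmul, tensDegTo_tensProd]
    rfl
  exact LinearMap.congr_fun e t

/-- The isomorphism of `(E(m) ⊗_{E(g)} U(E(g)))_n` with `m ⊗ g^{⊗ n}`. -/
noncomputable def tensEquiv (n : ℕ) : V.E.tensDeg n ≃ₗ[k] m ⊗[k] (⨂[k] (_ : Fin n), g) :=
  (LinearEquiv.ofBijective (V.tensOf n)
    ⟨Function.LeftInverse.injective (V.tensDegTo_tensOf n), V.tensOf_surjective n⟩).symm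

lemma tensEquiv_tensProd {n : ℕ} (v : m) (x : Fin n → g) :
    V.tensEquiv n (V.tensProd v x) = v ⊗ₜ PiTensorProduct.tprod k x := by
  rw [tensEquiv, LinearEquiv.symm_apply_eq]
  exact (V.tensOf_tmul v x).symm

/-- The summand `dv ⊗ x_0 w` equals `-[v, x_0] ⊗ w`. In `v ⊗ d(x_0 ⋯ x_n)` the factors `dx_j` are
absorbed into `v` by `v ⊗ dx_j w = -[x_j, v] ⊗ w`. -/
lemma tensDdeg_tensProd {n : ℕ} (v : m) (x : Fin (n + 1) → g) :
    V.E.tensDdeg (Nat.cast_succ n).symm (V.tensProd v x) =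
      V.tensProd (-V.r v (x 0)) (fun l => x l.succ)
      - ∑ j : Fin (n + 1), (-1 : k) ^ (j : ℕ) •
        V.tensProd (V.l (x j) v) (fun l => x (j.succAbove l))
      - ∑ j : Fin (n + 1), ∑ i : Fin n with i.castSucc < j, (-1 : k) ^ (j : ℕ) •
          V.tensProd v (Function.update (fun l => x (j.succAbove l)) i
            (G.opp.br (x i.castSucc) (x j))) := by
  apply Subtype.ext
  change V.E.tensD (V.E.tmk (V.eGen v) (G.uProd x)) = _
  have h2 : ∀ (y : g) (w : G.E.U), V.E.tmk (V.eGen v) (G.E.ι 0 (G.eLie (G.toLie y)) * w)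
      = -V.E.tmk (V.eGen (V.l y v)) w := fun y w => by
    rw [V.E.tmk_ι_mul (zero_add 0), ract_eGen_eLie, ← GrModule.tmkHom_apply, map_neg]
    rfl
  have h3 : ∀ w : G.E.U, V.E.tmk (V.eSym (V.anti.mkQ v)) (G.E.ι 1 (G.eGen (x 0)) * w)
      = V.E.tmk (V.eGen (-V.r v (x 0))) w := fun w => by
    rw [V.E.tmk_ι_mul (add_neg_cancel 1), ract_eSym_eGen, map_neg]
  rw [V.E.tensD_tmk (neg_add_cancel 1), d_eGen, sgn_eq_ite, if_pos (by simp), one_smul, dU_uProd,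
    uProd_cons, h3, ← GrModule.tmkHom_apply _ (V.eGen v)]
  simp only [map_sub, map_sum, map_smul, GrModule.tmkHom_apply, h2, smul_neg,
    Finset.sum_neg_distrib]
  push_cast
  rw [add_sub_assoc', ← sub_eq_add_neg]
  rfl

/-- The summand `j = 0`, which is `-[x_0, v]`, joins the term `-[v, x_0]` that comes from `dv`;
together they are minus the co-representation bracket of `v` with `x_0`. -/
lemma tensEquiv_tensDdeg (n : ℕ) (z : V.E.tensDeg (n + 1 : ℕ)) :
    V.tensEquiv n (V.E.tensDdeg (Nat.cast_succ n).symm z)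
      = -(LeftLeibniz.repEquivCorep V).homD n (V.tensEquiv (n + 1) z) := by
  have e : (V.tensEquiv n).toLinearMap ∘ₗ V.E.tensDdeg (Nat.cast_succ n).symm
      ∘ₗ V.tensOf (n + 1) = -(LeftLeibniz.repEquivCorep V).homD n := by
    ext v x
    change V.tensEquiv n (V.E.tensDdeg (Nat.cast_succ n).symm (V.tensOf (n + 1)
      (v ⊗ₜ PiTensorProduct.tprod k x))) = -(repEquivCorep V).homD n (v ⊗ₜ PiTensorProduct.tprod k x)
    rw [tensOf_tmul, RightLeibniz.Corep.homD_tmul, tensDdeg_tensProd, Fin.sum_univ_succ]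
    simp only [map_sub, map_add, map_sum, map_smul, tensEquiv_tensProd]
    have e1 : ∀ x v, (repEquivCorep V).l x v = -V.l x v := fun _ _ => rfl
    have e2 : ∀ x v, (repEquivCorep V).r v x = V.r v x + V.l x v := fun _ _ => rfl
    simp only [e1, e2, Fin.val_succ, pow_succ, mul_neg_one, neg_smul, Finset.sum_neg_distrib,
      Fin.val_zero, pow_zero, one_smul, Fin.succAbove_zero, TensorProduct.neg_tmul, smul_neg,
      TensorProduct.add_tmul]
    abel
  obtain ⟨t, rfl⟩ := (V.tensEquiv (n + 1)).symm.surjective z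
  rw [LinearEquiv.apply_symm_apply]
  exact LinearMap.congr_fun e t

end Model
end Rep
end LeftLeibniz
end Leib

/-! ### The cochain complex of a representation, with values in `M̄(m)`. -/

namespace Leib
namespace LeftLeibniz
namespace Rep

variable {k : Type*} [Field k] {g : Type*} [AddCommGroup g] [Module k g] {G : LeftLeibniz k g}
  {m : Type*} [AddCommGroup m] [Module k m] (V : G.Rep m)

/-- The inclusion of `M̄(m)_p` in `m^anti ⊕ m ⊕ m_symm`. -/
def MbarIncl (p : ℤ) : V.Mbar.X p →ₗ[k] V.W :=
  (V.MX p).subtype ∘ₗ V.M.truncIncl E_nonneg p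

lemma MbarIncl_injective (p : ℤ) : Function.Injective (V.MbarIncl p) := fun _ _ h =>
  Subtype.ext (Subtype.ext h)

lemma MbarIncl_mem (p : ℤ) (e : V.Mbar.X p) : V.MbarIncl p e ∈ V.MX p := e.1.2

lemma MbarIncl_of_neg {p : ℤ} (hp : p < 0) (e : V.Mbar.X p) : V.MbarIncl p e = 0 := by
  exact congrArg (V.MX p).subtype (e.2 hp)

/-- The operators of `E(g)` on `m^anti ⊕ m ⊕ m_symm`. -/
def actW (i : ℤ) : G.E.X i →ₗ[k] Module.End k V.W := V.opE i

lemma actW_eLie (a : G.LieQuot) : V.actW 0 (G.eLie a) = V.opLie a := rfl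

lemma actW_eGen (x : g) : V.actW 1 (G.eGen x) = V.opGen x := rfl

lemma actW_br {i j n : ℤ} (h : i + j = n) (x : G.E.X i) (y : G.E.X j) :
    V.actW n (G.E.br h x y) =
      V.actW i x * V.actW j y - sgn k (i * j) • (V.actW j y * V.actW i x) := V.opE_br h x y

lemma actW_mem {i p q : ℤ} (h : i + p = q) (x : G.E.X i) {z : V.W} (hz : z ∈ V.MX p) :
    V.actW i x z ∈ V.MX q := V.opE_mem h x hz

lemma MbarIncl_truncD {p q : ℤ} (h : q + 1 = p) (hq : 0 ≤ q) (e : V.Mbar.X p) :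
    V.MbarIncl q (V.M.truncD E_nonneg h e) = V.dW (V.MbarIncl p e) :=
  congrArg (V.MX q).subtype (V.M.truncD_coe E_nonneg h hq e)

lemma mem_MX_eq_zero {p : ℤ} (h : p ≠ 1) (h' : p ≠ 0) (h'' : p ≠ -1) {z : V.W}
    (hz : z ∈ V.MX p) : z = 0 :=
  Prod.ext (hz.1 h) (Prod.ext (hz.2.1 h') (hz.2.2 h''))

section Extension

variable {n : ℕ} (φ : MultilinearMap k (fun _ : Fin n => g) m)

/-- An `n`-linear map to `m`, as a map to `m^anti ⊕ m ⊕ m_symm`. -/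
def valW : MultilinearMap k (fun _ : Fin n => g) V.W :=
  (LinearMap.inr k V.anti (m × V.Symm) ∘ₗ LinearMap.inl k m V.Symm).compMultilinearMap φ

lemma valW_mem (x : Fin n → g) : V.valW φ x ∈ V.MX 0 :=
  ⟨fun _ => rfl, fun h => absurd rfl h, fun _ => rfl⟩

/-- The `(n + 1)`-linear map `(x_0, ..., x_n) ↦ (-1)^n x_0 φ(x_1, ..., x_n)`. -/
def valW' : MultilinearMap k (fun _ : Fin (n + 1) => g) V.W :=
  -- This value is forced by `f(x u) = (-1)^{n |x|} x f(u)` with `|x| = 1` and `|u| = n`.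
  sgn k n • LinearMap.uncurryMid (M := fun _ => g) 0 (opTerm V.opGen (V.valW φ))

lemma valW'_apply (x : Fin (n + 1) → g) :
    V.valW' φ x = sgn k n • V.opGen (x 0) (V.valW φ fun i => x i.succ) := by
  rw [valW', smul_apply, LinearMap.uncurryMid_apply]
  rfl

lemma valW'_mem (x : Fin (n + 1) → g) : V.valW' φ x ∈ V.MX 1 := by
  rw [valW'_apply]
  exact Submodule.smul_mem _ _ (V.actW_mem (add_zero 1) (G.eGen (x 0)) (V.valW_mem φ _))

/-- The map from `U(E(g))` to `m^anti ⊕ m ⊕ m_symm` that corresponds to an `n`-linear map. -/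
def extW : G.E.U →ₗ[k] V.W :=
  -- Two pieces suffice: words of length `n` go to degree `0` and words of length `n + 1` to degree
  -- `1`, and `M̄(m)` has no other degrees.
  uExt V.opLie V.opLie_lie (V.valW φ) + uExt V.opLie V.opLie_lie (V.valW' φ)

lemma extW_eLie_mul (a : G.LieQuot) (u : G.E.U) :
    V.extW φ (G.E.ι 0 (G.eLie a) * u) = V.opLie a (V.extW φ u) := by
  rw [extW, LinearMap.add_apply, LinearMap.add_apply, uExt_eLie_mul, uExt_eLie_mul, map_add]

lemma extW_uProd (x : Fin n → g) : V.extW φ (G.uProd x) = V.valW φ x := by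
  rw [extW, LinearMap.add_apply, uExt_uProd, uExt_uProd_of_ne _ _ _ (by omega), add_zero]

lemma extW_uProd_succ (x : Fin (n + 1) → g) : V.extW φ (G.uProd x) = V.valW' φ x := by
  rw [extW, LinearMap.add_apply, uExt_uProd, uExt_uProd_of_ne _ _ _ (by omega), zero_add]

lemma extW_eq_zero {q : ℤ} (h : q ≠ n) (h' : q ≠ n + 1) {u : G.E.U} (hu : u ∈ G.E.Udeg q) :
    V.extW φ u = 0 := by
  rw [extW, LinearMap.add_apply, uExt_eq_zero _ _ _ h hu,
    uExt_eq_zero _ _ _ (by push_cast; exact h') hu, add_zero]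

lemma extW_mem {p q : ℤ} (h : p + n = q) {u : G.E.U} (hu : u ∈ G.E.Udeg q) :
    V.extW φ u ∈ V.MX p := by
  -- The degree `p` part of `M(m)` is stable under `g_Lie`, so membership need only be checked on
  -- words in `g`.
  have key : ∀ (r : ℕ), (r : ℤ) = q → (∀ x : Fin r → g, V.extW φ (G.uProd x) ∈ V.MX p) →
      V.extW φ u ∈ V.MX p := by
    rintro r rfl hr
    rw [Udeg_eq_span] at hu
    induction hu using Submodule.span_induction with
    | mem u hu =>
      obtain ⟨a, x, rfl⟩ := hu
      induction a using UniversalEnvelopingAlgebra.induction_left with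
      | one => rw [map_one, one_mul]; exact hr x
      | smul c a ih => rw [map_smul, smul_mul_assoc, map_smul]; exact Submodule.smul_mem _ c ih
      | add a b iha ihb => rw [map_add, add_mul, map_add]; exact add_mem iha ihb
      | ι_mul a b ih =>
        rw [map_mul G.uLie, uLie_ι, mul_assoc, extW_eLie_mul]
        exact V.actW_mem (zero_add p) (G.eLie a) ih
    | zero => rw [map_zero]; exact zero_mem _
    | add a b _ _ ha hb => rw [map_add]; exact add_mem ha hb
    | smul c a _ ha => rw [map_smul]; exact Submodule.smul_mem _ c ha
  by_cases h0 : p = 0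
  · subst h0
    refine key n (by omega) fun x => ?_
    rw [extW_uProd]
    exact V.valW_mem φ x
  by_cases h1 : p = 1
  · subst h1
    refine key (n + 1) (by omega) fun x => ?_
    rw [extW_uProd_succ]
    exact V.valW'_mem φ x
  rw [V.extW_eq_zero φ (by omega) (by omega) hu]
  exact zero_mem _

/-- On words of length `n` this is the definition of the second piece. On longer words both sides
would have degree at least `2` in `M(m)`, hence vanish. -/
lemma extW_eGen_mul {q : ℤ} (hq : n ≤ q) (x : g) {u : G.E.U} (hu : u ∈ G.E.Udeg q) :
    V.extW φ (G.E.ι 1 (G.eGen x) * u) = sgn k n • V.opGen x (V.extW φ u) := by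
  lift q to ℕ using by omega
  rw [Udeg_eq_span] at hu
  induction hu using Submodule.span_induction with
  | mem u hu =>
    obtain ⟨a, y, rfl⟩ := hu
    induction a using UniversalEnvelopingAlgebra.induction_left generalizing x with
    | one =>
      rw [map_one, one_mul]
      have e : G.E.ι 1 (G.eGen x) * (G.uProd y : G.E.U)
          = G.uProd (Fin.cons x y : Fin (q + 1) → g) := by
        simp [uProd_cons]
      obtain rfl | hne := eq_or_ne q n
      · rw [e, extW_uProd_succ, extW_uProd, valW'_apply]
        simp
      · have h1 := V.extW_eq_zero φ (q := 1 + q) (by omega) (by omega)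
          (G.E.ι_mul_mem rfl (G.eGen x) (G.uProd y).2)
        have h2 := V.actW_mem (q := 1 + (q - n)) rfl (G.eGen x)
          (V.extW_mem φ (sub_add_cancel (q : ℤ) n) (G.uProd y).2)
        rw [h1]
        have h3 := V.mem_MX_eq_zero (by omega) (by omega) (by omega) h2
        rw [actW_eGen] at h3
        rw [h3, smul_zero]
    | smul c a ih =>
      rw [map_smul, smul_mul_assoc, mul_smul_comm, map_smul, map_smul, ih, map_smul, smul_comm]
    | add a b iha ihb =>
      rw [map_add, add_mul, mul_add, map_add, map_add, iha, ihb, map_add, smul_add]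
    | ι_mul a b ih =>
      -- With a factor `a` of `g_Lie` in front, `x a b = a x b - (a · x) b`; the induction
      -- hypothesis is applied to `x` and to `a · x`, and the results recombine because the operator
      -- of `a · x` is the commutator of those of `a` and `x`.
      rw [map_mul G.uLie, uLie_ι, mul_assoc, ← mul_assoc (G.E.ι 1 _), ι_gen_mul_lie, sub_mul,
        map_sub, ih, mul_assoc, extW_eLie_mul, extW_eLie_mul, ih, opGen_lieAct, map_smul, ← smul_sub]
      simp
  | zero => simp
  | add a b _ _ ha hb => rw [mul_add, map_add, map_add, map_add, ha, hb, smul_add]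
  | smul c a _ ha => rw [mul_smul_comm, map_smul, map_smul, map_smul, ha, smul_comm]

/-- Compatibility with `x` and with `y` gives compatibility with their graded commutator. The inner
letter changes the degree of the argument, so the induction is over all `u` of degree at least `n`.
-/
lemma extW_ι_mul {i q : ℤ} (hq : n ≤ q) (x : G.E.X i) {u : G.E.U} (hu : u ∈ G.E.Udeg q) :
    V.extW φ (G.E.ι i x * u) = sgn k (n * i) • V.actW i x (V.extW φ u) := by
  induction x using LeftLeibniz.E_induction generalizing q u with
  | zero i => simp
  | add i x y hx hy =>
    simp only [map_add, add_mul, LinearMap.add_apply, hx hq hu, hy hq hu, smul_add]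
  | smul i c x hx =>
    simp only [map_smul, smul_mul_assoc, LinearMap.smul_apply, hx hq hu, smul_comm c]
  | lie a => rw [extW_eLie_mul, actW_eLie, mul_zero, sgn_eq_ite, if_pos (by simp), one_smul]
  | gen x => rw [V.extW_eGen_mul φ hq x hu, mul_one, actW_eGen]
  | br i j r hij x y hx hy =>
    -- Only letters of non-negative degree remain, so `x u` and `y u` still have degree at least `n`
    -- and the induction hypotheses apply to them.
    rcases lt_or_ge i 0 with hi | hi
    · simp [E_nonneg i hi x]
    rcases lt_or_ge j 0 with hj | hj
    · simp [E_nonneg j hj y]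
    rw [← G.E.ι_br hij, sub_mul, smul_mul_assoc, mul_assoc, mul_assoc, map_sub, map_smul,
      hx (by omega) (G.E.ι_mul_mem rfl y hu), hy (by omega) (G.E.ι_mul_mem rfl x hu), hx hq hu,
      hy hq hu, actW_br, map_smul, map_smul]
    subst hij
    by_cases pi : Even i <;> by_cases pj : Even j <;> by_cases pn : Even n <;>
      simp [sgn_eq_ite, parity_simps, pi, pj, pn] <;> abel

/-- The element of `Hom(U(E(g)), M̄(m))` that corresponds to an `n`-linear map. -/
def homOf : V.Mbar.homDeg n :=
  ⟨fun z => LinearMap.codRestrict _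
      (LinearMap.codRestrict (V.MX z.1.1) (V.extW φ ∘ₗ (G.E.Udeg z.1.2).subtype)
        fun u => V.extW_mem φ z.2 u.2 : G.E.Udeg z.1.2 →ₗ[k] V.M.X z.1.1)
      -- For `p < 0` the argument has degree `q < n`, where the extension vanishes; so the values
      -- lie in the truncation.
      fun u hz => Subtype.ext (V.extW_eq_zero φ (by have := z.2; omega) (by have := z.2; omega) u.2),
    fun i p q s r hr hs hpq hsr hn x u => Subtype.ext (Subtype.ext (V.extW_ι_mul φ hn x u.2))⟩

end Extension

section Equiv

variable {n : ℕ}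

/-- The `n`-linear map of an element of `Hom(U(E(g)), M̄(m))`. -/
def homTo (n : ℕ) : V.Mbar.homDeg n →ₗ[k] MultilinearMap k (fun _ : Fin n => g) m where
  toFun f := (V.Mbar₀ ∘ₗ f.1 ⟨(0, n), zero_add _⟩).compMultilinearMap (G.uMulDeg n)
  map_add' f f' := by ext x; exact map_add V.Mbar₀ _ _
  map_smul' c f := by ext x; exact map_smul V.Mbar₀ _ _

lemma homTo_apply (f : V.Mbar.homDeg n) (x : Fin n → g) :
    V.homTo n f x = V.Mbar₀ (f.1 ⟨(0, n), zero_add _⟩ (G.uProd x)) := by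
  rw [← uMulDeg_apply]; rfl

lemma homTo_surjective : Function.Surjective (V.homTo n) := fun φ =>
  ⟨V.homOf φ, by
    ext x
    rw [homTo_apply]
    change (V.extW φ (G.uProd x)).2.1 = φ x
    rw [extW_uProd]
    rfl⟩

/-- The value of an element of `Hom(U(E(g)), M̄(m))` in `m^anti ⊕ m ⊕ m_symm`. -/
def homVal (f : V.Mbar.homDeg n) {p q : ℤ} (h : p + n = q) : G.E.Udeg q →ₗ[k] V.W :=
  V.MbarIncl p ∘ₗ f.1 ⟨(p, q), h⟩

lemma homVal_mulUdeg (f : V.Mbar.homDeg n) {i p q s r : ℤ} (hr : i + q = r) (hs : i + p = s)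
    (hpq : p + n = q) (hsr : s + n = r) (hn : n ≤ q) (x : G.E.X i) (u : G.E.Udeg q) :
    V.homVal f hsr (G.E.mulUdeg hr x u) = sgn k (n * i) • V.actW i x (V.homVal f hpq u) := by
  rw [homVal, LinearMap.comp_apply, f.2 i p q s r hr hs hpq hsr hn x u, map_smul]
  rfl

lemma homVal_lieMul (f : V.Mbar.homDeg n) {p q : ℤ} (h : p + n = q) (hn : n ≤ q) (a : G.LieQuot)
    (u : G.E.Udeg q) :
    V.homVal f h (G.lieMul q a u) = V.opLie a (V.homVal f h u) := by
  refine (V.homVal_mulUdeg f (zero_add q) (zero_add p) h h hn (G.eLie a) u).trans ?_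
  rw [mul_zero, sgn_eq_ite, if_pos (by simp), one_smul, actW_eLie]

lemma uProd_succ_eq {r : ℤ} (x : Fin (n + 1) → g) (h : 1 + (n : ℤ) = r) (hx) :
    (⟨G.uProd x, hx⟩ : G.E.Udeg r) = G.E.mulUdeg h (G.eGen (x 0)) (G.uProd fun i => x i.succ) :=
  Subtype.ext (uProd_cons x)

lemma homVal_uProd_succ (f : V.Mbar.homDeg n) (x : Fin (n + 1) → g) :
    V.homVal f (by push_cast; ring : 1 + (n : ℤ) = (n + 1 : ℕ)) (G.uProd x) =
      sgn k n • V.opGen (x 0) (V.homVal f (zero_add _) (G.uProd fun i => x i.succ)) := by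
  have h : 1 + (n : ℤ) = (n + 1 : ℕ) := by push_cast; ring
  refine (congrArg _ (uProd_succ_eq x h (G.uProd x).2)).trans ?_
  rw [V.homVal_mulUdeg f h (add_zero 1) (zero_add _) h le_rfl, mul_one, actW_eGen]

/-- If the values on words of length `n` vanish, `g_Lie`-linearity gives zero on all of degree `n`.
Then `f(x u) = (-1)^n x f(u)` gives zero in degree `n + 1`, and in all other degrees the target is
zero. -/
lemma homTo_injective : Function.Injective (V.homTo n) := by
  rw [← LinearMap.ker_eq_bot, LinearMap.ker_eq_bot']
  intro f hf
  have h0 : V.homVal f (zero_add (n : ℤ)) = 0 := by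
    refine Udeg_hom_ext V.opLie (fun a u => V.homVal_lieMul f _ le_rfl a u) (fun a u => by simp)
      fun x => ?_
    have hx := MultilinearMap.congr_fun hf x
    rw [homTo_apply] at hx
    have hm := V.MbarIncl_mem 0 (f.1 ⟨(0, n), zero_add _⟩ (G.uProd x))
    exact Prod.ext (hm.1 (by omega)) (Prod.ext hx (hm.2.2 (by omega)))
  have h1 : V.homVal f (by push_cast; ring : 1 + (n : ℤ) = (n + 1 : ℕ)) = 0 := by
    refine Udeg_hom_ext V.opLie (fun a u => V.homVal_lieMul f _ (by omega) a u)
      (fun a u => by simp) fun x => ?_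
    rw [homVal_uProd_succ, h0]
    simp
  apply Subtype.ext
  funext ⟨⟨p, q⟩, hpq⟩
  ext u : 1
  apply V.MbarIncl_injective
  change V.homVal f hpq u = 0
  dsimp only at hpq
  rcases lt_or_ge p 0 with hp | hp
  · exact V.MbarIncl_of_neg hp _
  obtain rfl | hp0 := eq_or_ne p 0
  · obtain rfl : q = n := by omega
    exact LinearMap.congr_fun h0 u
  obtain rfl | hp1 := eq_or_ne p 1
  · obtain rfl : q = (n + 1 : ℕ) := by push_cast; omega
    exact LinearMap.congr_fun h1 u
  exact V.mem_MX_eq_zero hp1 hp0 (by omega) (V.MbarIncl_mem p _)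

/-- The isomorphism of `Hom^n(U(E(g)), M̄(m))` with the space of `n`-linear maps. -/
noncomputable def homEquiv (n : ℕ) :
    V.Mbar.homDeg n ≃ₗ[k] MultilinearMap k (fun _ : Fin n => g) m :=
  LinearEquiv.ofBijective (V.homTo n) ⟨V.homTo_injective, V.homTo_surjective⟩

lemma homEquiv_apply (f : V.Mbar.homDeg n) (x : Fin n → g) :
    V.homEquiv n f x = V.Mbar₀ (f.1 ⟨(0, n), zero_add _⟩ (G.uProd x)) := V.homTo_apply f x

lemma homEquiv_eq_homVal (f : V.Mbar.homDeg n) (x : Fin n → g) :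
    V.homEquiv n f x = (V.homVal f (zero_add _) (G.uProd x)).2.1 := V.homEquiv_apply f x

/-- Transport between equal degrees that are not definitionally equal, such as `(n + 1) - 1` and
`n`. -/
lemma homVal_congr (f : V.Mbar.homDeg n) {p q p' q' : ℤ} (h : p + n = q) (h' : p' + n = q')
    (e : q = q') (u : G.E.Udeg q) (u' : G.E.Udeg q') (hu : (u : G.E.U) = u') :
    V.homVal f h u = V.homVal f h' u' := by
  subst e
  obtain rfl : p = p' := by omega
  obtain rfl := Subtype.ext hu
  rfl

/-- The condition `0 ≤ p` is essential: the truncated differential is zero on degree `0`, while `dW`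
is the full differential, which maps `m` to `m_symm`. -/
lemma homVal_homD (f : V.Mbar.homDeg n) {n' : ℕ} (hn : (n : ℤ) + 1 = n') {p q : ℤ}
    (h : p + n' = q) (hp : 0 ≤ p) (u : G.E.Udeg q) :
    V.homVal (V.M.homD E_nonneg hn f) h u
      = V.homVal f (by omega : p + n = q - 1) (G.E.dUdeg (sub_add_cancel q 1) u)
        - sgn k n • V.dW (V.homVal f (by omega : p + 1 + n = q) u) := by
  change V.MbarIncl p (_ - sgn k n • V.M.truncD E_nonneg rfl _) = _
  rw [map_sub, map_smul, V.MbarIncl_truncD rfl hp]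
  rfl

/-- The part `f ∘ d` contributes `(-1)^j [x_j, f(...)]` and minus the double sum. In `(-1)^n d ∘ f`
the value `f(x_0 w) = (-1)^n x_0 f(w)` brings a second sign, so it is `[x_0, f(w)] + [f(w), x_0]`.
Subtracting it cancels the summand `j = 0` and leaves `-[f(w), x_0]`, the first term of `-δ` for the
opposite representation. -/
lemma homEquiv_homD (f : V.Mbar.homDeg n) :
    V.homEquiv (n + 1) (V.M.homD E_nonneg (Nat.cast_succ n).symm f)
      = -V.opp.cohomD n (V.homEquiv n f) := by
  ext x
  have hq : ((n + 1 : ℕ) : ℤ) - 1 = n := by push_cast; ring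
  have h1 := V.homVal_congr f (by omega : 0 + (n : ℤ) = (n + 1 : ℕ) - 1) (zero_add (n : ℤ)) hq
    (G.E.dUdeg (sub_add_cancel _ 1) (G.uProd x)) (G.E.dUdeg (Nat.cast_succ n).symm (G.uProd x)) rfl
  have h2 := V.homVal_uProd_succ f x
  refine (congrArg (fun z : V.W => z.2.1) ((V.homVal_homD f (Nat.cast_succ n).symm (zero_add _)
    le_rfl (G.uProd x)).trans (congrArg₂ (fun z w => z - sgn k n • V.dW w) h1 h2))).trans ?_
  change _ = -V.opp.cohomFun (V.homEquiv n f) x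
  rw [dUdeg_uProd, RightLeibniz.Rep.cohomFun_apply, Fin.sum_univ_succ]
  simp only [map_sub, map_add, map_sum, map_smul, V.homVal_lieMul f _ le_rfl, homEquiv_eq_homVal]
  have e1 : ∀ y v, V.opp.l y v = V.r v y := fun _ _ => rfl
  have e2 : ∀ y v, V.opp.r v y = V.l y v := fun _ _ => rfl
  have e3 : ∀ (y : g) (z : V.W), (V.opLie (G.toLie y) z).2.1 = V.l y z.2.1 := fun _ _ => rfl
  have e4 : ∀ (y : g) (z : V.W), (V.dW (V.opGen y z)).2.1 = V.l y z.2.1 + V.r z.2.1 y :=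
    fun _ _ => rfl
  simp only [smul_smul, sgn_mul_self, one_smul, Prod.fst_sub, Prod.snd_sub, Prod.fst_add,
    Prod.snd_add, Prod.smul_fst, Prod.smul_snd, Prod.fst_neg, Prod.snd_neg, Prod.fst_sum,
    Prod.snd_sum, e1, e2, e3, e4, Fin.val_succ, pow_succ, mul_neg_one, neg_smul, Finset.sum_neg_distrib,
    Fin.val_zero, pow_zero, Fin.succAbove_zero]
  abel

/-- The terms `f ∘ d ∘ d` and `d ∘ d ∘ f` vanish, and the two mixed terms `d ∘ f ∘ d` have opposite
signs because the degree of `f` changes by one. -/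
lemma homD_homD {n₁ n₂ : ℕ} (h : (n : ℤ) + 1 = n₁) (h' : (n₁ : ℤ) + 1 = n₂)
    (f : V.Mbar.homDeg n) :
    V.M.homD E_nonneg h' (V.M.homD E_nonneg h f) = 0 := by
  apply Subtype.ext
  funext ⟨⟨p, q⟩, hpq⟩
  ext u : 1
  apply V.MbarIncl_injective
  change V.homVal (V.M.homD E_nonneg h' (V.M.homD E_nonneg h f)) hpq u = 0
  dsimp only at hpq
  rcases lt_or_ge p 0 with hp | hp
  · exact V.MbarIncl_of_neg hp _
  have hs : sgn k (n₁ : ℤ) = -sgn k n := by rw [← h, sgn_add_one]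
  rw [V.homVal_homD _ _ _ hp, V.homVal_homD _ _ _ hp, V.homVal_homD _ _ _ (by omega),
    G.E.dUdeg_dUdeg, map_sub, map_smul, V.dW_dW, hs]
  simp

end Equiv
end Rep
end LeftLeibniz
end Leib

theorem mainTheorem2 {k : Type*} [Field k] [CharZero k]
    {g : Type*} [AddCommGroup g] [Module k g] (G : LeftLeibniz k g) :
    -- `U(E(g)) = U(g_Lie) ⊗ T(g)` as graded left `U(g_Lie)`-modules
    (∃ Φ : (UniversalEnvelopingAlgebra k G.LieQuot ⊗[k] TensorAlgebra k g)
          ≃ₗ[UniversalEnvelopingAlgebra k G.LieQuot] G.E.U,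
        (∀ a t, Φ (a ⊗ₜ t) = G.uLie a * G.uGen t) ∧
        (∀ (n : ℕ) (u : G.E.U), u ∈ G.E.Udeg n ↔
          Φ.symm u ∈ LinearMap.range (LinearMap.lTensor (UniversalEnvelopingAlgebra k G.LieQuot)
            (LinearMap.range (TensorAlgebra.ι k : g →ₗ[k] TensorAlgebra k g) ^ n).subtype)) ∧
        ∀ n < 0, G.E.Udeg n = ⊥) ∧
    -- coefficients in a `g_Lie`-module
    (∀ (m : Type*) [AddCommGroup m] [Module k m] [LieRingModule G.LieQuot m]
        [LieModule k G.LieQuot m],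
      (∃ e : ∀ n : ℕ, G.LieTens m n ≃ₗ[k] m ⊗[k] (⨂[k] (_ : Fin n), g),
        (∀ (n : ℕ) (v : m) (x : Fin n → g),
          e n (G.lieTmk v (G.uProd x)) = v ⊗ₜ PiTensorProduct.tprod k x) ∧
        ∀ (n : ℕ) (z : G.LieTens m (n + 1 : ℕ)),
          e n (G.lieTensD m (Nat.cast_succ n).symm z)
            = -(G.lieCorep m).homD n (e (n + 1) z)) ∧
      (∀ (n : ℕ) (z : G.LieTens m (n + 2 : ℕ)),
        G.lieTensD m (Nat.cast_succ n).symm (G.lieTensD m (Nat.cast_succ (n + 1)).symm z) = 0) ∧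
      (∃ e : ∀ n : ℕ, G.lieHom m n ≃ₗ[k] MultilinearMap k (fun _ : Fin n => g) m,
        (∀ (n : ℕ) (f : G.lieHom m n) (x : Fin n → g), e n f x = f.1 (G.uProd x)) ∧
        ∀ (n : ℕ) (f : G.lieHom m n),
          e (n + 1) (G.lieHomD m (Nat.cast_succ n).symm f)
            = -(G.lieRep m).opp.cohomD n (e n f)) ∧
      ∀ (n : ℕ) (f : G.lieHom m n),
        G.lieHomD m (Nat.cast_succ (n + 1)).symm (G.lieHomD m (Nat.cast_succ n).symm f) = 0) ∧
    -- coefficients in a representation of `g`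
    (∀ (m : Type*) [AddCommGroup m] [Module k m] (V : G.Rep m),
      (∀ n : ℕ, Function.Bijective (V.E.truncTensDeg LeftLeibniz.E_nonneg n)) ∧
      (∃ e : ∀ n : ℕ, V.E.tensDeg n ≃ₗ[k] m ⊗[k] (⨂[k] (_ : Fin n), g),
        (∀ (n : ℕ) (v : m) (x : Fin n → g),
          e n (V.tensProd v x) = v ⊗ₜ PiTensorProduct.tprod k x) ∧
        ∀ (n : ℕ) (z : V.E.tensDeg (n + 1 : ℕ)),
          e n (V.E.tensDdeg (Nat.cast_succ n).symm z)
            = -(LeftLeibniz.repEquivCorep V).homD n (e (n + 1) z)) ∧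
      (∀ (n : ℕ) (z : V.E.tensDeg (n + 2 : ℕ)),
        V.E.tensDdeg (Nat.cast_succ n).symm (V.E.tensDdeg (Nat.cast_succ (n + 1)).symm z) = 0) ∧
      (∃ e : ∀ n : ℕ, V.Mbar.homDeg n ≃ₗ[k] MultilinearMap k (fun _ : Fin n => g) m,
        (∀ (n : ℕ) (f : V.Mbar.homDeg n) (x : Fin n → g),
          e n f x = V.Mbar₀ (f.1 ⟨(0, n), zero_add _⟩ (G.uProd x))) ∧
        ∀ (n : ℕ) (f : V.Mbar.homDeg n),
          e (n + 1) (V.M.homD LeftLeibniz.E_nonneg (Nat.cast_succ n).symm f)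
            = -V.opp.cohomD n (e n f)) ∧
      ∀ (n : ℕ) (f : V.Mbar.homDeg n),
        V.M.homD LeftLeibniz.E_nonneg (Nat.cast_succ (n + 1)).symm
          (V.M.homD LeftLeibniz.E_nonneg (Nat.cast_succ n).symm f) = 0) := by
  refine ⟨⟨G.smashEquiv, fun a t => ?_, G.mem_Udeg_iff, fun n hn => LeftLeibniz.Udeg_eq_bot hn⟩,
    fun m _ _ _ _ => ⟨⟨G.lieTensEquiv m, G.lieTensEquiv_lieTmk m, G.lieTensEquiv_lieTensD m⟩,
      fun n z => G.lieTensD_lieTensD m _ _ z,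
      ⟨G.lieHomEquiv m, G.lieHomEquiv_apply m, G.lieHomEquiv_lieHomD m⟩,
      fun n f => G.lieHomD_lieHomD m _ _ f⟩,
    fun m _ _ V => ⟨fun n => V.E.truncTensDeg_bijective LeftLeibniz.E_nonneg (Int.natCast_nonneg n),
      ⟨V.tensEquiv, fun n => V.tensEquiv_tensProd, V.tensEquiv_tensDdeg⟩,
      fun n z => V.E.tensDdeg_tensDdeg _ _ z,
      ⟨V.homEquiv, fun n => V.homEquiv_apply, fun n => V.homEquiv_homD⟩,
      fun n f => V.homD_homD _ _ f⟩⟩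
  rw [LeftLeibniz.smashEquiv_apply, LeftLeibniz.smash_tmul]
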